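/- **Setting.** Let $S$ be an oriented surface with finitely many (at least one) punctures, and let $G\subset S$ be a finite connected graph with at least one edge, embedded in $S$ so that each component of $S\setminus G$ is a once-punctured disc (so $S$ deformation retracts onto $G$). Let $F:S\to S$ be a homeomorphism and let $f:G\to G$ be a map that takes vertices to vertices and each edge to a nondegenerate edge path. We say that $f$ *represents* the pseudo-Anosov mapping class $[F]$ if * $[F]$ is pseudo-Anosov, i.e. $F$ is isotopic to an orientation-preserving homeomorphism preserving a pair of transverse measured singular foliations (finitely many singularities, with at least three prongs in the interior and at least one prong at each puncture), and multiplying the two transverse measures by $\lambda$ and $1/\lambda$ for some $\lambda>1$; * $f$ is a train track map: for all $r\ge 1$ and every edge $e$ the path $f^r(e)$ has no backtracking, and every edge of $G$ is crossed by the image of some edge; * $f$ is induced by an orientation-preserving, fibre-preserving embedding of the fibred ribbon neighbourhood of $G$ (a disc for each vertex, a strip for each edge) into itself; * $F|_G$ is homotopic, as a map $G\to S$, to $f:G\to G\subset S$. **The train track.** Two edge ends at a vertex are in the same *gate* if for some $r>0$ their images under $f^r$ have a nontrivial common initial segment. Two different gates at a vertex are joined by an *infinitesimal edge* if for some $r>0$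 and some edge $e$ the path $f^r(e)$ takes a turn between them. The train track $\tau$ has the gates as switches, and as branches the edges of $G$ (real edges) and the infinitesimal edges. Let $W(\tau)$ be the space of real branch weights such that at each gate the total weight of the real edge ends equals the total weight of the infinitesimal edge ends, let $V(G)$ be the space of real edge weights on $G$, and let $W(G,f)\subset V(G)$ be the space of edge weights that extend to elements of $W(\tau)$. On $W(\tau)$ there is the skew-symmetric form $$\langle\eta,\zeta\rangle=\frac12\sum_{\text{switches}}\ \sum_{b<b'}\bigl(\eta(b)\zeta(b')-\eta(b')\zeta(b)\bigr),$$ where the inner sum is over pairs of branch ends $b<b'$ on the same side of the switch, ordered counterclockwise. The form on $W(G,f)$ is computed through lifts to $W(\tau)$, and its radical is the space $Z\subset W(G,f)$ of those $\eta$ that have a lift to $W(\tau)$ pairing to zero with every lift of every $\zeta\in W(G,f)$. Let $f_*:V(G)\to V(G)$ be given by the transition matrix of $f$, whose $(i,j)$ entry is the number of times $f(e_j)$ passes over $e_i$ in either direction. The characteristic polynomials of $f_*$ on $W(G,f)$, on $Z$ and on $W(G,f)/Z$ are the *homology*, *puncture* and *symplectic* polynomials of $f$. **Statement.** Let $f:G\to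 G$ represent the pseudo-Anosov mapping class $[F]$ and let $n>0$. Then $f^n$ represents the pseudo-Anosov mapping class $[F^n]$, and the train track of $f^n$ is the same $\tau$ as that of $f$ (same gates and same infinitesimal edges); in particular $W(G,f^n)=W(G,f)$, with the same $Z$. Both $f_*$ and $(f^n)_*$ map $W(G,f)$ into itself and $Z$ into itself. If $$\chi(f_*|_{W(G,f)/Z})=\prod_i(x-z_i),\qquad \chi(f_*|_Z)=\prod_j(x-w_j)\qquad(z_i,w_j\in\mathbb C),$$ then $$\chi(f^n_*|_{W(G,f)/Z})=\prod_i(x-z_i^n),\qquad \chi(f^n_*|_Z)=\prod_j(x-w_j^n),$$ $$\chi(f^n_*|_{W(G,f)})=\prod_i(x-z_i^n)\,\prod_j(x-w_j^n).$$ -/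

import Mathlib

open Polynomial Topology

noncomputable section

/-! ## Ribbon graphs and the punctured surfaces they span -/

/-- A finite connected graph with at least one edge, together with a cyclic order of the edge ends
at every vertex (the order induced by an embedding in an oriented surface). A *dart* is an oriented
edge, based at its initial vertex; `rev` reverses orientation; `next d` is the dart that follows `d`
counterclockwise around the initial vertex of `d`. So vertices are the cycles of `next`, and edges
are the pairs `{d, rev d}`. -/
structure RibbonGraph where
  Dart : Type
  [fintypeDart : Fintype Dart]
  [decEqDart : DecidableEq Dart]
  [nonemptyDart : Nonempty Dart]
  rev : Dart → Dart
  rev_rev : ∀ d, rev (rev d) = d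
  rev_ne : ∀ d, rev d ≠ d
  next : Equiv.Perm Dart
  connected : ∀ d d', Relation.ReflTransGen (fun a b => b = rev a ∨ b = next a) d d'

attribute [instance] RibbonGraph.fintypeDart RibbonGraph.decEqDart RibbonGraph.nonemptyDart

namespace RibbonGraph

variable (G : RibbonGraph)

/-- Darts carry the discrete topology. -/
instance : TopologicalSpace G.Dart := ⊥

/-- Two darts have the same initial vertex. -/
def SameVertex (d d' : G.Dart) : Prop := G.next.SameCycle d d'

/-- The number of counterclockwise steps from `a` to `b` around their common initial vertex
(and `0` if they have different initial vertices). -/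
def steps (a b : G.Dart) : ℕ := sInf {i : ℕ | (G.next ^ i) a = b}

/-- `a, b, c` are distinct darts at one vertex, met in this counterclockwise order. -/
def Ccw (a b c : G.Dart) : Prop := 0 < G.steps a b ∧ G.steps a b < G.steps a c

/-- The setoid whose classes are the unoriented edges `{d, rev d}`. -/
def edgeSetoid : Setoid G.Dart where
  r d d' := d' = d ∨ d' = G.rev d
  iseqv :=
    { refl := fun _ => Or.inl rfl
      symm := by
        rintro a b (rfl | rfl)
        · exact Or.inl rfl
        · exact Or.inr (G.rev_rev a).symm
      trans := by
        rintro a b c (rfl | rfl) (rfl | rfl)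
        · exact Or.inl rfl
        · exact Or.inr rfl
        · exact Or.inr rfl
        · exact Or.inl (G.rev_rev a) }

/-- Unoriented edges. -/
def Edge : Type := Quotient G.edgeSetoid

instance : Finite G.Edge := inferInstanceAs (Finite (Quotient G.edgeSetoid))
instance : Fintype G.Edge := Fintype.ofFinite _
instance : DecidableEq G.Edge := Classical.decEq _

/-- The unoriented edge underlying a dart. -/
def edge (d : G.Dart) : G.Edge := Quotient.mk G.edgeSetoid d

/-- The space `V(G)` of real edge weights. -/
def Weights : Type := G.Edge → ℝ

instance : AddCommGroup G.Weights := inferInstanceAs (AddCommGroup (G.Edge → ℝ))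
instance : Module ℝ G.Weights := inferInstanceAs (Module ℝ (G.Edge → ℝ))
instance : FiniteDimensional ℝ G.Weights := inferInstanceAs (FiniteDimensional ℝ (G.Edge → ℝ))

/-- The gluing pattern of the surface of `G`. To the left side of every dart `d` one attaches a
half-open strip `[0,1] × [0,∞)` with base `[0,1] × {0}` on the edge; `(d, t, s)` is the point of the
strip of `d` at parameter `t` along `d` and at distance `s` from the edge. The bases of `d` and
`rev d` are the same edge, and the strip of `d` is followed, around the complementary region on its
left, by the strip of the next boundary dart `next⁻¹ (rev d)` of that region. -/
inductive Glue : G.Dart × unitInterval × NNReal → G.Dart × unitInterval × NNReal → Prop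
  | base (d : G.Dart) (t : unitInterval) : Glue (d, t, 0) (G.rev d, unitInterval.symm t, 0)
  | side (d : G.Dart) (s : NNReal) : Glue (d, 1, s) (G.next.symm (G.rev d), 0, s)

/-- The oriented surface of `G`: `G` with a half-open annulus, i.e. a once punctured disc, glued to
each of its boundary cycles. It has one puncture for each cycle, and `G` is a deformation retract.
-/
def Surface : Type := Quot G.Glue

instance : TopologicalSpace G.Surface := inferInstanceAs (TopologicalSpace (Quot G.Glue))

/-- The point at parameter `t` of the dart `d`, as a point of the surface. -/
def point (d : G.Dart) (t : unitInterval) : G.Surface := Quot.mk _ (d, t, 0)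

/-- The graph itself, as a subspace of its surface. -/
def spine : Set G.Surface := {x | ∃ d t, x = G.point d t}

/-- The point at parameter `t` of the dart `d`, as a point of the graph. -/
def spinePoint (d : G.Dart) (t : unitInterval) : G.spine := ⟨G.point d t, d, t, rfl⟩

end RibbonGraph

/-! ## Graph maps -/

/-- A map of graphs that takes vertices to vertices and every edge to an edge path, recorded by the
edge paths `path d`, which are nonempty. -/
structure GraphMap (G : RibbonGraph) where
  path : G.Dart → List G.Dart
  path_ne_nil : ∀ d, path d ≠ []
  /-- consecutive darts of `path d` fit together -/
  path_chain : ∀ d, (path d).IsChain fun x y => G.SameVertex (G.rev x) y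
  path_rev : ∀ d, path (G.rev d) = ((path d).map G.rev).reverse
  /-- the image of a vertex is well defined -/
  path_vertex : ∀ d d', G.SameVertex d d' →
    G.SameVertex ((path d).head (path_ne_nil d)) ((path d').head (path_ne_nil d'))

namespace GraphMap

variable {G : RibbonGraph}

/-- The initial dart of the image path. -/
def init (f : GraphMap G) (d : G.Dart) : G.Dart := (f.path d).head (f.path_ne_nil d)

theorem getLast_eq (f : GraphMap G) (d : G.Dart) :
    G.rev ((f.path d).getLast (f.path_ne_nil d)) = f.init (G.rev d) := by
  simp only [init, f.path_rev d, List.head_reverse, List.getLast_map]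

/-- The identity. -/
protected def id (G : RibbonGraph) : GraphMap G where
  path d := [d]
  path_ne_nil := by simp
  path_chain := by simp
  path_rev := by simp
  path_vertex := by simp

theorem flatMap_ne_nil (g : GraphMap G) {l : List G.Dart} (h : l ≠ []) :
    l.flatMap g.path ≠ [] := by
  obtain ⟨a, l, rfl⟩ := List.exists_cons_of_ne_nil h
  simp [g.path_ne_nil a]

theorem head_flatMap (g : GraphMap G) {l : List G.Dart} (h : l ≠ []) :
    (l.flatMap g.path).head (g.flatMap_ne_nil h) = g.init (l.head h) := by
  obtain ⟨a, l, rfl⟩ := List.exists_cons_of_ne_nil h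
  simp only [List.flatMap_cons, List.head_cons, init]
  exact List.head_append_of_ne_nil (g.path_ne_nil a)

theorem chain_flatMap (g : GraphMap G) {l : List G.Dart}
    (h : l.IsChain fun x y => G.SameVertex (G.rev x) y) :
    (l.flatMap g.path).IsChain fun x y => G.SameVertex (G.rev x) y := by
  induction l with
  | nil => simp
  | cons a l ih =>
    rw [List.flatMap_cons, List.isChain_append]
    refine ⟨g.path_chain a, ih h.tail, ?_⟩
    intro x hx y hy
    cases l with
    | nil => simp at hy
    | cons b l =>
      have hab : G.SameVertex (G.rev a) b := by
        rw [List.isChain_cons_cons] at h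
        exact h.1
      have hx' : (g.path a).getLast (g.path_ne_nil a) = x := by
        rw [List.getLast?_eq_some_getLast (g.path_ne_nil a)] at hx
        simpa using hx
      have hy' : g.init b = y := by
        have hne : (b :: l).flatMap g.path ≠ [] := g.flatMap_ne_nil (by simp)
        rw [List.head?_eq_some_head hne, g.head_flatMap (by simp)] at hy
        simpa using hy
      rw [← hx', ← hy', g.getLast_eq]
      exact g.path_vertex _ _ hab

theorem flatMap_rev (g : GraphMap G) (l : List G.Dart) :
    ((l.map G.rev).reverse).flatMap g.path = ((l.flatMap g.path).map G.rev).reverse := by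
  induction l with
  | nil => simp
  | cons a l ih =>
    simp only [List.map_cons, List.reverse_cons, List.flatMap_append, ih, List.flatMap_cons,
      List.map_append, List.reverse_append, List.flatMap_nil, List.append_nil, g.path_rev a]

/-- The composite `g ∘ f`. -/
def comp (g f : GraphMap G) : GraphMap G where
  path d := (f.path d).flatMap g.path
  path_ne_nil d := g.flatMap_ne_nil (f.path_ne_nil d)
  path_chain d := g.chain_flatMap (f.path_chain d)
  path_rev d := by rw [f.path_rev, g.flatMap_rev]
  path_vertex d d' h := by
    rw [g.head_flatMap (f.path_ne_nil d), g.head_flatMap (f.path_ne_nil d')]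
    exact g.path_vertex _ _ (f.path_vertex _ _ h)

/-- The iterates `f^n`. -/
def iterate (f : GraphMap G) : ℕ → GraphMap G
  | 0 => GraphMap.id G
  | n + 1 => f.comp (f.iterate n)

theorem init_iterate_succ (f : GraphMap G) (n : ℕ) (d : G.Dart) :
    (f.iterate (n + 1)).init d = f.init ((f.iterate n).init d) :=
  f.head_flatMap ((f.iterate n).path_ne_nil d)

theorem init_iterate_eq_of_le (f : GraphMap G) {m n : ℕ} (hmn : m ≤ n) {d d' : G.Dart}
    (h : (f.iterate m).init d = (f.iterate m).init d') :
    (f.iterate n).init d = (f.iterate n).init d' := by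
  induction n, hmn using Nat.le_induction with
  | base => exact h
  | succ n _ ih => rw [init_iterate_succ, init_iterate_succ, ih]

/-- The continuous map `φ` of the graph realizes `f`: on each edge it is a strictly monotone
parametrization `θ` of the image edge path, where the `i`-th dart of the path occupies `[i, i+1]`.
-/
def Realizes (f : GraphMap G) (φ : C(G.spine, G.spine)) : Prop :=
  ∀ d : G.Dart, ∃ θ : unitInterval → ℝ,
    Continuous θ ∧ StrictMono θ ∧ θ 0 = 0 ∧ θ 1 = (f.path d).length ∧
    ∀ (i : Fin (f.path d).length) (t s : unitInterval), θ t = (i : ℕ) + (s : ℝ) →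
      φ (G.spinePoint d t) = G.spinePoint ((f.path d).get i) s

/-- The transition matrix: its `(i, j)` entry counts how often the image of the edge `j` passes over
the edge `i`, in either direction. -/
def transition (f : GraphMap G) : Matrix G.Edge G.Edge ℕ := fun i j =>
  ((f.path j.out).map G.edge).count i

/-- The map `f_*` induced by `f` on the space of real edge weights. -/
def push (f : GraphMap G) : G.Weights →ₗ[ℝ] G.Weights :=
  (f.transition.map (Nat.cast : ℕ → ℝ)).mulVecLin

/-! ### Graph maps induced by fibre preserving embeddings of the ribbon neighbourhood

Let `N` be the ribbon neighbourhood of `G`: a disc for each vertex and a strip for each edge, fibred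
over `G` by the discs and by arcs across the strips. An orientation preserving embedding of `N` in
itself that takes fibres into fibres and induces `f` on `G` is recorded by the heights at which the
images of the strips cross each strip. -/

/-- The strand `(d, i)` is the part of the image of the strip of `d` that runs over the `i`-th dart
of `path d`, in the direction of that dart. -/
abbrev Strand (f : GraphMap G) : Type := Σ d : G.Dart, Fin (f.path d).length

/-- The dart over which a strand runs. -/
def Strand.over {f : GraphMap G} (x : f.Strand) : G.Dart := (f.path x.1).get x.2

/-- The initial strand of the image of `d`. -/
def firstStrand (f : GraphMap G) (d : G.Dart) : f.Strand :=
  ⟨d, ⟨0, List.length_pos_of_ne_nil (f.path_ne_nil d)⟩⟩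

/-- `y` is the strand `x` run backwards. -/
def IsReverse (f : GraphMap G) (x y : f.Strand) : Prop :=
  y.1 = G.rev x.1 ∧ (x.2 : ℕ) + (y.2 : ℕ) + 1 = (f.path x.1).length

/-- The initial ends of the strands `x` and `y` belong to one piece of the image of `N` inside a
vertex disc. That piece is either the image of a vertex disc, with an end for each dart at the
vertex, or a band that enters the disc along the `(i-1)`-st and leaves it along the `i`-th
dart of some `path d`, with the two ends `rev (d, i-1)` and `(d, i)`. -/
def SamePiece (f : GraphMap G) (x y : f.Strand) : Prop :=
  x = y ∨
  (∃ d d', G.SameVertex d d' ∧ x = f.firstStrand d ∧ y = f.firstStrand d') ∨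
  (∃ z : f.Strand, z.1 = x.1 ∧ (z.2 : ℕ) + 1 = x.2 ∧ f.IsReverse z y)

/-- The counterclockwise cyclic order of the initial ends of strands on the boundary of a vertex
disc. Ends over different darts are ordered as the darts are, and ends over the same
dart are ordered by increasing height. -/
def StrandCcw (f : GraphMap G) (height : f.Strand → ℝ) (x y z : f.Strand) : Prop :=
  G.SameVertex x.over y.over ∧ G.SameVertex y.over z.over ∧
  (G.Ccw x.over y.over z.over ∨
    (x.over = y.over ∧ y.over ≠ z.over ∧ height x < height y) ∨
    (y.over = z.over ∧ z.over ≠ x.over ∧ height y < height z) ∨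
    (z.over = x.over ∧ x.over ≠ y.over ∧ height z < height x) ∨
    (x.over = y.over ∧ y.over = z.over ∧
      ((height x < height y ∧ height y < height z) ∨ (height y < height z ∧ height z < height x) ∨
        (height z < height x ∧ height x < height y))))

/-- `f` is induced by an orientation preserving, fibre preserving embedding of the ribbon
neighbourhood. Here `height x` is the height, increasing from right to left as seen along `x`, at
which the strand `x` crosses the strip of the dart below it. -/
def IsEmbedded (f : GraphMap G) : Prop :=
  ∃ height : f.Strand → ℝ,
    -- running a strand backwards interchanges left and right
    (∀ x y, f.IsReverse x y → height y = - height x) ∧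
    -- different strands are disjoint in the strips
    (∀ x y : f.Strand, x.over = y.over → height x = height y → x = y) ∧
    -- different pieces are disjoint in the vertex discs: their ends do not separate each other
    (∀ x y z w, f.SamePiece x y → f.SamePiece z w → ¬ f.SamePiece x z →
      ¬ (f.StrandCcw height x z y ∧ f.StrandCcw height y w x)) ∧
    -- the embedding of each vertex disc preserves orientation
    (∀ a b c, G.Ccw a b c →
      f.StrandCcw height (f.firstStrand a) (f.firstStrand b) (f.firstStrand c))

end GraphMap

/-! ## Train tracks and their transverse measures -/

/-- A train track obtained from the ribbon graph `G` by splitting the edge ends at each vertex into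
gates and by joining some pairs of gates at the same vertex by infinitesimal edges. The
switches are the gates and the branches are the edges of `G` and the infinitesimal edges.
`joined d d'` says that the gates of `d` and `d'` are joined by an infinitesimal edge. -/
@[ext]
structure TrainTrack (G : RibbonGraph) where
  gate : Setoid G.Dart
  gate_vertex : ∀ d d', gate d d' → G.SameVertex d d'
  joined : G.Dart → G.Dart → Prop
  joined_symm : ∀ d d', joined d d' → joined d' d
  joined_congr : ∀ a b d, gate a b → joined a d → joined b d
  joined_vertex : ∀ d d', joined d d' → G.SameVertex d d'
  joined_ne : ∀ d d', joined d d' → ¬ gate d d'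

namespace TrainTrack

variable {G : RibbonGraph} (τ : TrainTrack G)

/-- The switches of `τ`, which are the gates. -/
def Switch : Type := Quotient τ.gate

instance : Finite τ.Switch := inferInstanceAs (Finite (Quotient τ.gate))
instance : Fintype τ.Switch := Fintype.ofFinite _

/-- The switch at which the dart `d` starts. -/
def switch (d : G.Dart) : τ.Switch := Quotient.mk τ.gate d

/-- The unordered pairs of switches joined by an infinitesimal edge. -/
def IsInfinitesimal (p : Sym2 τ.Switch) : Prop :=
  ∃ d d', τ.joined d d' ∧ p = s(τ.switch d, τ.switch d')

/-- The branches of `τ`: real edges and infinitesimal edges. -/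
abbrev Branch : Type := G.Edge ⊕ {p : Sym2 τ.Switch // τ.IsInfinitesimal p}

open Classical in
/-- The weight of the infinitesimal edge joining `g` to `h`, or `0` if there is none. -/
def infWeight (η : τ.Branch → ℝ) (g h : τ.Switch) : ℝ :=
  if hp : τ.IsInfinitesimal s(g, h) then η (Sum.inr ⟨s(g, h), hp⟩) else 0

theorem infWeight_add (η ζ : τ.Branch → ℝ) (g h : τ.Switch) :
    τ.infWeight (η + ζ) g h = τ.infWeight η g h + τ.infWeight ζ g h := by
  unfold infWeight; split_ifs <;> simp

theorem infWeight_smul (c : ℝ) (η : τ.Branch → ℝ) (g h : τ.Switch) :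
    τ.infWeight (c • η) g h = c * τ.infWeight η g h := by
  unfold infWeight; split_ifs <;> simp

open Classical in
/-- The space `W(τ)` of real branch weights satisfying the switch conditions: at each switch the
total weight of the real edge ends equals the total weight of the infinitesimal edge ends. -/
def measures : Submodule ℝ (τ.Branch → ℝ) where
  carrier := {η | ∀ g : τ.Switch,
    (∑ d : G.Dart, if τ.switch d = g then η (Sum.inl (G.edge d)) else 0) =
      ∑ h : τ.Switch, τ.infWeight η g h}
  zero_mem' := by intro _; simp [infWeight]
  add_mem' := by
    intro η ζ hη hζ g
    simp only [infWeight_add, Finset.sum_add_distrib, ← hη g, ← hζ g]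
    rw [← Finset.sum_add_distrib]
    refine Finset.sum_congr rfl fun d _ => ?_
    split_ifs <;> simp
  smul_mem' := by
    intro c η hη g
    simp only [infWeight_smul, ← Finset.mul_sum, ← hη g]
    rw [Finset.mul_sum]
    refine Finset.sum_congr rfl fun d _ => ?_
    split_ifs <;> simp

/-- Restriction of branch weights to the real edges; this is the map induced by the collapse of `τ`
to `G`. -/
def collapse : (τ.Branch → ℝ) →ₗ[ℝ] G.Weights := LinearMap.funLeft ℝ ℝ Sum.inl

/-- The space `W(G, f)`: the edge weights on `G` that extend to an element of `W(τ)`. -/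
def W : Submodule ℝ G.Weights := τ.measures.map τ.collapse

/-- `d` and `d'` are different darts in one gate, and `d'` comes after `d` in the counterclockwise
order of that gate: the counterclockwise walk from `d` to `d'` stays in the gate. -/
def Before (d d' : G.Dart) : Prop :=
  d ≠ d' ∧ G.SameVertex d d' ∧ ∀ i ≤ G.steps d d', τ.gate d ((G.next ^ i) d)

/-- `g, h, k` are different switches at one vertex, met in this counterclockwise order; so, seen from
`g`, the infinitesimal edge to `k` comes counterclockwise after the one to `h`. -/
def SwitchCcw (g h k : τ.Switch) : Prop :=
  g ≠ h ∧ h ≠ k ∧ k ≠ g ∧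
  ∃ a b c, τ.switch a = g ∧ τ.switch b = h ∧ τ.switch c = k ∧ G.Ccw a b c

open Classical in
/-- The skew-symmetric form on branch weights: half of the sum over all switches, over both sides of
the switch, and over all pairs of branch ends `b, b'` on that side with `b'` counterclockwise after
`b`, of the determinant `η b * ζ b' - η b' * ζ b`. -/
def form (η ζ : τ.Branch → ℝ) : ℝ :=
  (1 / 2) * ∑ g : τ.Switch,
    ((∑ d : G.Dart, ∑ d' : G.Dart,
        if τ.switch d = g ∧ τ.Before d d' then
          η (Sum.inl (G.edge d)) * ζ (Sum.inl (G.edge d')) -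
            η (Sum.inl (G.edge d')) * ζ (Sum.inl (G.edge d))
        else 0) +
      ∑ h : τ.Switch, ∑ k : τ.Switch,
        if τ.SwitchCcw g h k then
          τ.infWeight η g h * τ.infWeight ζ g k - τ.infWeight η g k * τ.infWeight ζ g h
        else 0)

theorem form_add (η ζ ξ : τ.Branch → ℝ) : τ.form ξ (η + ζ) = τ.form ξ η + τ.form ξ ζ := by
  simp only [form, ← mul_add, ← Finset.sum_add_distrib]
  congr 1
  refine Finset.sum_congr rfl fun g _ => ?_
  rw [add_add_add_comm]
  simp only [← Finset.sum_add_distrib, infWeight_add, Pi.add_apply]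
  congr 1 <;>
  · refine Finset.sum_congr rfl fun d _ => Finset.sum_congr rfl fun d' _ => ?_
    split_ifs <;> ring

theorem form_smul (c : ℝ) (η ξ : τ.Branch → ℝ) : τ.form ξ (c • η) = c * τ.form ξ η := by
  simp only [form]
  rw [mul_left_comm]
  congr 1
  simp only [Finset.mul_sum, mul_add, infWeight_smul, Pi.smul_apply, smul_eq_mul]
  refine Finset.sum_congr rfl fun g _ => ?_
  congr 1 <;>
  · refine Finset.sum_congr rfl fun d _ => Finset.sum_congr rfl fun d' _ => ?_
    split_ifs <;> ring

/-- The radical `Z` of the skew-symmetric form on `W(G, f)`. The value of the form on `ζ, η` in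
`W(G, f)` is the value on lifts `ζ', η'` in `W(τ)`; so `η` lies in the radical when it
has a lift that pairs to zero with all lifts of all `ζ` in `W(G, f)`. -/
def Z : Submodule ℝ τ.W where
  carrier := {η | ∃ η' ∈ τ.measures, τ.collapse η' = η ∧
    ∀ ζ ∈ τ.W, ∀ ζ' ∈ τ.measures, τ.collapse ζ' = ζ → τ.form ζ' η' = 0}
  zero_mem' := ⟨0, τ.measures.zero_mem, by simp, fun _ _ ζ' _ _ => by
    simpa using τ.form_smul 0 0 ζ'⟩
  add_mem' := by
    rintro a b ⟨a', ha, ha', ha''⟩ ⟨b', hb, hb', hb''⟩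
    refine ⟨a' + b', τ.measures.add_mem ha hb, by simp [ha', hb'], fun ζ hζ ζ' h1 h2 => ?_⟩
    rw [form_add, ha'' ζ hζ ζ' h1 h2, hb'' ζ hζ ζ' h1 h2, add_zero]
  smul_mem' := by
    rintro c a ⟨a', ha, ha', ha''⟩
    refine ⟨c • a', τ.measures.smul_mem c ha, by simp [ha'], fun ζ hζ ζ' h1 h2 => ?_⟩
    rw [form_smul, ha'' ζ hζ ζ' h1 h2, mul_zero]

end TrainTrack

namespace GraphMap

variable {G : RibbonGraph}

/-- Darts at one vertex are in the same gate when, for some `r > 0`, their images under `f^r` have a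
nontrivial common initial segment. -/
def gate (f : GraphMap G) : Setoid G.Dart where
  r d d' := G.SameVertex d d' ∧ ∃ r > 0, (f.iterate r).init d = (f.iterate r).init d'
  iseqv :=
    { refl := fun _ => ⟨Equiv.Perm.SameCycle.refl _ _, 1, one_pos, rfl⟩
      symm := fun ⟨h, r, hr, h'⟩ => ⟨Equiv.Perm.SameCycle.symm h, r, hr, h'.symm⟩
      trans := fun ⟨h, r, hr, h'⟩ ⟨k, s, _, k'⟩ =>
        ⟨Equiv.Perm.SameCycle.trans h k, max r s, lt_max_of_lt_left hr,
          (f.init_iterate_eq_of_le (le_max_left r s) h').trans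
            (f.init_iterate_eq_of_le (le_max_right r s) k')⟩ }

/-- The gates of `d` and `d'` are different and, for some `r > 0` and some edge `e`, the path
`f^r(e)` takes a turn from one of these gates to the other. -/
def Joined (f : GraphMap G) (d d' : G.Dart) : Prop :=
  ¬ f.gate d d' ∧ ∃ r > 0, ∃ e x y, [x, y] <:+: (f.iterate r).path e ∧
    ((f.gate d (G.rev x) ∧ f.gate d' y) ∨ (f.gate d y ∧ f.gate d' (G.rev x)))

/-- The train track `τ` of `f`. -/
def trainTrack (f : GraphMap G) : TrainTrack G where
  gate := f.gate
  gate_vertex _ _ h := h.1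
  joined := f.Joined
  joined_symm := by
    rintro _ _ ⟨h, r, hr, e, x, y, hxy, h'⟩
    refine ⟨fun k => h (f.gate.symm k), r, hr, e, x, y, hxy, ?_⟩
    tauto
  joined_congr := by
    rintro a b _ hab ⟨h, r, hr, e, x, y, hxy, h'⟩
    refine ⟨fun k => h (f.gate.trans hab k), r, hr, e, x, y, hxy, ?_⟩
    rcases h' with h' | h'
    · exact Or.inl ⟨f.gate.trans (f.gate.symm hab) h'.1, h'.2⟩
    · exact Or.inr ⟨f.gate.trans (f.gate.symm hab) h'.1, h'.2⟩
  joined_vertex := by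
    rintro d d' ⟨-, r, -, e, x, y, hxy, h'⟩
    have hv : G.SameVertex (G.rev x) y := by
      have := ((f.iterate r).path_chain e).infix hxy
      simpa using this
    rcases h' with ⟨h1, h2⟩ | ⟨h1, h2⟩
    · exact (h1.1.trans hv).trans h2.1.symm
    · exact (h1.1.trans hv.symm).trans h2.1.symm
  joined_ne _ _ h := h.1

/-- The subspace `W(G, f)` of the space of edge weights. -/
abbrev W (f : GraphMap G) : Submodule ℝ G.Weights := f.trainTrack.W

/-- The radical `Z` of the skew-symmetric form on `W(G, f)`. -/
abbrev Z (f : GraphMap G) : Submodule ℝ f.W := f.trainTrack.Z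

/-- `f_*` maps `W(G, f)` into itself and `Z` into itself, so that it acts on `W(G, f)`, on `Z` and
on `W(G, f) / Z`. -/
structure PreservesWZ (f : GraphMap G) : Prop where
  mapsW : ∀ η ∈ f.W, f.push η ∈ f.W
  mapsZ : ∀ η ∈ f.Z, f.push.restrict mapsW η ∈ f.Z

/-- The homology polynomial: the characteristic polynomial of `f_*` on `W(G, f)`. -/
def homologyPoly (f : GraphMap G) (h : f.PreservesWZ) : ℝ[X] :=
  (f.push.restrict h.mapsW).charpoly

/-- The puncture polynomial: the characteristic polynomial of `f_*` on `Z`. -/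
def puncturePoly (f : GraphMap G) (h : f.PreservesWZ) : ℝ[X] :=
  ((f.push.restrict h.mapsW).restrict h.mapsZ).charpoly

/-- The symplectic polynomial: the characteristic polynomial of `f_*` on `W(G, f) / Z`. -/
def symplecticPoly (f : GraphMap G) (h : f.PreservesWZ) : ℝ[X] :=
  (f.Z.mapQ f.Z (f.push.restrict h.mapsW) h.mapsZ).charpoly

end GraphMap

/-! ## Pseudo-Anosov mapping classes -/

/-- Two homeomorphisms are isotopic. -/
def Isotopic {S : Type*} [TopologicalSpace S] (F F' : S ≃ₜ S) : Prop :=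
  ∃ H : C(unitInterval × S, S), (∀ t, IsHomeomorph fun x => H (t, x)) ∧
    (∀ x, H (0, x) = F x) ∧ ∀ x, H (1, x) = F' x

/-- `φ` is a `k`-pronged coordinate away from the point `φ = 0`: the flat charts `ψ` satisfy
`(ψ - c) ^ 2 = φ ^ k` locally, with constants `c`. -/
def IsProngChart {S : Type*} [TopologicalSpace S] (charts : Set (OpenPartialHomeomorph S ℂ))
    (φ : OpenPartialHomeomorph S ℂ) (k : ℕ) : Prop :=
  ∀ x ∈ φ.source, φ x ≠ 0 → ∃ ψ ∈ charts, x ∈ ψ.source ∧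
    ∃ c : ℂ, ∀ᶠ y in 𝓝 x, (ψ y - c) ^ 2 = φ y ^ k

/-- A pair of transverse measured singular foliations on a punctured oriented surface, given by
charts in which the foliations are the horizontal and the vertical foliation of `ℂ`, with the
transverse measures `|dy|` and `|dx|`. There are finitely many singularities, with at
least three prongs each, and each puncture is a singularity with at least one prong. -/
structure MeasuredFoliationPair (S : Type*) [TopologicalSpace S] where
  sing : Set S
  sing_finite : sing.Finite
  charts : Set (OpenPartialHomeomorph S ℂ)
  source_subset : ∀ ψ ∈ charts, ψ.source ⊆ singᶜ
  cover : ∀ x ∉ sing, ∃ ψ ∈ charts, x ∈ ψ.source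
  compat : ∀ ψ ∈ charts, ∀ ψ' ∈ charts, ∀ x ∈ ψ.source ∩ ψ'.source,
    ∃ ε c : ℂ, (ε = 1 ∨ ε = -1) ∧ ∀ᶠ y in 𝓝 x, ψ' y = ε * ψ y + c
  prongs : ∀ p ∈ sing, ∃ (φ : OpenPartialHomeomorph S ℂ) (k : ℕ),
    3 ≤ k ∧ p ∈ φ.source ∧ φ p = 0 ∧ IsProngChart charts φ k
  punctures : ∃ (m : ℕ) (φ : Fin m → OpenPartialHomeomorph S ℂ) (k : Fin m → ℕ),
    (∀ j, 1 ≤ k j ∧ (φ j).target = Metric.ball 0 1 \ {0} ∧ IsProngChart charts (φ j) (k j)) ∧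
    IsCompact (⋃ j, {x ∈ (φ j).source | ‖φ j x‖ < 1 / 2})ᶜ

/-- `F` is a pseudo-Anosov homeomorphism, preserving orientation: it preserves a pair of transverse
measured foliations and multiplies one transverse measure by the dilatation `lam > 1` and the other
by `1 / lam`. -/
def IsPseudoAnosovHomeo {S : Type*} [TopologicalSpace S] (F : S ≃ₜ S) : Prop :=
  ∃ (Φ : MeasuredFoliationPair S) (lam : ℝ), 1 < lam ∧ (∀ x, F x ∈ Φ.sing ↔ x ∈ Φ.sing) ∧
    ∀ ψ ∈ Φ.charts, ∀ ψ' ∈ Φ.charts, ∀ x ∈ ψ.source, F x ∈ ψ'.source →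
      ∃ ε c : ℂ, (ε = 1 ∨ ε = -1) ∧ ∀ᶠ y in 𝓝 x,
        ψ' (F y) = ε * (⟨lam * (ψ y).re, lam⁻¹ * (ψ y).im⟩ : ℂ) + c

/-- The mapping class `[F]` is pseudo-Anosov. -/
def IsPseudoAnosovClass {S : Type*} [TopologicalSpace S] (F : S ≃ₜ S) : Prop :=
  ∃ F', Isotopic F F' ∧ IsPseudoAnosovHomeo F'

/-! ## Train track representatives -/

namespace GraphMap

variable {G : RibbonGraph}

/-- `f` is a train track map: the images of edges under all iterates have no backtracking, and no
edge is missed by `f`. -/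
structure IsTrainTrackMap (f : GraphMap G) : Prop where
  noBacktrack : ∀ r > 0, ∀ d, ((f.iterate r).path d).IsChain fun x y => y ≠ G.rev x
  surjective : ∀ d, ∃ e, d ∈ f.path e

/-- `f` represents the pseudo-Anosov mapping class of `F`. The surface `S` is identified by `ι` with
the surface of `G`, so that `G` is an embedded graph to which `S` retracts. -/
structure Represents (f : GraphMap G) {S : Type*} [TopologicalSpace S] (ι : G.Surface ≃ₜ S)
    (F : S ≃ₜ S) : Prop where
  pseudoAnosov : IsPseudoAnosovClass F
  trainTrack : f.IsTrainTrackMap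
  embedded : f.IsEmbedded
  /-- on `G`, the homeomorphism `F` is homotopic to `f` -/
  homotopic : ∃ φ : C(G.spine, G.spine), f.Realizes φ ∧
    ContinuousMap.Homotopic
      ((⟨fun x => F (ι x), by fun_prop⟩ : C(G.spine, S)))
      ((⟨fun x => ι (φ x), by fun_prop⟩ : C(G.spine, S)))

end GraphMap

end

noncomputable section

/-! ## Linear algebra -/

/-! The transition matrix counts passages without sign, so nothing cancels under composition and
`(f^n)_* = (f_*)^n`. Once `f` and `f^n` are known to have the same train track, hence the same `W`
and `Z`, and `f_*` is known to act on both, the polynomials are a matter of linear algebra. The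
roots of the characteristic polynomial of `A ^ n` are powers of those of `A`, because `x ^ n - A ^
n` is the product of `x - μ A` over the `n`-th roots of unity `μ`. The homology polynomial is the
product of the other two because `Z` is invariant.

Each condition in `Represents` passes to iterates. The foliations of a pseudo-Anosov homeomorphism
serve for its powers, with dilatation `lam ^ n`. A composite of ribbon embeddings is described by
the height of the `g`-strand plus `ε` times the height of the `f`-strand. For small `ε` this is a
lexicographic order, and noncrossing reduces to that of `g`, to that of `f`, or to parallel copies
of one band (`IsEmbedded.comp`). The track does not change: gates only record eventual coincidence
of initial darts, and a turn of `f^r(e)` recurs in a longer iterate because `e` itself is crossed by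
the image of some edge.

The main work is the invariance of `W` and `Z`. The action lifts to `W(τ)` as `pushMeasure`: an
infinitesimal edge receives the weights of the bands of the image that run along it and of the
infinitesimal edges mapped to it. A linear map that preserves a bilinear form on a finite
dimensional space preserves the radical, even if it is not known to be invertible. So everything
rests on `form_pushMeasure`, the invariance of the form.

For that, the darts are ordered linearly so that gates are intervals. Twice the form is then a sum
of signs: of pairs of real edge ends in a gate, and of cyclic orientations of the gates met by two
infinitesimal edges at a common gate. For pushed measures these become sums over pairs of strands
and pairs of chords in the vertex discs. Pairs inside one piece of the image give back the form of
the original measures, since the embedding preserves the cyclic order at each vertex. For pairs in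
different pieces the switch conditions replace strands by chords, and the four pairs of ends of two
disjoint chords contribute zero in total (`endPairing_sum_eq_zero`): the order in which two chords
leave a common gate is undone by the order in which they arrive. -/

theorem Matrix.eval_charpoly_pow_eq_prod {m : Type*} [Fintype m] [DecidableEq m] {k : ℕ}
    (A : Matrix m m ℂ) (z : Fin k → ℂ) (hA : A.charpoly = ∏ i, (X - C (z i))) {n : ℕ} (hn : 0 < n)
    (x : ℂ) : (A ^ n).charpoly.eval (x ^ n) = ∏ i, (x ^ n - z i ^ n) := by
  have hk : Fintype.card m = k := by
    have := A.charpoly_natDegree_eq_dim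
    rw [hA, natDegree_prod_of_monic _ _ fun i _ => monic_X_sub_C _] at this
    simpa using this.symm
  obtain ⟨ζ, hζ⟩ : ∃ ζ : ℂ, IsPrimitiveRoot ζ n :=
    ⟨_, Complex.isPrimitiveRoot_exp n hn.ne'⟩
  -- Pulling the nonzero scalar `μ` out of the matrix gives `μ ^ k` times the characteristic
  -- polynomial at `x / μ`, and the powers of `μ` are absorbed by the `k` linear factors.
  have key : ∀ μ ∈ Polynomial.nthRootsFinset n (1 : ℂ),
      (Matrix.scalar m x - μ • A).det = ∏ i, (x - μ * z i) := by
    intro μ hμ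
    have hμ0 : μ ≠ 0 := by
      rintro rfl
      rw [mem_nthRootsFinset hn] at hμ
      simp [hn.ne'] at hμ
    have h1 : Matrix.scalar m x - μ • A = μ • (Matrix.scalar m (x / μ) - A) := by
      rw [smul_sub]
      congr 1
      ext i j
      by_cases h : i = j
      · subst h; simp; field_simp
      · simp [h]
    rw [h1, Matrix.det_smul, ← Matrix.eval_charpoly, hA, eval_prod, hk]
    have h2 : μ ^ k = ∏ _i : Fin k, μ := by simp
    rw [h2, ← Finset.prod_mul_distrib]
    refine Finset.prod_congr rfl fun i _ => ?_
    simp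
    field_simp
  -- The factorization holds in the commutative ring `ℂ[X]`, with the roots of unity as constants,
  -- and is carried to matrices by evaluation at `A`.
  have hfac : Matrix.scalar m (x ^ n) - A ^ n =
      ((nthRootsFinset n (1 : ℂ)).toList.map fun μ => Matrix.scalar m x - μ • A).prod := by
    have : NeZero n := ⟨hn.ne'⟩
    have h := hζ.map_of_injective (f := (C : ℂ →+* ℂ[X])) (C_injective)
    have h2 : C x ^ n - X ^ n = ∏ μ ∈ nthRootsFinset n (1 : ℂ), (C x - C μ * X) := by
      have h3 := h.pow_sub_pow_eq_prod_sub_mul (C x) X hn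
      rw [h3]
      symm
      refine Finset.prod_bij (fun a _ => C a) ?_ ?_ ?_ ?_
      · intro a ha
        rw [mem_nthRootsFinset hn] at ha ⊢
        rw [← C_pow, ha, C_1]
      · intro a _ b _ hab
        exact C_injective hab
      · intro b hb
        rw [mem_nthRootsFinset hn] at hb
        obtain ⟨i, -, hi⟩ := h.eq_pow_of_pow_eq_one hb
        refine ⟨ζ ^ i, ?_, by rw [← hi, C_pow]⟩
        rw [mem_nthRootsFinset hn, ← pow_mul, mul_comm, pow_mul, hζ.pow_eq_one, one_pow]
      · intros; rfl
    have h4 := congrArg (aeval A) h2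
    have h5 : ∀ μ : ℂ, aeval A (C x - C μ * X) = Matrix.scalar m x - μ • A := fun μ => by
      rw [map_sub, map_mul, aeval_C, aeval_C, aeval_X, ← Algebra.smul_def]
      rfl
    rw [← Finset.prod_map_toList, map_list_prod, List.map_map] at h4
    simp only [Function.comp_def, h5] at h4
    rw [← h4]
    rw [map_sub, map_pow, map_pow, map_pow, aeval_X, aeval_C]
    rfl
  have hdet : ∀ l : List ℂ, (∀ μ ∈ l, μ ∈ nthRootsFinset n (1 : ℂ)) →
      ((l.map fun μ => Matrix.scalar m x - μ • A).prod).det =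
        (l.map fun μ => ∏ i, (x - μ * z i)).prod := by
    intro l hl
    induction l with
    | nil => simp
    | cons a l ih =>
      rw [List.map_cons, List.prod_cons, List.map_cons, List.prod_cons, Matrix.det_mul,
        key a (hl a (by simp)), ih fun μ hμ => hl μ (by simp [hμ])]
  rw [Matrix.eval_charpoly, hfac, hdet _ (by simp), Finset.prod_map_toList, Finset.prod_comm]
  exact Finset.prod_congr rfl fun i _ => (hζ.pow_sub_pow_eq_prod_sub_mul x (z i) hn).symm

/-- Every complex number is an `n`-th power, so values at the points `x ^ n` determine the
polynomial. -/
theorem Matrix.charpoly_pow_eq_prod {m : Type*} [Fintype m] [DecidableEq m] {k : ℕ}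
    (A : Matrix m m ℂ) (z : Fin k → ℂ) (hA : A.charpoly = ∏ i, (X - C (z i))) {n : ℕ} (hn : 0 < n) :
    (A ^ n).charpoly = ∏ i, (X - C (z i ^ n)) := by
  refine Polynomial.funext fun y => ?_
  obtain ⟨x, rfl⟩ := IsAlgClosed.exists_pow_nat_eq y hn
  rw [A.eval_charpoly_pow_eq_prod z hA hn, eval_prod]
  simp

theorem LinearMap.charpoly_pow_eq_prod {V : Type*} [AddCommGroup V] [Module ℝ V]
    [FiniteDimensional ℝ V] {k : ℕ} (g : V →ₗ[ℝ] V) (z : Fin k → ℂ)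
    (hg : g.charpoly.map (algebraMap ℝ ℂ) = ∏ i, (X - C (z i))) {n : ℕ} (hn : 0 < n) :
    (g ^ n).charpoly.map (algebraMap ℝ ℂ) = ∏ i, (X - C (z i ^ n)) := by
  have b := Module.finBasis ℝ V
  rw [← LinearMap.charpoly_toMatrix _ b, ← Matrix.charpoly_map] at hg ⊢
  rw [← LinearMap.toMatrix_pow, Matrix.map_pow]
  exact Matrix.charpoly_pow_eq_prod _ z hg hn

/-- At each `t` this is multiplicativity of the determinant of `t - g` along the invariant subspace
`W`. -/
theorem LinearMap.charpoly_eq_restrict_mul_mapQ {V : Type*} [AddCommGroup V] [Module ℝ V]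
    [FiniteDimensional ℝ V] (W : Submodule ℝ V) (g : V →ₗ[ℝ] V) (hg : ∀ x ∈ W, g x ∈ W) :
    g.charpoly = (g.restrict hg).charpoly * (W.mapQ W g hg).charpoly := by
  refine Polynomial.funext fun t => ?_
  have ht : W ≤ W.comap (algebraMap ℝ (Module.End ℝ V) t - g) := fun x hx =>
    W.sub_mem (W.smul_mem t hx) (hg x hx)
  rw [eval_mul, LinearMap.eval_charpoly, LinearMap.eval_charpoly, LinearMap.eval_charpoly,
    LinearMap.det_eq_det_mul_det W _ ht]
  congr 2
  ext x
  simp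

/-- A linear map preserving a bilinear form on a finite dimensional space preserves its radical. -/
theorem LinearMap.apply_eq_zero_of_preserves_form {V : Type*} [AddCommGroup V] [Module ℝ V]
    [FiniteDimensional ℝ V] (B : V →ₗ[ℝ] V →ₗ[ℝ] ℝ) (T : V →ₗ[ℝ] V)
    (h : ∀ x y, B (T x) (T y) = B x y) {x : V} (hx : B x = 0) : B (T x) = 0 := by
  have hle : LinearMap.ker (B ∘ₗ T) ≤ LinearMap.ker B := by
    intro y hy
    ext w
    rw [← h y w]
    exact congrArg (fun φ => φ (T w)) hy
  -- The composite has rank at most that of `B`, so its kernel is at least as large as that of `B`.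
  -- Together with the inclusion above the kernels agree.
  have hr : Module.finrank ℝ (LinearMap.range (B ∘ₗ T)) ≤ Module.finrank ℝ (LinearMap.range B) :=
    Submodule.finrank_mono (LinearMap.range_comp_le_range T B)
  have h1 := LinearMap.finrank_range_add_finrank_ker (B ∘ₗ T)
  have h2 := LinearMap.finrank_range_add_finrank_ker B
  have heq := Submodule.eq_of_le_of_finrank_le hle (by omega)
  have : x ∈ LinearMap.ker (B ∘ₗ T) := by rw [heq]; exact hx
  exact this

/-! ## Iterates of graph maps -/

namespace GraphMap

variable {G : RibbonGraph}

theorem ext_path {f g : GraphMap G} (h : ∀ d, f.path d = g.path d) : f = g := by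
  obtain ⟨p, _, _, _, _⟩ := f
  obtain ⟨q, _, _, _, _⟩ := g
  obtain rfl : p = q := funext h
  rfl

theorem comp_path (g f : GraphMap G) (d : G.Dart) :
    (g.comp f).path d = (f.path d).flatMap g.path := rfl

theorem comp_init (g f : GraphMap G) (d : G.Dart) : (g.comp f).init d = g.init (f.init d) :=
  g.head_flatMap (f.path_ne_nil d)

theorem comp_id (f : GraphMap G) : f.comp (GraphMap.id G) = f :=
  ext_path fun d => by simp [comp_path, GraphMap.id]

theorem id_comp (f : GraphMap G) : (GraphMap.id G).comp f = f :=
  ext_path fun d => by simp [comp_path, GraphMap.id]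

theorem comp_assoc (h g f : GraphMap G) : (h.comp g).comp f = h.comp (g.comp f) :=
  ext_path fun d => by
    simp only [comp_path]
    rw [List.flatMap_assoc]
    rfl

theorem iterate_one (f : GraphMap G) : f.iterate 1 = f := f.comp_id

theorem iterate_add (f : GraphMap G) (m n : ℕ) :
    f.iterate (m + n) = (f.iterate m).comp (f.iterate n) := by
  induction m with
  | zero => rw [zero_add]; exact (id_comp _).symm
  | succ m ih =>
    rw [Nat.succ_add]
    change f.comp (f.iterate (m + n)) = (f.comp (f.iterate m)).comp (f.iterate n)
    rw [ih, comp_assoc]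

theorem iterate_mul (f : GraphMap G) (m n : ℕ) : f.iterate (m * n) = (f.iterate m).iterate n := by
  induction n with
  | zero => rfl
  | succ n ih =>
    rw [Nat.mul_succ, Nat.add_comm, iterate_add, ih]
    rfl

theorem init_iterate_add (f : GraphMap G) (m n : ℕ) (d : G.Dart) :
    (f.iterate (m + n)).init d = (f.iterate m).init ((f.iterate n).init d) := by
  rw [iterate_add, comp_init]

/-- If every edge is crossed by `f`, then every edge is crossed by each iterate. -/
theorem IsTrainTrackMap.exists_mem_iterate {f : GraphMap G} (h : f.IsTrainTrackMap) (n : ℕ)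
    (d : G.Dart) : ∃ e, d ∈ (f.iterate n).path e := by
  induction n generalizing d with
  | zero => exact ⟨d, by simp [iterate, GraphMap.id]⟩
  | succ n ih =>
    obtain ⟨a, ha⟩ := h.surjective d
    obtain ⟨e, he⟩ := ih a
    exact ⟨e, List.mem_flatMap.2 ⟨a, he, ha⟩⟩

theorem IsTrainTrackMap.iterate {f : GraphMap G} (h : f.IsTrainTrackMap) {n : ℕ} (hn : 0 < n) :
    (f.iterate n).IsTrainTrackMap where
  noBacktrack r hr d := by
    rw [← iterate_mul]
    exact h.noBacktrack _ (Nat.mul_pos hn hr) d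
  surjective := h.exists_mem_iterate n

theorem infix_flatMap_of_mem {α β : Type*} {l : List α} {a : α} (h : a ∈ l) (p : α → List β) :
    p a <:+: l.flatMap p := by
  obtain ⟨s, t, rfl⟩ := List.append_of_mem h
  exact ⟨s.flatMap p, t.flatMap p, by simp⟩

/-- Initial darts that have become equal stay equal, so the exponents `r` and `n * r` detect the
same gates. -/
theorem gate_iterate (f : GraphMap G) {n : ℕ} (hn : 0 < n) : (f.iterate n).gate = f.gate := by
  ext d d'
  refine ⟨fun ⟨hv, r, hr, h⟩ => ⟨hv, n * r, Nat.mul_pos hn hr, ?_⟩,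
    fun ⟨hv, r, hr, h⟩ => ⟨hv, r, hr, ?_⟩⟩
  · rw [iterate_mul]; exact h
  · rw [← iterate_mul]
    exact f.init_iterate_eq_of_le (Nat.le_mul_of_pos_left r hn) h

/-- Surjectivity is what allows a turn to be delayed: if `e` lies on `f^(n * r - r)(a)`, then
`f^r(e)` is a subpath of `f^(n * r)(a)`, and the latter is the image of `a` under an iterate of
`f^n`. -/
theorem IsTrainTrackMap.trainTrack_iterate {f : GraphMap G} (h : f.IsTrainTrackMap) {n : ℕ}
    (hn : 0 < n) : (f.iterate n).trainTrack = f.trainTrack := by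
  refine TrainTrack.ext (f.gate_iterate hn) ?_
  change (f.iterate n).Joined = f.Joined
  funext d d'
  refine propext ⟨?_, ?_⟩
  · rintro ⟨hg, r, hr, e, x, y, hxy, ht⟩
    rw [gate_iterate f hn] at hg ht
    exact ⟨hg, n * r, Nat.mul_pos hn hr, e, x, y, by rw [iterate_mul]; exact hxy, ht⟩
  · rintro ⟨hg, r, hr, e, x, y, hxy, ht⟩
    obtain ⟨a, ha⟩ := h.exists_mem_iterate (n * r - r) e
    refine ⟨by rw [gate_iterate f hn]; exact hg, r, hr, a, x, y, ?_, by
      rw [gate_iterate f hn]; exact ht⟩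
    rw [← iterate_mul, show n * r = r + (n * r - r) by
      have := Nat.le_mul_of_pos_left r hn
      omega, iterate_add]
    exact hxy.trans (infix_flatMap_of_mem ha _)

/-! ### The action on edge weights -/

theorem edge_rev (d : G.Dart) : G.edge (G.rev d) = G.edge d :=
  (Quotient.sound (s := G.edgeSetoid) (Or.inr rfl : G.edgeSetoid d (G.rev d))).symm

theorem edge_eq_iff {d d' : G.Dart} : G.edge d = G.edge d' ↔ d' = d ∨ d' = G.rev d :=
  ⟨fun h => Quotient.exact h, fun h => Quotient.sound h⟩

theorem edge_surjective (e : G.Edge) : ∃ d, G.edge d = e := Quotient.exists_rep e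

theorem count_rev_map (l : List G.Dart) (d : G.Dart) :
    ((l.map G.rev).reverse).count d = l.count (G.rev d) := by
  rw [List.count_reverse]
  conv_lhs => rw [← G.rev_rev d]
  exact List.count_map_of_injective l G.rev (Function.LeftInverse.injective G.rev_rev) (G.rev d)

theorem count_edge (l : List G.Dart) (d : G.Dart) :
    (l.map G.edge).count (G.edge d) = l.count d + l.count (G.rev d) := by
  induction l with
  | nil => simp
  | cons a l ih =>
    simp only [List.map_cons, List.count_cons, ih, beq_iff_eq, edge_eq_iff]
    have h1 := G.rev_ne d
    have h2 := G.rev_rev a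
    have h3 := G.rev_rev d
    have h4 : d = G.rev a ↔ a = G.rev d := by
      constructor
      · rintro rfl; exact h2.symm
      · rintro rfl; exact h3.symm
    simp only [h4]
    by_cases ha : a = d
    · subst ha
      simp [h1.symm]
      omega
    · by_cases hb : a = G.rev d
      · simp [hb, h1, h1.symm]; omega
      · simp [ha, hb, Ne.symm ha]

/-- A sum over darts is a sum over edges. -/
theorem sum_dart_eq_sum_edge (φ : G.Dart → ℝ) :
    ∑ d, φ d = ∑ e : G.Edge, (φ (Quotient.out e) + φ (G.rev (Quotient.out e))) := by
  rw [← Finset.sum_fiberwise Finset.univ G.edge φ]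
  refine Finset.sum_congr rfl fun e _ => ?_
  have he : G.edge (Quotient.out e) = e := Quotient.out_eq e
  have : (Finset.univ.filter fun d => G.edge d = e) = {Quotient.out e, G.rev (Quotient.out e)} := by
    ext d
    simp only [Finset.mem_filter, Finset.mem_univ, true_and, Finset.mem_insert,
      Finset.mem_singleton]
    conv_lhs => rw [← he, eq_comm]
    exact edge_eq_iff
  rw [this, Finset.sum_pair (G.rev_ne _).symm]

/-- Summing over both darts of an edge, while counting only passages in the direction of `d`,
replaces counting passages in either direction. This removes the choice of representatives from the
transition matrix. -/
theorem push_apply (f : GraphMap G) (η : G.Weights) (d : G.Dart) :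
    f.push η (G.edge d) = ∑ a, ((f.path a).count d : ℝ) * η (G.edge a) := by
  rw [sum_dart_eq_sum_edge]
  change ∑ e, (f.transition.map (Nat.cast : ℕ → ℝ)) (G.edge d) e * η e = _
  refine Finset.sum_congr rfl fun e _ => ?_
  have he : G.edge (Quotient.out e) = e := Quotient.out_eq e
  rw [Matrix.map_apply, transition, count_edge, edge_rev, he, f.path_rev, count_rev_map,
    Nat.cast_add, add_mul]

theorem push_comp (g f : GraphMap G) : (g.comp f).push = g.push ∘ₗ f.push := by
  refine LinearMap.ext fun η => funext fun e => ?_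
  obtain ⟨d, rfl⟩ := edge_surjective e
  rw [LinearMap.comp_apply, push_apply, push_apply]
  simp only [push_apply, Finset.mul_sum]
  rw [Finset.sum_comm]
  refine Finset.sum_congr rfl fun a _ => ?_
  simp only [← mul_assoc]
  rw [← Finset.sum_mul]
  congr 1
  rw [comp_path, List.count_flatMap]
  have h : ∀ l : List G.Dart, ((l.map (List.count d ∘ g.path)).sum : ℝ) =
      ∑ b, ((g.path b).count d : ℝ) * (l.count b : ℝ) := by
    intro l
    induction l with
    | nil => simp
    | cons c l ih =>
      simp only [List.map_cons, List.sum_cons, Nat.cast_add, ih, List.count_cons, mul_add,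
        Finset.sum_add_distrib]
      simp [add_comm]
  exact h _

theorem push_iterate (f : GraphMap G) (n : ℕ) : (f.iterate n).push = f.push ^ n := by
  induction n with
  | zero =>
    refine LinearMap.ext fun η => funext fun e => ?_
    obtain ⟨d, rfl⟩ := edge_surjective e
    rw [push_apply]
    simp [iterate, GraphMap.id, List.count_singleton]
  | succ n ih =>
    rw [pow_succ']
    change (f.comp (f.iterate n)).push = _
    rw [push_comp, ih]
    rfl

end GraphMap

/-! ## Powers of pseudo-Anosov classes -/

theorem Isotopic.mul {S : Type*} [TopologicalSpace S] {F F' K K' : S ≃ₜ S} (h : Isotopic F F')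
    (k : Isotopic K K') : Isotopic (F * K) (F' * K') := by
  obtain ⟨H, h1, h2, h3⟩ := h
  obtain ⟨J, k1, k2, k3⟩ := k
  refine ⟨⟨fun x => H (x.1, J x), by fun_prop⟩, fun t => (h1 t).comp (k1 t), fun x => ?_,
    fun x => ?_⟩
  · simp [h2, k2]
  · simp [h3, k3]

theorem Isotopic.pow {S : Type*} [TopologicalSpace S] {F F' : S ≃ₜ S} (h : Isotopic F F') (n : ℕ) :
    Isotopic (F ^ n) (F' ^ n) := by
  induction n with
  | zero =>
    exact ⟨⟨fun x => x.2, by fun_prop⟩, fun _ => IsHomeomorph.id, fun _ => rfl, fun _ => rfl⟩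
  | succ n ih =>
    rw [pow_succ, pow_succ]
    exact ih.mul h

/-- The same foliations are used; only the dilatation and the local constants change. -/
theorem IsPseudoAnosovHomeo.pow {S : Type*} [TopologicalSpace S] {F : S ≃ₜ S}
    (h : IsPseudoAnosovHomeo F) {n : ℕ} (hn : 0 < n) : IsPseudoAnosovHomeo (F ^ n) := by
  obtain ⟨Φ, lam, hlam, hs, hF⟩ := h
  refine ⟨Φ, lam ^ n, one_lt_pow₀ hlam hn.ne', ?_⟩
  induction n, hn using Nat.le_induction with
  | base =>
    simp only [pow_one]
    exact ⟨hs, hF⟩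
  | succ n hn ih =>
    obtain ⟨ih1, ih2⟩ := ih
    refine ⟨fun x => ?_, fun ψ hψ ψ' hψ' x hx hx' => ?_⟩
    · rw [pow_succ, Homeomorph.mul_apply, ih1, hs]
    · rw [pow_succ, Homeomorph.mul_apply] at hx'
      -- The two affine local forms can be composed only in a chart around the intermediate point `F
      -- x`, which exists because `F x` is not singular.
      have hx1 : F x ∉ Φ.sing := by
        rw [hs]
        exact Φ.source_subset ψ hψ hx
      obtain ⟨ψ₁, hψ₁, hx₁⟩ := Φ.cover _ hx1
      obtain ⟨ε, c, hε, he⟩ := hF ψ hψ ψ₁ hψ₁ x hx hx₁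
      obtain ⟨ε', c', hε', he'⟩ := ih2 ψ₁ hψ₁ ψ' hψ' (F x) hx₁ hx'
      -- The translation of the first step is stretched by the remaining `n` steps before their own
      -- translation is added.
      refine ⟨ε * ε', ε' * ⟨lam ^ n * c.re, (lam ^ n)⁻¹ * c.im⟩ + c', ?_, ?_⟩
      · rcases hε with rfl | rfl <;> rcases hε' with rfl | rfl <;> simp
      · filter_upwards [he, F.continuous.continuousAt.eventually he'] with y h1 h2
        rw [pow_succ, Homeomorph.mul_apply, h2, h1]
        rcases hε with rfl | rfl <;> rcases hε' with rfl | rfl <;>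
          apply Complex.ext <;> simp [pow_succ] <;> ring

theorem IsPseudoAnosovClass.pow {S : Type*} [TopologicalSpace S] {F : S ≃ₜ S}
    (h : IsPseudoAnosovClass F) {n : ℕ} (hn : 0 < n) : IsPseudoAnosovClass (F ^ n) := by
  obtain ⟨F', h1, h2⟩ := h
  exact ⟨F' ^ n, h1.pow n, h2.pow hn⟩

/-! ## Concatenated lists -/

namespace List

variable {α β : Type*}

/-- The index at which the block of the `j`-th entry of `l` starts in `l.flatMap p`. -/
def flatOffset (p : α → List β) (l : List α) (j : ℕ) : ℕ := ((l.take j).flatMap p).length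

variable (p : α → List β) (l : List α)

theorem flatOffset_zero : flatOffset p l 0 = 0 := rfl

theorem flatOffset_succ {j : ℕ} (hj : j < l.length) :
    flatOffset p l (j + 1) = flatOffset p l j + (p l[j]).length := by
  rw [flatOffset, List.take_succ_eq_append_getElem hj, List.flatMap_append, List.length_append]
  simp [flatOffset]

theorem flatOffset_mono : Monotone (flatOffset p l) := by
  refine monotone_nat_of_le_succ fun j => ?_
  rcases lt_or_ge j l.length with hj | hj
  · rw [flatOffset_succ p l hj]; omega
  · simp [flatOffset, List.take_of_length_le hj, List.take_of_length_le (hj.trans (Nat.le_succ _))]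

theorem flatOffset_length : flatOffset p l l.length = (l.flatMap p).length := by
  simp [flatOffset]

theorem flatOffset_add_lt {j k : ℕ} (hj : j < l.length) (hk : k < (p l[j]).length) :
    flatOffset p l j + k < (l.flatMap p).length := by
  rw [← flatOffset_length]
  have := flatOffset_mono p l (Nat.succ_le_of_lt hj)
  rw [Nat.succ_eq_add_one, flatOffset_succ p l hj] at this
  omega

theorem getElem_flatMap {j k : ℕ} (hj : j < l.length) (hk : k < (p l[j]).length) :
    (l.flatMap p)[flatOffset p l j + k]'(flatOffset_add_lt p l hj hk) = (p l[j])[k] := by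
  have h : l.flatMap p = (l.take j).flatMap p ++ (p l[j] ++ (l.drop (j + 1)).flatMap p) := by
    conv_lhs => rw [← List.take_append_drop j l, List.drop_eq_getElem_cons hj]
    rw [List.flatMap_append, List.flatMap_cons]
  rw [List.getElem_of_eq h, List.getElem_append_right (by simp [flatOffset])]
  simp only [flatOffset, Nat.add_sub_cancel_left]
  rw [List.getElem_append_left hk]

theorem exists_flatOffset {i : ℕ} (hi : i < (l.flatMap p).length) :
    ∃ (j : ℕ) (hj : j < l.length) (k : ℕ), k < (p l[j]).length ∧ i = flatOffset p l j + k := by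
  have key : ∀ n ≤ l.length, i < flatOffset p l n →
      ∃ (j : ℕ) (hj : j < l.length) (k : ℕ), k < (p l[j]).length ∧ i = flatOffset p l j + k := by
    intro n
    induction n with
    | zero => intro _ h; rw [flatOffset_zero] at h; omega
    | succ n ih =>
      intro hn h
      rcases lt_or_ge i (flatOffset p l n) with h' | h'
      · exact ih (by omega) h'
      · rw [flatOffset_succ p l hn] at h
        exact ⟨n, hn, i - flatOffset p l n, by omega, by omega⟩
  exact key l.length le_rfl (by rwa [flatOffset_length])

theorem flatOffset_inj {j k j' k' : ℕ} (hj : j < l.length) (hk : k < (p l[j]).length)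
    (hj' : j' < l.length) (hk' : k' < (p l[j']).length)
    (h : flatOffset p l j + k = flatOffset p l j' + k') : j = j' ∧ k = k' := by
  have key : ∀ {a b x y : ℕ} (ha : a < l.length), x < (p l[a]).length → a < b →
      flatOffset p l a + x < flatOffset p l b + y := by
    intro a b x y ha hx hab
    have := flatOffset_mono p l (Nat.succ_le_of_lt hab)
    rw [Nat.succ_eq_add_one, flatOffset_succ p l ha] at this
    omega
  rcases lt_trichotomy j j' with hlt | rfl | hlt
  · exact absurd h (key hj hk hlt).ne
  · exact ⟨rfl, by omega⟩
  · exact absurd h.symm (key hj' hk' hlt).ne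

end List

/-! ## Realizations of composites -/

namespace RibbonGraph

variable (G : RibbonGraph)

/-- The end of `rev (next d)` is glued to the start of `d` along the sides of strips, taken at
distance `0`, and to the start of `next d` along the base. -/
theorem point_zero_next (d : G.Dart) : G.point (G.next d) 0 = G.point d 0 := by
  have h1 : G.point (G.rev (G.next d)) 1 = G.point (G.next.symm (G.rev (G.rev (G.next d)))) 0 :=
    Quot.sound (Glue.side _ 0)
  have h2 : G.point (G.rev (G.next d)) 1 =
      G.point (G.rev (G.rev (G.next d))) (unitInterval.symm 1) :=
    Quot.sound (Glue.base _ 1)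
  rw [G.rev_rev] at h1 h2
  rw [Equiv.symm_apply_apply] at h1
  rw [unitInterval.symm_one] at h2
  rw [← h2, h1]

theorem point_zero_eq {d d' : G.Dart} (h : G.SameVertex d d') : G.point d 0 = G.point d' 0 := by
  obtain ⟨i, rfl⟩ := h.exists_nat_pow_eq
  clear h
  induction i with
  | zero => rfl
  | succ i ih => rw [pow_succ', Equiv.Perm.mul_apply, point_zero_next, ← ih]

theorem point_one (d : G.Dart) : G.point d 1 = G.point (G.rev d) 0 := by
  have h : G.point d 1 = G.point (G.rev d) (unitInterval.symm 1) := Quot.sound (Glue.base d 1)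
  rwa [unitInterval.symm_one] at h

/-- An interior integer parameter of a path has two descriptions, as the end of one dart and as the
start of the following one. The chain condition makes them the same vertex. -/
theorem spinePoint_eq_of_chain {l : List G.Dart}
    (hl : l.IsChain fun x y => G.SameVertex (G.rev x) y) {i j : ℕ} (hi : i < l.length)
    (hj : j < l.length) {s t : unitInterval} (h : (i : ℝ) + s = j + t) :
    G.spinePoint l[i] s = G.spinePoint l[j] t := by
  have key : ∀ {i j : ℕ} (hi : i < l.length) (hj : j < l.length) {s t : unitInterval},
      (i : ℝ) + s = j + t → i < j → G.spinePoint l[i] s = G.spinePoint l[j] t := by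
    intro i j hi hj s t h hij
    have h1 : (i : ℝ) + 1 ≤ j := by exact_mod_cast hij
    have hs := s.2.2
    have ht := t.2.1
    have h2 : (j : ℝ) = (i + 1 : ℕ) := by push_cast; linarith
    obtain rfl : j = i + 1 := by exact_mod_cast h2
    have hs1 : s = 1 := Subtype.ext (by push_cast at h; change (s : ℝ) = 1; linarith)
    have ht0 : t = 0 := Subtype.ext (by push_cast at h; change (t : ℝ) = 0; linarith)
    subst hs1 ht0
    refine Subtype.ext ?_
    change G.point _ _ = G.point _ _
    rw [point_one]
    exact G.point_zero_eq (List.isChain_iff_getElem.1 hl i hj)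
  rcases lt_trichotomy i j with hij | rfl | hij
  · exact key hi hj h hij
  · rw [Subtype.ext (by linarith : (s : ℝ) = t)]
  · exact (key hj hi h.symm hij).symm

end RibbonGraph

/-- Integer and fractional part, except at the right end `u = n`, where the floor is out of range
and the last index is taken with parameter `1`. -/
theorem exists_nat_add_unitInterval {u : ℝ} {n : ℕ} (h0 : 0 ≤ u) (h1 : u ≤ n) (hn : 0 < n) :
    ∃ j < n, ∃ s : unitInterval, u = (j : ℝ) + s := by
  rcases h1.lt_or_eq with h | rfl
  · refine ⟨⌊u⌋₊, (Nat.floor_lt h0).2 h, ⟨u - ⌊u⌋₊, ?_, ?_⟩, by simp⟩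
    · linarith [Nat.floor_le h0]
    · linarith [Nat.lt_floor_add_one u]
  · refine ⟨n - 1, by omega, 1, ?_⟩
    rw [Nat.cast_sub hn]
    simp

namespace GraphMap

variable {G : RibbonGraph}

open List in
theorem Realizes.comp {g f : GraphMap G} {ψ φ : C(G.spine, G.spine)} (hg : g.Realizes ψ)
    (hf : f.Realizes φ) : (g.comp f).Realizes (ψ.comp φ) := by
  intro d
  choose θ hθc hθm hθ0 hθ1 hθ using hg
  obtain ⟨κ, hκc, hκm, hκ0, hκ1, hκ⟩ := hf d
  set l := f.path d with hl
  have hl0 : 0 < l.length := List.length_pos_of_ne_nil (f.path_ne_nil d)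
  -- A total version of indexing; the default `d` is never used, since only indices below the length
  -- occur.
  let a : ℕ → G.Dart := fun j => (l[j]?).getD d
  have ha : ∀ {j : ℕ} (hj : j < l.length), a j = l[j] := fun hj => by simp [a, hj]
  let pr : ℝ → unitInterval := Set.projIcc 0 1 zero_le_one
  have prc : Continuous pr := continuous_projIcc
  have prm : Monotone pr := Set.monotone_projIcc _
  have pr0 : ∀ {x : ℝ}, x ≤ 0 → pr x = 0 := fun h => Set.projIcc_of_le_left _ h
  have pr1 : ∀ {x : ℝ}, 1 ≤ x → pr x = 1 := fun h => Set.projIcc_of_right_le _ h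
  have prs : ∀ s : unitInterval, pr s = s := fun s => Set.projIcc_val _ s
  -- The concatenation of the parametrizations of the paths `g(l[i])`. After clipping to `[0,1]`,
  -- segments already passed contribute their full length and later ones contribute `0`, so on `[j,
  -- j+1]` only the `j`-th summand varies. As a finite sum it is visibly continuous and monotone.
  let Γ : ℝ → ℝ := fun u => ∑ i ∈ Finset.range l.length, θ (a i) (pr (u - i))
  have hoff : ∀ {j : ℕ}, j ≤ l.length →
      ∑ i ∈ Finset.range j, ((g.path (a i)).length : ℝ) = flatOffset g.path l j := by
    intro j
    induction j with
    | zero => intro _; simp [flatOffset_zero]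
    | succ j ih =>
      intro hj
      rw [Finset.sum_range_succ, ih (by omega), flatOffset_succ _ _ hj, ha hj]
      push_cast
      rfl
  have hΓ : ∀ {j : ℕ} (hj : j < l.length) (s : unitInterval),
      Γ (j + s) = flatOffset g.path l j + θ l[j] s := by
    intro j hj s
    obtain ⟨m, hm⟩ := Nat.exists_eq_add_of_lt hj
    change ∑ i ∈ Finset.range l.length, _ = _
    rw [hm, show j + m + 1 = (j + 1) + m by ring, Finset.sum_range_add, Finset.sum_range_succ,
      ← hoff hj.le]
    have e1 : ∀ i ∈ Finset.range j, θ (a i) (pr ((j : ℝ) + s - i)) = (g.path (a i)).length := by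
      intro i hi
      have : (i : ℝ) + 1 ≤ j := by exact_mod_cast Finset.mem_range.1 hi
      rw [pr1 (by linarith [s.2.1]), hθ1]
    have e2 : ∀ i ∈ Finset.range m, θ (a (j + 1 + i)) (pr ((j : ℝ) + s - (j + 1 + i : ℕ))) = 0 := by
      intro i _
      push_cast
      have := s.2.2
      rw [pr0 (by linarith [Nat.cast_nonneg (α := ℝ) i]), hθ0]
    rw [Finset.sum_congr rfl e1, Finset.sum_eq_zero e2, add_zero, add_sub_cancel_left, prs, ha hj]
  have hκb : ∀ t, 0 ≤ κ t ∧ κ t ≤ l.length := fun t =>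
    ⟨hκ0 ▸ hκm.monotone t.2.1, hκ1 ▸ hκm.monotone t.2.2⟩
  refine ⟨Γ ∘ κ, ?_, ?_, ?_, ?_, ?_⟩
  · exact (continuous_finsetSum _ fun i _ => (hθc _).comp (prc.comp (by fun_prop))).comp hκc
  · intro t t' htt
    have hlt := hκm htt
    refine Finset.sum_lt_sum (fun i _ => (hθm _).monotone (prm (by linarith))) ?_
    obtain ⟨h0, -⟩ := hκb t
    obtain ⟨-, h1⟩ := hκb t'
    have hfl : ⌊κ t⌋₊ < l.length := (Nat.floor_lt h0).2 (by linarith)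
    -- All summands are monotone, and the one for the segment that contains `κ t` grows strictly.
    refine ⟨⌊κ t⌋₊, Finset.mem_range.2 hfl, hθm _ ?_⟩
    have h2 := Nat.floor_le h0
    have h3 := Nat.lt_floor_add_one (κ t)
    refine Subtype.coe_lt_coe.1 ?_
    change ((Set.projIcc (0 : ℝ) 1 zero_le_one _ : unitInterval) : ℝ) <
      (Set.projIcc (0 : ℝ) 1 zero_le_one _ : unitInterval)
    rw [Set.coe_projIcc, Set.coe_projIcc]
    refine max_lt (lt_max_of_lt_right (lt_min one_pos (by linarith))) (lt_max_of_lt_right ?_)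
    exact lt_min (min_lt_of_right_lt (by linarith)) (min_lt_of_right_lt (by linarith))
  · have := hΓ hl0 0
    simp only [Nat.cast_zero, flatOffset_zero, hθ0] at this
    simpa [hκ0] using this
  · have hj : l.length - 1 < l.length := by omega
    have := hΓ hj 1
    rw [hθ1, ← Nat.cast_add, ← flatOffset_succ _ _ hj, Nat.sub_add_cancel hl0, flatOffset_length,
      Nat.cast_sub hl0] at this
    simp only [Nat.cast_one, Set.Icc.coe_one, sub_add_cancel] at this
    rw [Function.comp_apply, hκ1]
    exact this
  · intro i t s hts
    obtain ⟨j, hj, u, hu⟩ := exists_nat_add_unitInterval (hκb t).1 (hκb t).2 hl0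
    obtain ⟨k, hk, v, hv⟩ := exists_nat_add_unitInterval (u := θ l[j] u)
      (by have h := (hθm l[j]).monotone (show (0 : unitInterval) ≤ u from u.2.1)
          rwa [hθ0] at h)
      (by have h := (hθm l[j]).monotone (show u ≤ (1 : unitInterval) from u.2.2)
          rwa [hθ1] at h)
      (List.length_pos_of_ne_nil (g.path_ne_nil l[j]))
    have e1 : φ (G.spinePoint d t) = G.spinePoint l[j] u := hκ ⟨j, hj⟩ t u hu
    have e2 : ψ (G.spinePoint l[j] u) = G.spinePoint (g.path l[j])[k] v := hθ l[j] ⟨k, hk⟩ u v hv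
    rw [ContinuousMap.comp_apply, e1, e2, ← getElem_flatMap g.path l hj hk]
    refine G.spinePoint_eq_of_chain ((g.comp f).path_chain d) _ i.2 ?_
    rw [← hts, Function.comp_apply, hu, hΓ hj, hv]
    push_cast
    ring

end GraphMap

/-! ## Cyclic orders -/

/-- `a, b, c` are distinct elements of a linear order, met in this cyclic order. -/
def Cyc {α : Type*} [LT α] (a b c : α) : Prop := a < b ∧ b < c ∨ b < c ∧ c < a ∨ c < a ∧ a < b

namespace Cyc

variable {α β : Type*} [LinearOrder α] [LinearOrder β] {a b c d : α}

theorem rotate (h : Cyc a b c) : Cyc b c a := by unfold Cyc at *; tauto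

theorem ne_left (h : Cyc a b c) : a ≠ b := by unfold Cyc at h; grind

theorem asymm (h : Cyc a b c) (h' : Cyc c b a) : False := by unfold Cyc at *; grind

theorem total (h1 : a ≠ b) (h2 : b ≠ c) (h3 : c ≠ a) : Cyc a b c ∨ Cyc c b a := by
  unfold Cyc; grind

theorem lex_iff_of_eq_of_ne {p p' : α} {q q' q'' : β} (h : p ≠ p') :
    Cyc (toLex (p, q)) (toLex (p, q')) (toLex (p', q'')) ↔ q < q' := by
  simp only [Cyc, Prod.Lex.toLex_lt_toLex]
  grind

theorem lex_of_ne {p₁ p₂ p₃ : α} {q₁ q₂ q₃ : β} (h : Cyc p₁ p₂ p₃) :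
    Cyc (toLex (p₁, q₁)) (toLex (p₂, q₂)) (toLex (p₃, q₃)) := by
  simp only [Cyc, Prod.Lex.toLex_lt_toLex] at *
  grind

theorem lex_iff_of_eq {p : α} {q₁ q₂ q₃ : β} :
    Cyc (toLex (p, q₁)) (toLex (p, q₂)) (toLex (p, q₃)) ↔ Cyc q₁ q₂ q₃ := by
  simp only [Cyc, Prod.Lex.toLex_lt_toLex]
  grind

theorem of_lex {p₁ p₂ p₃ : α} {q₁ q₂ q₃ : β} (h1 : p₁ ≠ p₂) (h2 : p₂ ≠ p₃) (h3 : p₃ ≠ p₁)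
    (h : Cyc (toLex (p₁, q₁)) (toLex (p₂, q₂)) (toLex (p₃, q₃))) : Cyc p₁ p₂ p₃ := by
  simp only [Cyc, Prod.Lex.toLex_lt_toLex] at *
  grind

end Cyc

/-! ### Linear positions for the cyclic order at a vertex -/

namespace RibbonGraph

variable {G : RibbonGraph}

theorem pow_steps {a b : G.Dart} (h : G.SameVertex a b) : (G.next ^ G.steps a b) a = b :=
  Nat.sInf_mem (s := {i : ℕ | (G.next ^ i) a = b}) h.exists_nat_pow_eq

theorem steps_le {a b : G.Dart} {i : ℕ} (h : (G.next ^ i) a = b) : G.steps a b ≤ i :=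
  Nat.sInf_le (s := {i : ℕ | (G.next ^ i) a = b}) h

theorem SameVertex.pow_right (a : G.Dart) (i : ℕ) : G.SameVertex a ((G.next ^ i) a) :=
  ⟨i, by simp⟩

theorem pow_minimalPeriod (a : G.Dart) :
    (G.next ^ (Function.minimalPeriod G.next a)) a = a := by
  rw [Equiv.Perm.coe_pow]
  exact Function.iterate_minimalPeriod

theorem steps_lt_minimalPeriod {a b : G.Dart} (h : G.SameVertex a b) :
    G.steps a b < Function.minimalPeriod G.next a := by
  obtain ⟨i, hi⟩ := h.exists_nat_pow_eq
  have hp : 0 < Function.minimalPeriod G.next a :=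
    Function.minimalPeriod_pos_of_mem_periodicPts
      (Function.Injective.mem_periodicPts G.next.injective a)
  refine (steps_le (i := i % Function.minimalPeriod G.next a) ?_).trans_lt (Nat.mod_lt _ hp)
  rw [Equiv.Perm.coe_pow, Function.iterate_mod_minimalPeriod_eq, ← Equiv.Perm.coe_pow, hi]

theorem eq_of_pow_eq {o : G.Dart} {i j : ℕ} (hi : i < Function.minimalPeriod G.next o)
    (hj : j < Function.minimalPeriod G.next o) (h : (G.next ^ i) o = (G.next ^ j) o) : i = j := by
  rw [Equiv.Perm.coe_pow, Equiv.Perm.coe_pow] at h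
  exact (Function.iterate_eq_iterate_iff_of_lt_minimalPeriod hi hj).1 h

/-- Step counts from `o` are coordinates modulo the period of `next`, and steps from `a` to `b` are
the difference of coordinates. In this form the cyclic order is that of the natural numbers `G.steps
o _`. -/
theorem steps_eq {o a b : G.Dart} (ha : G.SameVertex o a) (hb : G.SameVertex o b) :
    G.steps a b = if G.steps o a ≤ G.steps o b then G.steps o b - G.steps o a
      else Function.minimalPeriod G.next o + G.steps o b - G.steps o a := by
  have hab : G.SameVertex a b := ha.symm.trans hb
  have h1 := pow_steps ha
  have h2 := pow_steps hb
  have h3 := pow_steps hab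
  have l1 := steps_lt_minimalPeriod ha
  have l2 := steps_lt_minimalPeriod hb
  set n := Function.minimalPeriod G.next o
  set i := G.steps o a
  set j := G.steps o b
  set k := G.steps a b
  have h4 : (G.next ^ (k + i)) o = (G.next ^ j) o := by
    rw [pow_add, Equiv.Perm.mul_apply, h1, h3, h2]
  split_ifs with hij
  · have hle : k ≤ j - i := steps_le (by
      rw [← h1, ← Equiv.Perm.mul_apply, ← pow_add, Nat.sub_add_cancel hij, h2])
    have := eq_of_pow_eq (o := o) (i := k + i) (by omega) l2 h4
    omega
  · have hle : k ≤ n + j - i := steps_le (by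
      rw [← h1, ← Equiv.Perm.mul_apply, ← pow_add, Nat.sub_add_cancel (by omega), Nat.add_comm,
        pow_add, Equiv.Perm.mul_apply, pow_minimalPeriod, h2])
    rcases lt_or_ge (k + i) n with h | h
    · have := eq_of_pow_eq (o := o) h l2 h4
      omega
    · have h5 : (G.next ^ (k + i)) o = (G.next ^ (k + i - n)) o := by
        conv_lhs => rw [← Nat.sub_add_cancel h, pow_add, Equiv.Perm.mul_apply, pow_minimalPeriod]
      have := eq_of_pow_eq (o := o) (i := k + i - n) (by omega) l2 (h5 ▸ h4)
      omega

theorem ccw_iff_cyc_steps {o a b c : G.Dart} (ha : G.SameVertex o a) (hb : G.SameVertex o b)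
    (hc : G.SameVertex o c) :
    G.Ccw a b c ↔ Cyc (G.steps o a) (G.steps o b) (G.steps o c) := by
  have l1 := steps_lt_minimalPeriod ha
  have l2 := steps_lt_minimalPeriod hb
  have l3 := steps_lt_minimalPeriod hc
  rw [Ccw, steps_eq ha hb, steps_eq ha hc, Cyc]
  split_ifs <;> omega

theorem sameVertex_of_steps_pos {a b : G.Dart} (h : 0 < G.steps a b) : G.SameVertex a b := by
  have : G.steps a b ∈ {i : ℕ | (G.next ^ i) a = b} :=
    Nat.sInf_mem (Nat.nonempty_of_pos_sInf h)
  exact ⟨G.steps a b, by simpa using this⟩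

theorem Ccw.sameVertex {a b c : G.Dart} (h : G.Ccw a b c) :
    G.SameVertex a b ∧ G.SameVertex a c :=
  ⟨sameVertex_of_steps_pos h.1, sameVertex_of_steps_pos (h.1.trans h.2)⟩

/-- A linear order of the darts in which the darts at each vertex form an interval, ordered
counterclockwise from some initial dart. -/
structure DartOrder (G : RibbonGraph) where
  pos : G.Dart → ℕ
  inj : Function.Injective pos
  ccw_iff : ∀ {a b c}, G.SameVertex a b → G.SameVertex a c →
    (G.Ccw a b c ↔ Cyc (pos a) (pos b) (pos c))
  sameVertex_of_between : ∀ {a b c}, G.SameVertex a b → pos a < pos c → pos c < pos b →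
    G.SameVertex a c

/-- For every choice of a base dart at each vertex there is an order of the darts starting with the
base darts. -/
theorem exists_dartOrder (base : G.Dart → G.Dart) (hb : ∀ d, G.SameVertex (base d) d)
    (hb' : ∀ d d', G.SameVertex d d' → base d = base d') :
    ∃ O : DartOrder G, ∀ d, O.pos (base d) ≤ O.pos d := by
  let N : ℕ := ∑ d, G.steps (base d) d + 1
  have hN : ∀ d, G.steps (base d) d < N := fun d =>
    Nat.lt_succ_of_le (Finset.single_le_sum (f := fun d => G.steps (base d) d)
      (fun _ _ => Nat.zero_le _) (Finset.mem_univ d))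
  let idx : G.Dart → ℕ := fun d => Fintype.equivFin G.Dart (base d)
  have hidx : ∀ {a b}, idx a = idx b → base a = base b := fun h =>
    (Fintype.equivFin G.Dart).injective (Fin.ext h)
  have hidx' : ∀ {a b}, idx a = idx b → G.SameVertex a b := fun {a b} h =>
    (hb a).symm.trans (by rw [hidx h]; exact hb b)
  -- Each vertex gets its own block of `N` positions, indexed by its base dart; `N` exceeds every
  -- step count, so blocks do not overlap.
  let pos : G.Dart → ℕ := fun d => idx d * N + G.steps (base d) d
  have hlt : ∀ {a b}, idx a < idx b → pos a < pos b := fun {a b} h => by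
    have h1 : (idx a + 1) * N ≤ idx b * N := Nat.mul_le_mul_right _ h
    have h2 := hN a
    change idx a * N + _ < idx b * N + _
    rw [Nat.add_mul, Nat.one_mul] at h1
    omega
  refine ⟨⟨pos, ?_, ?_, ?_⟩, ?_⟩
  · intro a b h
    rcases lt_trichotomy (idx a) (idx b) with h' | h' | h'
    · exact absurd h (hlt h').ne
    · have h1 : G.steps (base a) a = G.steps (base b) b := by
        change idx a * N + _ = idx b * N + _ at h
        rw [h'] at h
        omega
      rw [← pow_steps (hb a), h1, hidx h', pow_steps (hb b)]
    · exact absurd h (hlt h').ne'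
  · intro a b c hab hac
    have e1 := hb' _ _ hab
    have e2 := hb' _ _ hac
    rw [ccw_iff_cyc_steps (hb a) (e1 ▸ hb b) (e2 ▸ hb c)]
    change _ ↔ Cyc (Fintype.equivFin G.Dart (base a) * N + _)
      (Fintype.equivFin G.Dart (base b) * N + _) (Fintype.equivFin G.Dart (base c) * N + _)
    rw [← e1, ← e2]
    simp only [Cyc]
    omega
  · intro a b c hab hac hcb
    have e1 : idx a = idx b := by simp only [idx, hb' _ _ hab]
    refine hidx' (le_antisymm ?_ ?_)
    · exact not_lt.1 fun h => absurd (hlt h) (by omega)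
    · exact not_lt.1 fun h => absurd (hlt (e1 ▸ h)) (by omega)
  · intro d
    have e : base (base d) = base d := hb' _ _ (hb d)
    change Fintype.equivFin G.Dart (base (base d)) * N + G.steps (base (base d)) (base d) ≤
      Fintype.equivFin G.Dart (base d) * N + G.steps (base d) d
    rw [e]
    have : G.steps (base d) (base d) = 0 := Nat.le_zero.1 (steps_le rfl)
    omega

/-- The setoid of darts with the same initial vertex. -/
def vertexSetoid (G : RibbonGraph) : Setoid G.Dart where
  r := G.SameVertex
  iseqv := ⟨fun _ => Equiv.Perm.SameCycle.refl _ _, fun h => h.symm, fun h h' => h.trans h'⟩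

instance : Nonempty (DartOrder G) := by
  obtain ⟨O, -⟩ := exists_dartOrder (G := G)
    (fun d => Quotient.out (Quotient.mk G.vertexSetoid d))
    (fun d => Quotient.mk_out (s := G.vertexSetoid) d)
    (fun d d' h => congrArg Quotient.out (Quotient.sound (s := G.vertexSetoid) h))
  exact ⟨O⟩

end RibbonGraph

namespace GraphMap

open RibbonGraph

variable {G : RibbonGraph} {f g : GraphMap G}

/-! ### Strands -/

theorem Strand.ext_val {x y : f.Strand} (h1 : x.1 = y.1) (h2 : (x.2 : ℕ) = y.2) : x = y := by
  obtain ⟨d, i⟩ := x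
  obtain ⟨d', j⟩ := y
  obtain rfl : d = d' := h1
  obtain rfl : i = j := Fin.ext h2
  rfl

/-- The strand `x` run backwards. -/
def revStrand (x : f.Strand) : f.Strand :=
  ⟨G.rev x.1, ⟨(f.path x.1).length - 1 - x.2, by
    have := x.2.2
    rw [f.path_rev, List.length_reverse, List.length_map]
    omega⟩⟩

theorem isReverse_iff {x y : f.Strand} : f.IsReverse x y ↔ y = revStrand x := by
  have hx := x.2.2
  constructor
  · rintro ⟨h1, h2⟩
    refine Strand.ext_val h1 ?_
    simp only [revStrand]
    omega
  · rintro rfl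
    refine ⟨rfl, ?_⟩
    simp only [revStrand]
    omega

theorem revStrand_revStrand (x : f.Strand) : revStrand (revStrand x) = x := by
  have hx := x.2.2
  refine Strand.ext_val (G.rev_rev _) ?_
  simp only [revStrand, f.path_rev, List.length_reverse, List.length_map]
  omega

theorem over_revStrand (x : f.Strand) : (revStrand x).over = G.rev x.over := by
  have hx := x.2.2
  simp only [Strand.over, revStrand, List.get_eq_getElem]
  rw [List.getElem_of_eq (f.path_rev x.1), List.getElem_reverse, List.getElem_map]
  congr 2
  simp only [List.length_map]
  omega

/-- The strand before `x` in the same image path. -/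
def prevStrand (x : f.Strand) : f.Strand := ⟨x.1, ⟨x.2 - 1, (Nat.sub_le _ _).trans_lt x.2.2⟩⟩

/-- The other end of the band in a vertex disc that starts at the initial end of `x`, for a strand
`x` that is not the first of its path. -/
def partner (x : f.Strand) : f.Strand := revStrand (prevStrand x)

theorem over_firstStrand (d : G.Dart) : (f.firstStrand d).over = f.init d := by
  simp [Strand.over, firstStrand, init, List.head_eq_getElem]

theorem eq_firstStrand {x : f.Strand} (h : (x.2 : ℕ) = 0) : x = f.firstStrand x.1 :=
  Strand.ext_val rfl h

theorem val_partner (x : f.Strand) (h : 0 < (x.2 : ℕ)) :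
    ((partner x).2 : ℕ) = (f.path x.1).length - x.2 := by
  have := x.2.2
  simp only [partner, revStrand, prevStrand]
  omega

theorem partner_pos {x : f.Strand} (h : 0 < (x.2 : ℕ)) : 0 < ((partner x).2 : ℕ) := by
  have := x.2.2
  rw [val_partner x h]
  omega

theorem partner_partner {x : f.Strand} (h : 0 < (x.2 : ℕ)) : partner (partner x) = x := by
  have := x.2.2
  have h1 : (f.path (partner x).1).length = (f.path x.1).length := by
    change (f.path (G.rev x.1)).length = _
    rw [f.path_rev, List.length_reverse, List.length_map]
  refine Strand.ext_val (G.rev_rev _) ?_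
  rw [val_partner _ (partner_pos h), val_partner x h, h1]
  omega

theorem partner_ne (x : f.Strand) : partner x ≠ x := fun h =>
  G.rev_ne x.1 (congrArg Sigma.fst h)

theorem over_partner (x : f.Strand) : (partner x).over = G.rev (prevStrand x).over :=
  over_revStrand _

/-- The index of a strand decides its piece: index `0` means the image of a vertex disc, and a
positive index means a band with exactly the two ends `x` and `partner x`. -/
theorem samePiece_iff {x y : f.Strand} : f.SamePiece x y ↔
    x = y ∨ ((x.2 : ℕ) = 0 ∧ (y.2 : ℕ) = 0 ∧ G.SameVertex x.1 y.1) ∨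
      (0 < (x.2 : ℕ) ∧ y = partner x) := by
  rw [SamePiece]
  refine or_congr Iff.rfl (or_congr ?_ ?_)
  · constructor
    · rintro ⟨d, d', h, rfl, rfl⟩
      exact ⟨rfl, rfl, h⟩
    · rintro ⟨h1, h2, h3⟩
      exact ⟨_, _, h3, eq_firstStrand h1, eq_firstStrand h2⟩
  · constructor
    · rintro ⟨z, h1, h2, h3⟩
      have hz : z = prevStrand x := Strand.ext_val h1 (by simp only [prevStrand]; omega)
      subst hz
      exact ⟨by omega, isReverse_iff.1 h3⟩
    · rintro ⟨h1, rfl⟩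
      exact ⟨prevStrand x, rfl, by simp only [prevStrand]; omega, isReverse_iff.2 rfl⟩

theorem SamePiece.symm {x y : f.Strand} (h : f.SamePiece x y) : f.SamePiece y x := by
  rw [samePiece_iff] at *
  rcases h with rfl | ⟨h1, h2, h3⟩ | ⟨h, rfl⟩
  · exact Or.inl rfl
  · exact Or.inr (Or.inl ⟨h2, h1, h3.symm⟩)
  · exact Or.inr (Or.inr ⟨partner_pos h, (partner_partner h).symm⟩)

theorem SamePiece.trans {x y z : f.Strand} (h : f.SamePiece x y) (h' : f.SamePiece y z) :
    f.SamePiece x z := by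
  rw [samePiece_iff] at *
  rcases h with rfl | ⟨h1, h2, h3⟩ | ⟨h, rfl⟩
  · exact h'
  · rcases h' with rfl | ⟨h1', h2', h3'⟩ | ⟨h', rfl⟩
    · exact Or.inr (Or.inl ⟨h1, h2, h3⟩)
    · exact Or.inr (Or.inl ⟨h1, h2', h3.trans h3'⟩)
    · omega
  · have := partner_pos h
    rcases h' with rfl | ⟨h1', h2', h3'⟩ | ⟨h', rfl⟩
    · exact Or.inr (Or.inr ⟨h, rfl⟩)
    · omega
    · exact Or.inl (partner_partner h).symm

theorem sameVertex_over_partner {x : f.Strand} (h : 0 < (x.2 : ℕ)) :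
    G.SameVertex x.over (partner x).over := by
  have hc := List.isChain_iff_getElem.1 (f.path_chain x.1) (x.2 - 1) (by have := x.2.2; omega)
  rw [over_partner]
  refine Equiv.Perm.SameCycle.symm ?_
  have e : x.over = (f.path x.1)[(x.2 : ℕ) - 1 + 1]'(by have := x.2.2; omega) := by
    simp only [Strand.over, List.get_eq_getElem, Nat.sub_add_cancel h]
  rw [e]
  exact hc

theorem SamePiece.sameVertex {x y : f.Strand} (h : f.SamePiece x y) :
    G.SameVertex x.over y.over := by
  rw [samePiece_iff] at h
  rcases h with rfl | ⟨h1, h2, h3⟩ | ⟨h, rfl⟩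
  · exact Equiv.Perm.SameCycle.refl _ _
  · rw [eq_firstStrand h1, eq_firstStrand h2, over_firstStrand, over_firstStrand]
    exact f.path_vertex _ _ h3
  · exact sameVertex_over_partner h

/-- The position of the initial end of a strand. -/
def key (O : DartOrder G) (height : f.Strand → ℝ) (x : f.Strand) : ℕ ×ₗ ℝ :=
  toLex (O.pos x.over, height x)

/-- The cases in the definition of `StrandCcw` are those of the cyclic order of the lexicographic
product of dart position and height. Order arguments then need no case distinction on darts. -/
theorem strandCcw_iff (O : DartOrder G) (height : f.Strand → ℝ) {x y z : f.Strand}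
    (hxy : G.SameVertex x.over y.over) (hxz : G.SameVertex x.over z.over) :
    f.StrandCcw height x y z ↔ Cyc (key O height x) (key O height y) (key O height z) := by
  have hyz : G.SameVertex y.over z.over := hxy.symm.trans hxz
  simp only [StrandCcw, hxy, hyz, true_and, O.ccw_iff hxy hxz, ← O.inj.eq_iff, key, Cyc, ne_eq,
    Prod.Lex.toLex_lt_toLex]
  grind

theorem StrandCcw.sameVertex {height : f.Strand → ℝ} {x y z : f.Strand}
    (h : f.StrandCcw height x y z) :
    G.SameVertex x.over y.over ∧ G.SameVertex x.over z.over := ⟨h.1, h.1.trans h.2.1⟩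

end GraphMap

/-! ## Composites of embeddings of the ribbon neighbourhood -/

/-- Finitely many strict inequalities survive a small perturbation. This provides the width of the
ribbon of `f` once it is placed inside the strands of `g`. -/
theorem exists_pos_add_mul_lt {A B : Type*} [Finite A] [Finite B] (u : A → ℝ) (v : B → ℝ) :
    ∃ ε > 0, ∀ a a' b b', u a < u a' → u a + ε * v b < u a' + ε * v b' := by
  have h : ∀ᶠ ε : ℝ in 𝓝[>] 0, ∀ a a' b b', u a < u a' → u a + ε * v b < u a' + ε * v b' := by
    simp only [Filter.eventually_all]
    intro a a' b b' h
    have h1 : Filter.Tendsto (fun ε : ℝ => u a + ε * v b) (𝓝[>] 0) (𝓝 (u a + 0 * v b)) :=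
      ((continuous_const.add (continuous_id.mul continuous_const)).tendsto 0).mono_left
        nhdsWithin_le_nhds
    have h2 : Filter.Tendsto (fun ε : ℝ => u a' + ε * v b') (𝓝[>] 0) (𝓝 (u a' + 0 * v b')) :=
      ((continuous_const.add (continuous_id.mul continuous_const)).tendsto 0).mono_left
        nhdsWithin_le_nhds
    exact h1.eventually_lt h2 (by simpa using h)
  obtain ⟨ε, h1, h2⟩ := (h.and self_mem_nhdsWithin).exists
  exact ⟨ε, h2, h1⟩

/-- If `p = p'`, the two cyclic orders would compare `q` and `q'` in opposite ways. So a crossing in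
the product comes from a crossing of first coordinates. -/
theorem Cyc.of_lex_pairs {α β : Type*} [LinearOrder α] [LinearOrder β] {p p' r r' : α}
    {q q' s s' : β} (h1 : r ≠ p) (h2 : r ≠ p') (h3 : r' ≠ p) (h4 : r' ≠ p')
    (h : Cyc (toLex (p, q)) (toLex (r, s)) (toLex (p', q')))
    (h' : Cyc (toLex (p', q')) (toLex (r', s')) (toLex (p, q))) : Cyc p r p' ∧ Cyc p' r' p := by
  rcases eq_or_ne p p' with rfl | hp
  · have e1 := (lex_iff_of_eq_of_ne h1.symm).1 h.rotate.rotate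
    have e2 := (lex_iff_of_eq_of_ne h3.symm).1 h'.rotate.rotate
    exact absurd e1 e2.asymm
  · exact ⟨of_lex h1.symm h2 hp.symm h, of_lex h4.symm h3 hp h'⟩

namespace GraphMap

open RibbonGraph List

variable {G : RibbonGraph} {f g : GraphMap G}

/-- The strand `X` of `g ∘ f` is the part over `y` of the image under `g` of the strand `x`. -/
structure IsCompStrand (X : (g.comp f).Strand) (x : f.Strand) (y : g.Strand) : Prop where
  fst_eq : X.1 = x.1
  over_eq : y.1 = x.over
  val_eq : (X.2 : ℕ) = flatOffset g.path (f.path x.1) x.2 + y.2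

theorem val_lt_length_getElem {x : f.Strand} {y : g.Strand} (h : y.1 = x.over) :
    (y.2 : ℕ) < (g.path (f.path x.1)[(x.2 : ℕ)]).length := by
  obtain ⟨a, k⟩ := y
  obtain rfl : a = x.over := h
  exact k.2

theorem exists_isCompStrand (X : (g.comp f).Strand) : ∃ x y, IsCompStrand X x y := by
  obtain ⟨d, i⟩ := X
  obtain ⟨j, hj, k, hk, h⟩ := exists_flatOffset g.path (f.path d) i.2
  exact ⟨⟨d, j, hj⟩, ⟨(f.path d)[j], k, hk⟩, rfl, rfl, h⟩

namespace IsCompStrand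

variable {X X' : (g.comp f).Strand} {x x' : f.Strand} {y y' : g.Strand}

theorem unique (h : IsCompStrand X x y) (h' : IsCompStrand X x' y') : x = x' ∧ y = y' := by
  have e : x.1 = x'.1 := h.fst_eq.symm.trans h'.fst_eq
  have e' := h.val_eq.symm.trans h'.val_eq
  have l1 := val_lt_length_getElem h.over_eq
  have l2 := val_lt_length_getElem h'.over_eq
  obtain ⟨d, i⟩ := x
  obtain ⟨d', i'⟩ := x'
  obtain rfl : d = d' := e
  obtain ⟨h1, h2⟩ := flatOffset_inj g.path (f.path d) i.2 l1 i'.2 l2 e'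
  obtain rfl : i = i' := Fin.ext h1
  exact ⟨rfl, Strand.ext_val (h.over_eq.trans h'.over_eq.symm) h2⟩

theorem eq (h : IsCompStrand X x y) (h' : IsCompStrand X' x y) : X = X' :=
  Strand.ext_val (h.fst_eq.trans h'.fst_eq.symm) (h.val_eq.trans h'.val_eq.symm)

theorem over_eq_over (h : IsCompStrand X x y) : X.over = y.over := by
  obtain ⟨d, i⟩ := X
  obtain ⟨d', j⟩ := x
  obtain ⟨a, k⟩ := y
  obtain ⟨h1, h2, h3⟩ := h
  obtain rfl : d = d' := h1
  obtain rfl : a = (f.path d).get j := h2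
  have := getElem_flatMap g.path (f.path d) j.2 k.2
  simp only [Strand.over, List.get_eq_getElem, comp_path]
  simp only at h3
  rw [← this]
  congr 1
  exact Fin.ext h3

theorem firstStrand (f g : GraphMap G) (d : G.Dart) :
    IsCompStrand ((g.comp f).firstStrand d) (f.firstStrand d) (g.firstStrand (f.init d)) :=
  ⟨rfl, (over_firstStrand d).symm, rfl⟩

theorem revStrand (h : IsCompStrand X x y) :
    IsCompStrand (revStrand X) (revStrand x) (revStrand y) := by
  refine ⟨congrArg G.rev h.fst_eq, ?_, ?_⟩
  · rw [over_revStrand]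
    exact congrArg G.rev h.over_eq
  · obtain ⟨d, i⟩ := X
    obtain ⟨d', j⟩ := x
    obtain ⟨a, k⟩ := y
    obtain ⟨h1, h2, h3⟩ := h
    obtain rfl : d = d' := h1
    obtain rfl : a = (f.path d).get j := h2
    have hj := j.2
    have hk := k.2
    have hi := i.2
    simp only [GraphMap.revStrand] at h3 ⊢
    have e1 : flatOffset g.path (f.path (G.rev d)) ((f.path d).length - 1 - j) =
        (((f.path d).drop (j + 1)).flatMap g.path).length := by
      rw [flatOffset, f.path_rev, List.take_reverse, ← List.map_drop, flatMap_rev,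
        List.length_reverse, List.length_map, List.length_map]
      congr 4
      omega
    have e2 : ((g.comp f).path d).length =
        flatOffset g.path (f.path d) (j + 1) + (((f.path d).drop (j + 1)).flatMap g.path).length := by
      rw [flatOffset, ← List.length_append, ← List.flatMap_append, List.take_append_drop]
      rfl
    rw [flatOffset_succ g.path _ hj, show (f.path d)[(j : ℕ)] = (f.path d).get j from rfl] at e2
    rw [e1, h3, e2]
    omega

theorem prevStrand (h : IsCompStrand X x y) (hy : 0 < (y.2 : ℕ)) :
    IsCompStrand (prevStrand X) x (prevStrand y) := by
  refine ⟨h.fst_eq, h.over_eq, ?_⟩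
  have := h.val_eq
  simp only [GraphMap.prevStrand]
  omega

/-- Stepping back from the first strand of a block leads to the last strand of the block before.
That is the first strand of the reversed dart, run backwards, and the reversed dart is the one under
`partner x`. -/
theorem prevStrand_of_eq_zero (h : IsCompStrand X x y) (hy : (y.2 : ℕ) = 0)
    (hx : 0 < (x.2 : ℕ)) :
    IsCompStrand (GraphMap.prevStrand X) (GraphMap.prevStrand x)
      (GraphMap.revStrand (g.firstStrand (partner x).over)) := by
  refine ⟨h.fst_eq, ?_, ?_⟩
  · change G.rev (partner x).over = _
    rw [over_partner, G.rev_rev]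
  · obtain ⟨d, i⟩ := X
    obtain ⟨d', j⟩ := x
    obtain ⟨h1, -, h3⟩ := h
    obtain rfl : d = d' := h1
    have hj : (j : ℕ) - 1 < (f.path d).length := by omega
    have e := flatOffset_succ g.path (f.path d) hj
    simp only at hx h3
    have e1 : (g.path (partner (⟨d, j⟩ : f.Strand)).over).length =
        (g.path (f.path d)[(j : ℕ) - 1]).length := by
      rw [over_partner, g.path_rev, List.length_reverse, List.length_map]
      rfl
    have e2 := List.length_pos_of_ne_nil (g.path_ne_nil (f.path d)[(j : ℕ) - 1])
    rw [Nat.sub_add_cancel hx] at e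
    simp only [GraphMap.prevStrand, GraphMap.revStrand, GraphMap.firstStrand]
    omega

/-- The ends of a piece of the image of `g ∘ f` in a vertex disc are the ends of a band in the image
of `g`, or come from the ends of a piece of the image of `f`. -/
theorem of_samePiece (h : IsCompStrand X x y) (h' : IsCompStrand X' x' y')
    (hX : (g.comp f).SamePiece X X') :
    X = X' ∨ (0 < (y.2 : ℕ) ∧ x' = GraphMap.revStrand x ∧ y' = partner y) ∨
      ((y.2 : ℕ) = 0 ∧ (y'.2 : ℕ) = 0 ∧ f.SamePiece x x') := by
  rcases samePiece_iff.1 hX with hX | ⟨h1, h2, h3⟩ | ⟨h1, rfl⟩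
  · exact Or.inl hX
  · rw [eq_firstStrand h1] at h
    rw [eq_firstStrand h2] at h'
    obtain ⟨rfl, rfl⟩ := h.unique (firstStrand f g _)
    obtain ⟨rfl, rfl⟩ := h'.unique (firstStrand f g _)
    exact Or.inr (Or.inr ⟨rfl, rfl, samePiece_iff.2 (Or.inr (Or.inl ⟨rfl, rfl, h3⟩))⟩)
  · rcases Nat.eq_zero_or_pos y.2 with hy | hy
    · have hx : 0 < (x.2 : ℕ) := by
        by_contra hx
        have h2 := h.val_eq
        rw [Nat.eq_zero_of_not_pos hx, flatOffset_zero] at h2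
        omega
      obtain ⟨rfl, rfl⟩ := h'.unique (h.prevStrand_of_eq_zero hy hx).revStrand
      refine Or.inr (Or.inr ⟨hy, ?_, samePiece_iff.2 (Or.inr (Or.inr ⟨hx, rfl⟩))⟩)
      rw [revStrand_revStrand]
      rfl
    · obtain ⟨rfl, rfl⟩ := h'.unique (h.prevStrand hy).revStrand
      exact Or.inr (Or.inl ⟨hy, rfl, rfl⟩)

/-- Used in contrapositive form: initial strands in different pieces of `g ∘ f` come from different
pieces of `f`. -/
theorem samePiece (h : IsCompStrand X x y) (h' : IsCompStrand X' x' y') (hy : (y.2 : ℕ) = 0)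
    (hy' : (y'.2 : ℕ) = 0) (hx : f.SamePiece x x') : (g.comp f).SamePiece X X' := by
  rw [samePiece_iff] at *
  have ey : y = g.firstStrand x.over := by rw [← h.over_eq]; exact eq_firstStrand hy
  have ey' : y' = g.firstStrand x'.over := by rw [← h'.over_eq]; exact eq_firstStrand hy'
  rcases hx with rfl | ⟨h1, h2, h3⟩ | ⟨h1, rfl⟩
  · rw [ey] at h
    rw [ey'] at h'
    exact Or.inl (h.eq h')
  · refine Or.inr (Or.inl ⟨?_, ?_, ?_⟩)
    · rw [h.val_eq, h1, hy]; rfl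
    · rw [h'.val_eq, h2, hy']; rfl
    · rw [h.fst_eq, h'.fst_eq]; exact h3
  · refine Or.inr (Or.inr ⟨?_, ?_⟩)
    · rw [h.val_eq]
      have hj : (x.2 : ℕ) - 1 < (f.path x.1).length := by have := x.2.2; omega
      have e := flatOffset_succ g.path (f.path x.1) hj
      rw [Nat.sub_add_cancel h1] at e
      have e2 := List.length_pos_of_ne_nil (g.path_ne_nil (f.path x.1)[(x.2 : ℕ) - 1])
      omega
    · have e := (h.prevStrand_of_eq_zero hy h1).revStrand
      rw [revStrand_revStrand, ← ey'] at e
      exact h'.eq e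

end IsCompStrand

/-- The heights of an embedding of the ribbon neighbourhood that induces `f`. -/
structure IsEmbeddingHeight (f : GraphMap G) (height : f.Strand → ℝ) : Prop where
  rev : ∀ x, height (revStrand x) = - height x
  inj : ∀ x y : f.Strand, x.over = y.over → height x = height y → x = y
  noncrossing : ∀ (O : DartOrder G) (x y z w), f.SamePiece x y → f.SamePiece z w →
    ¬ f.SamePiece x z → G.SameVertex x.over z.over →
    Cyc (key O height x) (key O height z) (key O height y) →
    Cyc (key O height y) (key O height w) (key O height x) → False
  first : ∀ (O : DartOrder G) (a b c), G.Ccw a b c → Cyc (key O height (f.firstStrand a))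
    (key O height (f.firstStrand b)) (key O height (f.firstStrand c))

/-- The cyclic order at a vertex does not depend on the auxiliary `DartOrder`. Quantifying over all
of them costs nothing and leaves later arguments free to use one adapted to the gates. -/
theorem isEmbedded_iff : f.IsEmbedded ↔ ∃ height, IsEmbeddingHeight f height := by
  refine exists_congr fun height => ⟨fun ⟨h1, h2, h3, h4⟩ => ⟨?_, h2, ?_, ?_⟩,
    fun ⟨h1, h2, h3, h4⟩ => ⟨?_, h2, ?_, ?_⟩⟩
  · exact fun x => h1 x _ (isReverse_iff.2 rfl)
  · intro O x y z w hxy hzw hxz hv k1 k2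
    refine h3 x y z w hxy hzw hxz ⟨(strandCcw_iff O height hv hxy.sameVertex).2 k1,
      (strandCcw_iff O height ?_ hxy.sameVertex.symm).2 k2⟩
    exact hxy.sameVertex.symm.trans (hv.trans hzw.sameVertex)
  · intro O a b c h
    exact (strandCcw_iff O height (h4 a b c h).sameVertex.1 (h4 a b c h).sameVertex.2).1
      (h4 a b c h)
  · rintro x y h
    rw [isReverse_iff.1 h, h1]
  · rintro x y z w hxy hzw hxz ⟨k1, k2⟩
    have O : DartOrder G := Classical.choice inferInstance
    exact h3 O x y z w hxy hzw hxz k1.1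
      ((strandCcw_iff O height k1.sameVertex.1 k1.sameVertex.2).1 k1)
      ((strandCcw_iff O height k2.sameVertex.1 k2.sameVertex.2).1 k2)
  · intro a b c h
    have O : DartOrder G := Classical.choice inferInstance
    refine (strandCcw_iff O height ?_ ?_).2 (h4 O a b c h)
    · rw [over_firstStrand, over_firstStrand]
      exact f.path_vertex _ _ h.sameVertex.1
    · rw [over_firstStrand, over_firstStrand]
      exact f.path_vertex _ _ h.sameVertex.2

theorem key_injective (O : DartOrder G) {height : f.Strand → ℝ} (h : IsEmbeddingHeight f height) :
    Function.Injective (key O height) := by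
  intro x y hxy
  have e := toLex.injective hxy
  rw [Prod.mk.injEq] at e
  exact h.inj x y (O.inj e.1) e.2

/-- The strands of `g ∘ f` are thin parallel copies of the strands of `g`, stacked in the order
given by the heights of `f`. Two crossing pieces would cross already in `g`, or inside one vertex
disc of `g` as in `f`, or inside one band of `g`, where copies are parallel. -/
theorem IsEmbedded.comp (hg : g.IsEmbedded) (hf : f.IsEmbedded) : (g.comp f).IsEmbedded := by
  rw [isEmbedded_iff] at *
  obtain ⟨hgt, hg⟩ := hg
  obtain ⟨hft, hf⟩ := hf
  choose p q hpq using exists_isCompStrand (f := f) (g := g)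
  obtain ⟨ε, hε, hlt⟩ := exists_pos_add_mul_lt hgt hft
  let ht : (g.comp f).Strand → ℝ := fun X => hgt (q X) + ε * hft (p X)
  have hpe : ∀ {X Y}, p X = p Y → q X = q Y → X = Y := fun {X Y} h1 h2 => by
    have := hpq Y
    rw [← h1, ← h2] at this
    exact (hpq X).eq this
  have hinj : ∀ X Y, X.over = Y.over → ht X = ht Y → q X = q Y ∧ hft (p X) = hft (p Y) := by
    intro X Y ho hh
    have h1 : hgt (q X) = hgt (q Y) := by
      rcases lt_trichotomy (hgt (q X)) (hgt (q Y)) with h | h | h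
      · exact absurd hh (hlt _ _ (p X) (p Y) h).ne
      · exact h
      · exact absurd hh (hlt _ _ (p Y) (p X) h).ne'
    refine ⟨hg.inj _ _ ?_ h1, ?_⟩
    · rwa [← (hpq X).over_eq_over, ← (hpq Y).over_eq_over]
    · simp only [ht, h1] at hh
      exact mul_left_cancel₀ hε.ne' (add_left_cancel hh)
  have hover : ∀ {X Y}, q X = q Y → (p X).over = (p Y).over := fun {X Y} h => by
    rw [← (hpq X).over_eq, ← (hpq Y).over_eq, h]
  -- By the choice of `ε`, the `g`-strand decides first and the height in `f` only breaks ties.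
  have hkey : ∀ (O : DartOrder G) (X Y), key O ht X < key O ht Y ↔
      toLex (key O hgt (q X), hft (p X)) < toLex (key O hgt (q Y), hft (p Y)) := by
    intro O X Y
    have hi := (key_injective O hg).eq_iff (a := q X) (b := q Y)
    rw [Prod.Lex.toLex_lt_toLex, hi]
    simp only [key, Prod.Lex.toLex_lt_toLex, (hpq X).over_eq_over, (hpq Y).over_eq_over, O.inj.eq_iff]
    constructor
    · rintro (h | ⟨h1, h2⟩)
      · exact Or.inl (Or.inl h)
      · rcases lt_trichotomy (hgt (q X)) (hgt (q Y)) with h | h | h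
        · exact Or.inl (Or.inr ⟨h1, h⟩)
        · refine Or.inr ⟨hg.inj _ _ h1 h, ?_⟩
          simp only [ht, h] at h2
          exact lt_of_mul_lt_mul_left (lt_of_add_lt_add_left h2) hε.le
        · exact absurd h2 (hlt _ _ (p Y) (p X) h).asymm
    · rintro ((h | ⟨h1, h2⟩) | ⟨h1, h2⟩)
      · exact Or.inl h
      · exact Or.inr ⟨h1, hlt _ _ _ _ h2⟩
      · refine Or.inr ⟨by rw [h1], ?_⟩
        simp only [ht, h1]
        exact add_lt_add_right (mul_lt_mul_of_pos_left h2 hε) _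
  have hcyc : ∀ (O : DartOrder G) (X Y Z), Cyc (key O ht X) (key O ht Y) (key O ht Z) ↔
      Cyc (toLex (key O hgt (q X), hft (p X))) (toLex (key O hgt (q Y), hft (p Y)))
        (toLex (key O hgt (q Z), hft (p Z))) := fun O X Y Z => by
    simp only [Cyc, hkey]
  -- Cyclic order of the strands of `f` is inherited by the initial strands of their images.
  have hfwd : ∀ (O : DartOrder G) (X Y Z), ((q X).2 : ℕ) = 0 → ((q Y).2 : ℕ) = 0 →
      ((q Z).2 : ℕ) = 0 → G.SameVertex (p X).over (p Y).over → G.SameVertex (p X).over (p Z).over →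
      Cyc (key O hft (p X)) (key O hft (p Y)) (key O hft (p Z)) →
      Cyc (key O ht X) (key O ht Y) (key O ht Z) := by
    intro O X Y Z hX hY hZ hXY hXZ h
    have hq : ∀ W, ((q W).2 : ℕ) = 0 → q W = g.firstStrand (p W).over := fun W hW => by
      rw [← (hpq W).over_eq]; exact eq_firstStrand hW
    have hk : ∀ {a b}, a ≠ b → key O hgt (g.firstStrand a) ≠ key O hgt (g.firstStrand b) :=
      fun hab h => hab (congrArg Sigma.fst (key_injective O hg h))
    rw [hcyc, hq X hX, hq Y hY, hq Z hZ]
    have two : ∀ {U V W : f.Strand}, U.over = V.over → V.over ≠ W.over →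
        Cyc (key O hft U) (key O hft V) (key O hft W) →
        Cyc (toLex (key O hgt (g.firstStrand U.over), hft U))
          (toLex (key O hgt (g.firstStrand V.over), hft V))
          (toLex (key O hgt (g.firstStrand W.over), hft W)) := by
      intro U V W h1 h2 h
      simp only [key, h1] at h
      rw [Cyc.lex_iff_of_eq_of_ne (O.inj.ne h2)] at h
      rw [h1, Cyc.lex_iff_of_eq_of_ne (hk h2)]
      exact h
    by_cases h1 : (p X).over = (p Y).over
    · by_cases h2 : (p Y).over = (p Z).over
      · simp only [key, h1, h2, Cyc.lex_iff_of_eq] at h ⊢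
        exact h
      · exact two h1 h2 h
    · by_cases h2 : (p Y).over = (p Z).over
      · exact (two h2 (fun h3 => h1 (h3.symm.trans h2.symm)) h.rotate).rotate.rotate
      · by_cases h3 : (p Z).over = (p X).over
        · exact (two h3 h1 h.rotate.rotate).rotate
        · refine Cyc.lex_of_ne (hg.first O _ _ _ ?_)
          rw [O.ccw_iff hXY hXZ]
          exact Cyc.of_lex (O.inj.ne h1) (O.inj.ne h2) (O.inj.ne h3) h
  refine ⟨ht, ?_, ?_, ?_, ?_⟩
  · intro X
    obtain ⟨h1, h2⟩ := (hpq (revStrand X)).unique (hpq X).revStrand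
    simp only [ht, h1, h2, hf.rev, hg.rev]
    ring
  · intro X Y ho hh
    obtain ⟨h1, h2⟩ := hinj X Y ho hh
    exact hpe (hf.inj _ _ (hover h1) h2) h1
  · intro O A B C D hAB hCD hAC hv k1 k2
    have nAB : A ≠ B := by
      rintro rfl
      exact k1.rotate.rotate.ne_left rfl
    have nCD : C ≠ D := by
      rintro rfl
      exact k1.asymm k2
    have cAB := (hpq A).of_samePiece (hpq B) hAB
    have cCD := (hpq C).of_samePiece (hpq D) hCD
    have hp0 : ∀ {X}, ((q X).2 : ℕ) = 0 → ((q X) = g.firstStrand (p X).over) := fun {X} hX => by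
      rw [← (hpq X).over_eq]; exact eq_firstStrand hX
    have piece : ∀ {X Y}, X ≠ Y → (X = Y ∨ (0 < ((q X).2 : ℕ) ∧ p Y = revStrand (p X) ∧
        q Y = partner (q X)) ∨ (((q X).2 : ℕ) = 0 ∧ ((q Y).2 : ℕ) = 0 ∧ f.SamePiece (p X) (p Y))) →
        g.SamePiece (q X) (q Y) := by
      rintro X Y hXY (h | ⟨h1, -, h2⟩ | ⟨h1, h2, h3⟩)
      · exact absurd h hXY
      · exact samePiece_iff.2 (Or.inr (Or.inr ⟨h1, h2⟩))
      · refine samePiece_iff.2 (Or.inr (Or.inl ⟨h1, h2, ?_⟩))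
        rw [(hpq X).over_eq, (hpq Y).over_eq]
        exact h3.sameVertex
    have gAB := piece nAB cAB
    have gCD := piece nCD cCD
    have k1' := (hcyc O A C B).1 k1
    have k2' := (hcyc O B D A).1 k2
    by_cases gAC : g.SamePiece (q A) (q C)
    -- Both pieces lie in one piece of `g`. If it is the image of a vertex disc, all four ends are
    -- initial strands and the crossing is pulled back to `f`.
    · rcases Nat.eq_zero_or_pos (q A).2 with a0 | a0
      · obtain ⟨c0, hvp⟩ : ((q C).2 : ℕ) = 0 ∧ G.SameVertex (p A).over (p C).over := by
          rw [← (hpq A).over_eq, ← (hpq C).over_eq]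
          rcases samePiece_iff.1 gAC with e | ⟨-, c0, hv⟩ | ⟨a0', -⟩
          · exact ⟨by rw [← e, a0], by rw [e]; exact Equiv.Perm.SameCycle.refl _ _⟩
          · exact ⟨c0, hv⟩
          · omega
        rcases cAB with h | ⟨a0', -, -⟩ | ⟨-, b0, sAB⟩
        · exact nAB h
        · omega
        · rcases cCD with h | ⟨c0', -, -⟩ | ⟨-, d0, sCD⟩
          · exact nCD h
          · omega
          · have fAC : ¬ f.SamePiece (p A) (p C) := fun h =>
              hAC ((hpq A).samePiece (hpq C) a0 c0 h)
            -- Of three distinct ends exactly one of the two cyclic orders holds, so the forward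
            -- statement `hfwd` also gives its converse.
            have hback : ∀ {X Y Z}, ((q X).2 : ℕ) = 0 → ((q Y).2 : ℕ) = 0 → ((q Z).2 : ℕ) = 0 →
                G.SameVertex (p X).over (p Y).over → G.SameVertex (p X).over (p Z).over →
                p X ≠ p Y → p Y ≠ p Z → Cyc (key O ht X) (key O ht Y) (key O ht Z) →
                Cyc (key O hft (p X)) (key O hft (p Y)) (key O hft (p Z)) := by
              intro X Y Z hX hY hZ hXY hXZ n1 n2 h
              have inj := key_injective O hf
              rcases Cyc.total (inj.ne n1) (inj.ne n2) (inj.ne fun h3 => by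
                have e : q Z = q X := by rw [hp0 hX, hp0 hZ, h3]
                exact h.rotate.rotate.ne_left (congrArg _ (hpe h3 e))) with h' | h'
              · exact h'
              · exact (h.asymm (hfwd O Z Y X hZ hY hX (hXZ.symm.trans hXY) hXZ.symm h')).elim
            have sne : ∀ {u v : f.Strand}, ¬ f.SamePiece u v → u ≠ v :=
              fun h e => h (samePiece_iff.2 (Or.inl e))
            have fBC : ¬ f.SamePiece (p B) (p C) := fun h => fAC (sAB.trans h)
            have fAD : ¬ f.SamePiece (p A) (p D) := fun h => fAC (h.trans sCD.symm)
            have fBD : ¬ f.SamePiece (p B) (p D) := fun h => fBC (h.trans sCD.symm)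
            exact hf.noncrossing O _ _ _ _ sAB sCD fAC hvp
              (hback a0 c0 b0 hvp sAB.sameVertex (sne fAC) (sne fBC).symm k1)
              (hback b0 d0 a0 (sAB.sameVertex.symm.trans (hvp.trans sCD.sameVertex))
                sAB.sameVertex.symm (sne fBD) (sne fAD).symm k2)
      -- If it is a band of `g`, both pieces are copies of that band. Reversal negates the heights
      -- in `f`, so the two ends of the band would give contradictory inequalities.
      · have c0 : 0 < ((q C).2 : ℕ) := by
          rcases samePiece_iff.1 gAC with e | ⟨a0', -, -⟩ | ⟨-, e⟩
          · rwa [← e]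
          · omega
          · rw [e]; exact partner_pos a0
        rcases cAB with h | ⟨-, eB, eB'⟩ | ⟨a0', -, -⟩
        · exact nAB h
        · rcases cCD with h | ⟨-, eD, eD'⟩ | ⟨c0', -, -⟩
          · exact nCD h
          · have n := (key_injective O hg).ne (partner_ne (q A))
            rcases samePiece_iff.1 gAC with e | ⟨a0', -, -⟩ | ⟨-, e⟩
            · rw [eB', ← e, eB] at k1'
              rw [eB', eD', eB, eD, ← e] at k2'
              have l1 := (Cyc.lex_iff_of_eq_of_ne n.symm).1 k1'
              have l2 := (Cyc.lex_iff_of_eq_of_ne n).1 k2'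
              rw [hf.rev, hf.rev] at l2
              linarith
            · omega
            · rw [e, partner_partner a0] at eD'
              rw [eB', e, eB] at k1'
              rw [eB', eD', eB, eD] at k2'
              have l1 := (Cyc.lex_iff_of_eq_of_ne n).1 k1'.rotate
              have l2 := (Cyc.lex_iff_of_eq_of_ne n.symm).1 k2'.rotate
              rw [hf.rev] at l1 l2
              linarith
          · omega
        · omega
    -- Different pieces of `g`: the crossing is visible in first coordinates and contradicts
    -- noncrossing of `g`.
    · have kne : ∀ {u v : g.Strand}, ¬ g.SamePiece u v → key O hgt u ≠ key O hgt v :=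
        fun h e => h (samePiece_iff.2 (Or.inl (key_injective O hg e)))
      have gBC : ¬ g.SamePiece (q B) (q C) := fun h => gAC (gAB.trans h)
      have gAD : ¬ g.SamePiece (q A) (q D) := fun h => gAC (h.trans gCD.symm)
      have gBD : ¬ g.SamePiece (q B) (q D) := fun h => gAC (gAB.trans (h.trans gCD.symm))
      obtain ⟨l1, l2⟩ := Cyc.of_lex_pairs (kne gAC).symm (kne gBC).symm (kne gAD).symm
        (kne gBD).symm k1' k2'
      refine hg.noncrossing O _ _ _ _ gAB gCD gAC ?_ l1 l2
      rwa [← (hpq A).over_eq_over, ← (hpq C).over_eq_over]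
  · intro O a b c h
    obtain ⟨h1, h2⟩ := (hpq _).unique (IsCompStrand.firstStrand f g a)
    obtain ⟨h3, h4⟩ := (hpq _).unique (IsCompStrand.firstStrand f g b)
    obtain ⟨h5, h6⟩ := (hpq _).unique (IsCompStrand.firstStrand f g c)
    refine hfwd O _ _ _ (by rw [h2]; rfl) (by rw [h4]; rfl) (by rw [h6]; rfl) ?_ ?_ ?_
    · rw [h1, h3, over_firstStrand, over_firstStrand]
      exact f.path_vertex _ _ h.sameVertex.1
    · rw [h1, h5, over_firstStrand, over_firstStrand]
      exact f.path_vertex _ _ h.sameVertex.2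
    · rw [h1, h3, h5]
      exact hf.first O a b c h

end GraphMap

namespace GraphMap

open RibbonGraph List

variable {G : RibbonGraph} {f : GraphMap G}

/-! ## Gates -/

/-- Passing to initial darts shifts the exponent of eventual coincidence by one. Hence `f` induces a
map of gates that is injective at each vertex. -/
theorem gate_init_iff {d d' : G.Dart} (h : G.SameVertex d d') :
    f.gate (f.init d) (f.init d') ↔ f.gate d d' := by
  constructor
  · rintro ⟨-, r, hr, e⟩
    refine ⟨h, r + 1, by omega, ?_⟩
    rw [init_iterate_add, init_iterate_add, iterate_one]
    exact e
  · rintro ⟨-, r, hr, e⟩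
    refine ⟨f.path_vertex _ _ h, r, hr, ?_⟩
    have := f.init_iterate_eq_of_le (Nat.le_succ r) e
    rwa [Nat.succ_eq_add_one, init_iterate_add, init_iterate_add, iterate_one] at this

/-- At the junction of the blocks `g(x)` and `g(y)`, the last dart of `g(x)` is the reverse of the
first dart of `g(rev x)`. -/
theorem infix_flatMap_turn (g : GraphMap G) {l : List G.Dart} {x y : G.Dart} (h : [x, y] <:+: l) :
    [G.rev (g.init (G.rev x)), g.init y] <:+: l.flatMap g.path := by
  obtain ⟨s, t, rfl⟩ := h
  refine ⟨s.flatMap g.path ++ (g.path x).dropLast, (g.path y).tail ++ t.flatMap g.path, ?_⟩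
  have h1 : (g.path x).dropLast ++ [G.rev (g.init (G.rev x))] = g.path x := by
    rw [← g.getLast_eq, G.rev_rev]
    exact List.dropLast_append_getLast _
  have h2 : g.init y :: (g.path y).tail = g.path y := List.cons_head_tail _
  calc _ = s.flatMap g.path ++ ((g.path x).dropLast ++ [G.rev (g.init (G.rev x))]) ++
        ((g.init y :: (g.path y).tail) ++ t.flatMap g.path) := by simp
    _ = _ := by rw [h1, h2]; simp

/-- A turn taken by the image of an edge is legal. -/
theorem IsTrainTrackMap.not_gate_of_infix (h : f.IsTrainTrackMap) {r : ℕ} {e x y : G.Dart}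
    (hxy : [x, y] <:+: (f.iterate r).path e) : ¬ f.gate (G.rev x) y := by
  rintro ⟨-, s, hs, hxs⟩
  have h1 := infix_flatMap_turn (f.iterate s) hxy
  rw [← comp_path, ← iterate_add, hxs] at h1
  have h2 := (h.noBacktrack (s + r) (by omega) e).infix h1
  simp only [List.isChain_cons_cons, List.isChain_singleton, and_true, G.rev_rev, ne_eq,
    not_true] at h2

theorem Joined.init {d d' : G.Dart} (h : f.Joined d d') : f.Joined (f.init d) (f.init d') := by
  have hv := f.trainTrack.joined_vertex d d' h
  obtain ⟨hg, r, hr, e, x, y, hxy, ht⟩ := h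
  refine ⟨fun k => hg ((gate_init_iff hv).1 k), r + 1, by omega, e, _, _,
    infix_flatMap_turn f hxy, ?_⟩
  have key : ∀ {a b}, f.gate a b → f.gate (f.init a) (f.init b) := fun k =>
    (gate_init_iff k.1).2 k
  rw [G.rev_rev]
  exact ht.imp (fun k => ⟨key k.1, key k.2⟩) fun k => ⟨key k.1, key k.2⟩

theorem infix_prevStrand (x : f.Strand) (hx : 0 < (x.2 : ℕ)) :
    [(prevStrand x).over, x.over] <:+: f.path x.1 := by
  have h1 : (x.2 : ℕ) - 1 < (f.path x.1).length := by have := x.2.2; omega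
  refine ⟨(f.path x.1).take (x.2 - 1), (f.path x.1).drop (x.2 + 1), ?_⟩
  conv_rhs => rw [← List.take_append_drop (x.2 - 1) (f.path x.1), List.drop_eq_getElem_cons h1]
  have h2 : (x.2 : ℕ) - 1 + 1 = x.2 := Nat.sub_add_cancel hx
  simp only [h2]
  rw [List.drop_eq_getElem_cons x.2.2]
  simp only [List.append_assoc]
  rfl

theorem IsTrainTrackMap.not_gate_partner (h : f.IsTrainTrackMap) {x : f.Strand}
    (hx : 0 < (x.2 : ℕ)) : ¬ f.gate x.over (partner x).over := by
  intro hg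
  rw [over_partner] at hg
  refine h.not_gate_of_infix (r := 1) (e := x.1) ?_ (f.gate.symm hg)
  rw [iterate_one]
  exact infix_prevStrand x hx

theorem IsTrainTrackMap.joined_partner (h : f.IsTrainTrackMap) {x : f.Strand}
    (hx : 0 < (x.2 : ℕ)) : f.Joined x.over (partner x).over := by
  refine ⟨h.not_gate_partner hx, 1, one_pos, x.1, (prevStrand x).over, x.over, ?_,
    Or.inr ⟨f.gate.refl _, ?_⟩⟩
  · rw [iterate_one]
    exact infix_prevStrand x hx
  · rw [over_partner]

/-- A vertex with a single gate is an end of the graph. -/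
theorem IsTrainTrackMap.exists_not_gate (h : f.IsTrainTrackMap) {d d' : G.Dart}
    (hv : G.SameVertex d d') (hne : d ≠ d') : ∃ e, G.SameVertex d e ∧ ¬ f.gate d e := by
  by_contra! hd
  -- `U` consists of the darts at one-gate vertices. An image path cannot pass through such a
  -- vertex, since its turns join different gates; so each dart of `U` is the initial dart of the
  -- image of a dart, which is again in `U`. By finiteness `init` permutes `U`, and two distinct
  -- darts of `U` never merge.
  let U : Set G.Dart := {a | ∀ e, G.SameVertex a e → f.gate a e}
  have h1 : ∀ a ∈ U, ∃ b ∈ U, f.init b = a := by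
    intro a ha
    obtain ⟨e, he⟩ := h.surjective a
    obtain ⟨i, hi⟩ := List.get_of_mem he
    let x : f.Strand := ⟨e, i⟩
    have hx : x.over = a := hi
    rcases Nat.eq_zero_or_pos x.2 with h0 | h0
    · refine ⟨e, fun b hb => (gate_init_iff hb).1 ?_, ?_⟩
      · have : f.init e = a := by rw [← over_firstStrand, ← hx, eq_firstStrand h0]
        rw [this]
        exact ha _ (this ▸ f.path_vertex _ _ hb)
      · rw [← over_firstStrand, ← hx, eq_firstStrand h0]
    · refine absurd (ha (partner x).over ?_) (hx ▸ h.not_gate_partner h0)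
      exact hx ▸ sameVertex_over_partner h0
  choose φ hφ hφ' using h1
  let ψ : U → U := fun a => ⟨φ a a.2, hφ a a.2⟩
  have hψ : ∀ a, f.init (ψ a) = a := fun a => hφ' a a.2
  have hinj : Function.Injective ψ := fun a b hab => Subtype.ext (by
    rw [← hψ a, ← hψ b, hab])
  have hsurj := Finite.surjective_of_injective hinj
  have hU : ∀ a ∈ U, f.init a ∈ U := by
    intro a ha
    obtain ⟨b, hb⟩ := hsurj ⟨a, ha⟩
    have := hψ b
    rw [hb] at this
    rw [this]
    exact b.2
  have hUi : ∀ a ∈ U, ∀ b ∈ U, f.init a = f.init b → a = b := by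
    intro a ha b hb hab
    obtain ⟨a', ha'⟩ := hsurj ⟨a, ha⟩
    obtain ⟨b', hb'⟩ := hsurj ⟨b, hb⟩
    have e1 := hψ a'
    have e2 := hψ b'
    rw [ha'] at e1
    rw [hb'] at e2
    have : a' = b' := Subtype.ext (by rw [← e1, ← e2]; exact hab)
    have e3 := congrArg Subtype.val (ha'.symm.trans ((congrArg ψ this).trans hb'))
    exact e3
  have hdU : d ∈ U := hd
  have hdU' : d' ∈ U := fun e he => f.gate.trans (f.gate.symm (hd d' hv)) (hd e (hv.trans he))
  obtain ⟨-, r, -, hr⟩ := hd d' hv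
  have key : ∀ r, ∀ a ∈ U, ∀ b ∈ U, (f.iterate r).init a = (f.iterate r).init b → a = b := by
    intro r
    induction r with
    | zero => intro a _ b _ e; exact e
    | succ r ih =>
      intro a ha b hb e
      rw [init_iterate_add, init_iterate_add, iterate_one] at e
      exact hUi a ha b hb (ih _ (hU a ha) _ (hU b hb) e)
  exact hne (key r d hdU d' hdU' hr)

/-- Gates are intervals in the cyclic order at a vertex. -/
theorem gate_or_gate_of_ccw (hf : f.IsEmbedded) {a b c d : G.Dart} (h1 : G.Ccw a b c)
    (h2 : G.Ccw c d a) (h : f.gate a c) : f.gate a b ∨ f.gate a d := by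
  obtain ⟨ht, hf⟩ := isEmbedded_iff.1 hf
  have O : DartOrder G := Classical.choice inferInstance
  obtain ⟨-, r, -, hr⟩ := h
  suffices ∃ s > 0, (f.iterate s).init a = (f.iterate s).init b ∨
      (f.iterate s).init a = (f.iterate s).init d by
    obtain ⟨s, hs, h | h⟩ := this
    · exact Or.inl ⟨h1.sameVertex.1, s, hs, h⟩
    · exact Or.inr ⟨h1.sameVertex.2.trans h2.sameVertex.1, s, hs, h⟩
  -- If `f` merges `b` or `d` with `a` or `c`, this finishes. Otherwise the configuration passes to
  -- the initial darts, with one iterate fewer needed to merge `a` and `c`.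
  induction r generalizing a b c d with
  | zero =>
    have e : a = c := hr
    subst e
    have := (O.ccw_iff h1.sameVertex.1 h1.sameVertex.2).1 h1
    exact absurd rfl this.rotate.rotate.ne_left
  | succ r ih =>
    have hi : ∀ x, (f.iterate (r + 1)).init x = (f.iterate r).init (f.init x) := fun x => by
      rw [init_iterate_add, iterate_one]
    have k1 := hf.first O _ _ _ h1
    have k2 := hf.first O _ _ _ h2
    by_cases hab : f.init a = f.init b
    · exact ⟨1, one_pos, Or.inl (by rwa [iterate_one])⟩
    by_cases had : f.init a = f.init d
    · exact ⟨1, one_pos, Or.inr (by rwa [iterate_one])⟩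
    by_cases hcb : f.init c = f.init b
    · exact ⟨r + 1, by omega, Or.inl (by rw [hr, hi, hi, hcb])⟩
    by_cases hcd : f.init c = f.init d
    · exact ⟨r + 1, by omega, Or.inr (by rw [hr, hi, hi, hcd])⟩
    simp only [key, over_firstStrand] at k1 k2
    -- Here `b` and `d` are sent over other darts, and the two cyclic orders compare the heights of
    -- `a` and `c` in opposite ways.
    by_cases hac : f.init a = f.init c
    · rw [hac] at k1 k2
      have l1 := (Cyc.lex_iff_of_eq_of_ne (O.inj.ne hcb)).1 k1.rotate.rotate
      have l2 := (Cyc.lex_iff_of_eq_of_ne (O.inj.ne hcd)).1 k2.rotate.rotate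
      exact absurd l1 l2.asymm
    · have v1 : G.SameVertex (f.init a) (f.init b) := f.path_vertex _ _ h1.sameVertex.1
      have v2 : G.SameVertex (f.init a) (f.init c) := f.path_vertex _ _ h1.sameVertex.2
      have v3 : G.SameVertex (f.init c) (f.init d) := f.path_vertex _ _ h2.sameVertex.1
      have c1 : G.Ccw (f.init a) (f.init b) (f.init c) := (O.ccw_iff v1 v2).2
        (Cyc.of_lex (O.inj.ne hab) (O.inj.ne (Ne.symm hcb)) (O.inj.ne (Ne.symm hac)) k1)
      have c2 : G.Ccw (f.init c) (f.init d) (f.init a) := (O.ccw_iff v3 v2.symm).2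
        (Cyc.of_lex (O.inj.ne hcd) (O.inj.ne (Ne.symm had)) (O.inj.ne hac) k2)
      rw [hi, hi] at hr
      obtain ⟨s, hs, h⟩ := ih c1 c2 hr
      refine ⟨s + 1, by omega, ?_⟩
      rw [init_iterate_add, init_iterate_add, init_iterate_add, iterate_one]
      exact h

/-- There is an order of the darts for which the gates are intervals. -/
theorem exists_gateOrder (hf : f.IsEmbedded) : ∃ O : DartOrder G,
    ∀ a b e, f.gate a b → O.pos a < O.pos e → O.pos e < O.pos b → f.gate a e := by
  -- The base dart at a vertex is chosen as the first dart of some gate, whenever a gate boundary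
  -- exists there; then no gate wraps around the start of the order.
  have hex : ∀ q : Quotient G.vertexSetoid, ∃ b : G.Dart, Quotient.mk _ b = q ∧
      (∀ d, Quotient.mk _ d = q → ¬ f.gate d (G.next.symm d) → ¬ f.gate b (G.next.symm b)) := by
    intro q
    by_cases h : ∃ d, Quotient.mk _ d = q ∧ ¬ f.gate d (G.next.symm d)
    · obtain ⟨d, hd, hg⟩ := h
      exact ⟨d, hd, fun _ _ _ => hg⟩
    · obtain ⟨b, hb⟩ := Quotient.exists_rep q
      exact ⟨b, hb, fun d hd hg => absurd ⟨d, hd, hg⟩ h⟩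
  choose B hB hB' using hex
  obtain ⟨O, hO⟩ := exists_dartOrder (G := G) (fun d => B (Quotient.mk _ d))
    (fun d => Quotient.exact (s := G.vertexSetoid) (hB _))
    (fun d d' h => congrArg B (Quotient.sound (s := G.vertexSetoid) h))
  refine ⟨O, fun a c e hac h1 h2 => ?_⟩
  by_contra hae
  have ve : G.SameVertex a e := O.sameVertex_of_between hac.1 h1 h2
  set b := B (Quotient.mk _ a) with hb
  have vb : G.SameVertex a b := (Quotient.exact (s := G.vertexSetoid) (hB _)).symm
  have hmin : ∀ x, G.SameVertex a x → O.pos b ≤ O.pos x := fun x hx => by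
    have := hO x
    rwa [← show Quotient.mk G.vertexSetoid a = Quotient.mk _ x from Quotient.sound hx] at this
  have c1 : G.Ccw a e c := (O.ccw_iff ve hac.1).2 (Or.inl ⟨h1, h2⟩)
  have fin : ∀ x, G.SameVertex a x → Cyc (O.pos c) (O.pos x) (O.pos a) → f.gate a x := fun x hx h =>
    (gate_or_gate_of_ccw hf c1 ((O.ccw_iff (hac.1.symm.trans hx) hac.1.symm).2 h) hac).resolve_left
      hae
  have gb : f.gate a b := by
    rcases (hmin a (Equiv.Perm.SameCycle.refl _ _)).lt_or_eq with h | h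
    · exact fin b vb (Or.inr (Or.inl ⟨h, h1.trans h2⟩))
    · rw [O.inj h]
  have hall : ¬ f.gate b (G.next.symm b) := by
    intro hbn
    have hn : ∀ x, G.SameVertex a x → f.gate x (G.next.symm x) := fun x hx => by
      by_contra h
      exact hB' _ x (Quotient.sound (s := G.vertexSetoid) hx.symm) h hbn
    obtain ⟨i, rfl⟩ := ve.exists_nat_pow_eq
    refine hae ?_
    have : ∀ i : ℕ, f.gate a ((G.next ^ i) a) := by
      intro i
      induction i with
      | zero => exact f.gate.refl _
      | succ i ih =>
        refine f.gate.trans ih ?_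
        have := hn ((G.next ^ (i + 1)) a) (SameVertex.pow_right _ _)
        rw [pow_succ', Equiv.Perm.mul_apply, Equiv.symm_apply_apply] at this
        rw [pow_succ', Equiv.Perm.mul_apply]
        exact f.gate.symm this
    exact this i
  -- A gap `e` in the gate forces the complementary arc from `c` round to `a` into that gate. This
  -- arc contains the last dart `p` and the gate of `a` contains the first dart `b`, against the
  -- choice of `b`.
  set p := G.next.symm b with hp
  have hnp : G.next p = b := by simp [hp]
  have vp : G.SameVertex p b := ⟨1, by simpa using hnp⟩
  have hpb : p ≠ b := fun h => hall (h ▸ f.gate.refl _)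
  have hpc : p ≠ c := fun h => hall (h ▸ f.gate.trans (f.gate.symm gb) hac)
  have hbc : b ≠ c := fun h => by
    have := hmin a (Equiv.Perm.SameCycle.refl _ _)
    rw [h] at this
    omega
  have vpc : G.SameVertex p c := vp.trans (vb.symm.trans hac.1)
  have s1 := pow_steps vp
  have s2 := pow_steps vpc
  have hccw : G.Ccw p b c := by
    have l1 : G.steps p b ≤ 1 := steps_le (by simpa using hnp)
    refine ⟨Nat.pos_of_ne_zero fun h => hpb (by simpa [h] using s1), lt_of_le_of_lt l1 ?_⟩
    by_contra hlt
    rcases Nat.le_one_iff_eq_zero_or_eq_one.1 (not_lt.1 hlt) with h | h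
    · exact hpc (by simpa [h] using s2)
    · rw [h, pow_one, hnp] at s2
      exact hbc s2
  have k := (O.ccw_iff vp vpc).1 hccw
  have m1 := hmin p (vb.trans vp.symm)
  refine hall (f.gate.trans (f.gate.symm gb) (fin p (vb.trans vp.symm) ?_))
  simp only [Cyc] at k ⊢
  omega

end GraphMap

namespace GraphMap

open RibbonGraph List

variable {G : RibbonGraph} {f : GraphMap G}

/-! ## The action on the measures of the train track -/

/-- The weight of the real branch under a dart. -/
def realWeight (η : f.trainTrack.Branch → ℝ) (d : G.Dart) : ℝ := η (Sum.inl (G.edge d))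

theorem realWeight_rev (η : f.trainTrack.Branch → ℝ) (d : G.Dart) :
    realWeight η (G.rev d) = realWeight η d := by
  rw [realWeight, edge_rev, realWeight]

/-- The map of gates induced by `f`. -/
def switchMap (f : GraphMap G) : f.trainTrack.Switch → f.trainTrack.Switch :=
  Quotient.map f.init fun _ _ h => (gate_init_iff h.1).2 h

theorem switchMap_switch (d : G.Dart) :
    f.switchMap (f.trainTrack.switch d) = f.trainTrack.switch (f.init d) := rfl

theorem switch_eq_iff {d d' : G.Dart} :
    f.trainTrack.switch d = f.trainTrack.switch d' ↔ f.gate d d' :=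
  ⟨fun h => Quotient.exact h, fun h => Quotient.sound (s := f.trainTrack.gate) h⟩

theorem switch_out (g : f.trainTrack.Switch) : f.trainTrack.switch (Quotient.out g) = g :=
  Quotient.out_eq g

theorem infWeight_symm (η : f.trainTrack.Branch → ℝ) (g h : f.trainTrack.Switch) :
    f.trainTrack.infWeight η g h = f.trainTrack.infWeight η h g := by
  classical
  have key : ∀ p q : Sym2 f.trainTrack.Switch, p = q →
      (if hp : f.trainTrack.IsInfinitesimal p then η (Sum.inr ⟨p, hp⟩) else 0) =
        if hp : f.trainTrack.IsInfinitesimal q then η (Sum.inr ⟨q, hp⟩) else 0 := by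
    rintro p _ rfl
    rfl
  exact key _ _ Sym2.eq_swap

theorem joined_of_infWeight_ne_zero {η : f.trainTrack.Branch → ℝ} {g h : f.trainTrack.Switch}
    (hne : f.trainTrack.infWeight η g h ≠ 0) : f.Joined (Quotient.out g) (Quotient.out h) := by
  have hi : f.trainTrack.IsInfinitesimal s(g, h) := by
    by_contra hi
    exact hne (by rw [TrainTrack.infWeight, dif_neg hi])
  obtain ⟨d, d', hj, he⟩ := hi
  have key : ∀ {a b}, g = f.trainTrack.switch a → h = f.trainTrack.switch b → f.Joined a b →
      f.Joined (Quotient.out g) (Quotient.out h) := by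
    intro a b ha hb hab
    have e1 : f.gate a (Quotient.out g) := switch_eq_iff.1 (by rw [switch_out, ha])
    have e2 : f.gate b (Quotient.out h) := switch_eq_iff.1 (by rw [switch_out, hb])
    have j1 := f.trainTrack.joined_congr _ _ _ e1 hab
    exact f.trainTrack.joined_symm _ _ (f.trainTrack.joined_congr _ _ _ e2
      (f.trainTrack.joined_symm _ _ j1))
  rcases Sym2.eq_iff.1 he with ⟨h1, h2⟩ | ⟨h1, h2⟩
  · exact key h1 h2 hj
  · exact key h1 h2 (f.trainTrack.joined_symm _ _ hj)

/-- The bands of the image of the ribbon neighbourhood in the vertex discs, and the pairs of gates,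
which give the images of the infinitesimal edges. -/
abbrev Chord (f : GraphMap G) : Type :=
  {x : f.Strand // 0 < (x.2 : ℕ)} ⊕ (f.trainTrack.Switch × f.trainTrack.Switch)

namespace Chord

/-- A strand at the initial end of a chord. -/
def base : f.Chord → f.Strand
  | Sum.inl x => x
  | Sum.inr p => f.firstStrand (Quotient.out p.1)

/-- The gate at the initial end of a chord. -/
def start (k : f.Chord) : f.trainTrack.Switch := f.trainTrack.switch (base k).over

/-- The chord run backwards. -/
def inv : f.Chord ≃ f.Chord :=
  Equiv.sumCongr
    ⟨fun x => ⟨partner x.1, partner_pos x.2⟩, fun x => ⟨partner x.1, partner_pos x.2⟩,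
      fun x => Subtype.ext (partner_partner x.2), fun x => Subtype.ext (partner_partner x.2)⟩
    (Equiv.prodComm _ _)

theorem inv_inv (k : f.Chord) : inv (inv k) = k := by
  rcases k with x | ⟨g, h⟩
  · exact congrArg Sum.inl (Subtype.ext (partner_partner x.2))
  · rfl

theorem start_inr (p : f.trainTrack.Switch × f.trainTrack.Switch) :
    start (Sum.inr p : f.Chord) = f.switchMap p.1 := by
  rw [start, base, over_firstStrand, ← switchMap_switch, switch_out]

/-- The weight of a chord. -/
def weight (η : f.trainTrack.Branch → ℝ) : f.Chord → ℝ
  | Sum.inl x => realWeight η x.1.1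
  | Sum.inr p => f.trainTrack.infWeight η p.1 p.2

theorem weight_inv (η : f.trainTrack.Branch → ℝ) (k : f.Chord) : weight η (inv k) = weight η k := by
  rcases k with x | ⟨g, h⟩
  · exact realWeight_rev η _
  · exact infWeight_symm η h g

theorem weight_add (η ζ : f.trainTrack.Branch → ℝ) (k : f.Chord) :
    weight (η + ζ) k = weight η k + weight ζ k := by
  rcases k with x | ⟨g, h⟩
  · rfl
  · exact f.trainTrack.infWeight_add η ζ g h

theorem weight_smul (c : ℝ) (η : f.trainTrack.Branch → ℝ) (k : f.Chord) :
    weight (c • η) k = c * weight η k := by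
  rcases k with x | ⟨g, h⟩
  · rfl
  · exact f.trainTrack.infWeight_smul c η g h

/-- Bands follow turns of image paths, and images of infinitesimal edges are again infinitesimal.
The weight has to be nonzero because `Chord` contains all pairs of gates, joined or not. -/
theorem joined_start (hf : f.IsTrainTrackMap) {η : f.trainTrack.Branch → ℝ} {k : f.Chord}
    (hk : weight η k ≠ 0) : f.Joined (base k).over (base (inv k)).over := by
  rcases k with x | ⟨g, h⟩
  · exact hf.joined_partner x.2
  · change f.Joined (f.firstStrand _).over (f.firstStrand _).over
    rw [over_firstStrand, over_firstStrand]
    exact (joined_of_infWeight_ne_zero hk).init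

end Chord

open Classical in
/-- The total weight of the chords from the gate `g` to the gate `h`. -/
def chordWeight (η : f.trainTrack.Branch → ℝ) (g h : f.trainTrack.Switch) : ℝ :=
  ∑ k : f.Chord, if k.start = g ∧ (Chord.inv k).start = h then k.weight η else 0

theorem chordWeight_symm (η : f.trainTrack.Branch → ℝ) (g h : f.trainTrack.Switch) :
    chordWeight η g h = chordWeight η h g := by
  classical
  refine Fintype.sum_equiv Chord.inv _ _ fun k => ?_
  rw [Chord.inv_inv, Chord.weight_inv]
  exact if_congr and_comm rfl rfl

/-- The map `f_*` on branch weights. -/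
def pushMeasure (f : GraphMap G) :
    (f.trainTrack.Branch → ℝ) →ₗ[ℝ] (f.trainTrack.Branch → ℝ) where
  toFun η := Sum.elim (f.push (f.trainTrack.collapse η))
    fun p => Sym2.lift ⟨chordWeight η, chordWeight_symm η⟩ p.1
  map_add' η ζ := by
    funext b
    rcases b with e | ⟨p, hp⟩
    · simp only [map_add]
      rfl
    · induction p using Sym2.ind with
      | _ g h =>
        change chordWeight (η + ζ) g h = chordWeight η g h + chordWeight ζ g h
        simp only [chordWeight, Chord.weight_add, ← Finset.sum_add_distrib]
        refine Finset.sum_congr rfl fun k _ => ?_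
        split_ifs <;> simp
  map_smul' c η := by
    funext b
    rcases b with e | ⟨p, hp⟩
    · simp only [map_smul]
      rfl
    · induction p using Sym2.ind with
      | _ g h =>
        change chordWeight (c • η) g h = c * chordWeight η g h
        simp only [chordWeight, Chord.weight_smul, Finset.mul_sum]
        refine Finset.sum_congr rfl fun k _ => ?_
        split_ifs <;> simp

/-- Weights are stored only on existing infinitesimal edges; nothing is lost because every chord of
nonzero weight runs along one. -/
theorem infWeight_pushMeasure (hf : f.IsTrainTrackMap) (η : f.trainTrack.Branch → ℝ)
    (g h : f.trainTrack.Switch) :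
    f.trainTrack.infWeight (f.pushMeasure η) g h = chordWeight η g h := by
  rw [TrainTrack.infWeight]
  split_ifs with hi
  · rfl
  · symm
    refine Finset.sum_eq_zero fun k _ => ?_
    split_ifs with hk
    · by_contra hw
      exact hi ⟨_, _, Chord.joined_start hf hw, by rw [← hk.1, ← hk.2]; rfl⟩
    · rfl

theorem count_eq_sum_get (l : List G.Dart) (d : G.Dart) :
    (l.count d : ℝ) = ∑ i : Fin l.length, if l.get i = d then (1 : ℝ) else 0 := by
  induction l with
  | nil => simp
  | cons a l ih =>
    rw [List.count_cons, Nat.cast_add, ih]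
    have h : (∑ i : Fin (a :: l).length, if (a :: l).get i = d then (1 : ℝ) else 0) =
        (if a = d then 1 else 0) + ∑ i : Fin l.length, if l.get i = d then 1 else 0 :=
      Fin.sum_univ_succ _
    rw [h, add_comm]
    by_cases h' : a = d <;> simp [h']

theorem sum_realWeight_pushMeasure (η : f.trainTrack.Branch → ℝ) (φ : G.Dart → ℝ) :
    ∑ d, φ d * realWeight (f.pushMeasure η) d =
      ∑ x : f.Strand, φ x.over * realWeight η x.1 := by
  have h : ∀ d, realWeight (f.pushMeasure η) d =
      ∑ a, ∑ i : Fin (f.path a).length, if (f.path a).get i = d then realWeight η a else 0 := by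
    intro d
    refine (f.push_apply _ d).trans (Finset.sum_congr rfl fun a _ => ?_)
    rw [count_eq_sum_get, Finset.sum_mul]
    refine Finset.sum_congr rfl fun i _ => ?_
    split_ifs
    · rw [one_mul]; rfl
    · rw [zero_mul]
  rw [Fintype.sum_sigma]
  simp only [h, Finset.mul_sum]
  rw [Finset.sum_comm]
  refine Finset.sum_congr rfl fun a _ => ?_
  rw [Finset.sum_comm]
  refine Finset.sum_congr rfl fun i _ => ?_
  simp only [mul_ite, mul_zero, Finset.sum_ite_eq, Finset.mem_univ, if_true]
  rfl

theorem sum_strand (φ : f.Strand → ℝ) :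
    ∑ x, φ x = ∑ d, φ (f.firstStrand d) + ∑ x : {x : f.Strand // 0 < (x.2 : ℕ)}, φ x := by
  rw [← Finset.sum_filter_add_sum_filter_not Finset.univ fun x : f.Strand => (x.2 : ℕ) = 0]
  congr 1
  · symm
    refine Finset.sum_bij (fun d _ => f.firstStrand d) ?_ ?_ ?_ ?_
    · intro d _
      exact Finset.mem_filter.2 ⟨Finset.mem_univ _, rfl⟩
    · intro a _ b _ h
      exact congrArg Sigma.fst h
    · intro x hx
      exact ⟨x.1, Finset.mem_univ _, (eq_firstStrand (Finset.mem_filter.1 hx).2).symm⟩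
    · intros; rfl
  · refine Finset.sum_subtype _ (fun x => ?_) φ
    simp [Nat.pos_iff_ne_zero]

open Classical in
theorem sum_switch {η : f.trainTrack.Branch → ℝ} (hη : η ∈ f.trainTrack.measures)
    (φ : f.trainTrack.Switch → ℝ) :
    ∑ d, φ (f.trainTrack.switch d) * realWeight η d =
      ∑ p : f.trainTrack.Switch × f.trainTrack.Switch,
        φ p.1 * f.trainTrack.infWeight η p.1 p.2 := by
  rw [Fintype.sum_prod_type]
  simp only [← Finset.mul_sum]
  have h : ∀ g, (∑ d : G.Dart, if f.trainTrack.switch d = g then realWeight η d else 0) =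
      ∑ h, f.trainTrack.infWeight η g h := hη
  simp only [← h, Finset.mul_sum]
  rw [Finset.sum_comm]
  refine Finset.sum_congr rfl fun d _ => ?_
  simp

/-- Later strands are chords already. For first strands the switch condition trades the real weight
at a gate for infinitesimal weight, provided `φ` is constant on the gate wherever the weight does
not vanish. -/
theorem sum_strand_eq_sum_chord {η : f.trainTrack.Branch → ℝ} (hη : η ∈ f.trainTrack.measures)
    (φ : f.Strand → ℝ) (h : ∀ d, φ (f.firstStrand d) * realWeight η d =
      φ (f.firstStrand (Quotient.out (f.trainTrack.switch d))) * realWeight η d) :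
    ∑ x, φ x * realWeight η x.1 = ∑ k : f.Chord, φ k.base * k.weight η := by
  rw [sum_strand, Fintype.sum_sum_type, add_comm]
  congr 1
  refine (Finset.sum_congr rfl fun d _ => h d).trans ?_
  exact sum_switch hη fun g => φ (f.firstStrand (Quotient.out g))

/-- Both sides of the switch condition at `g` are the total weight of the chords that start at `g`.
-/
theorem pushMeasure_mem (hf : f.IsTrainTrackMap) {η : f.trainTrack.Branch → ℝ}
    (hη : η ∈ f.trainTrack.measures) : f.pushMeasure η ∈ f.trainTrack.measures := by
  classical
  intro g
  simp only [infWeight_pushMeasure hf, chordWeight]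
  rw [Finset.sum_comm]
  have h1 := sum_realWeight_pushMeasure η fun d => if f.trainTrack.switch d = g then 1 else 0
  have h2 := sum_strand_eq_sum_chord hη
    (fun x => if f.trainTrack.switch x.over = g then 1 else 0) (fun d => by
      rw [over_firstStrand, over_firstStrand, ← switchMap_switch, ← switchMap_switch, switch_out])
  simp only [ite_mul, one_mul, zero_mul] at h1 h2
  refine h1.trans (h2.trans (Finset.sum_congr rfl fun k _ => ?_))
  change (if k.start = g then _ else _) = _
  by_cases hk : k.start = g <;> simp [hk]

end GraphMap

/-! ## Signs of pairs and orientations of triples in a linear order -/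

/-- The sign of the pair `a, b`, which is `1` if `a < b`. -/
def pairSign {α : Type*} [LinearOrder α] (a b : α) : ℝ :=
  if a < b then 1 else if b < a then -1 else 0

/-- The orientation of the triple `a, b, c` in the cyclic order. -/
def orient {α : Type*} [LinearOrder α] (a b c : α) : ℝ :=
  pairSign a b + pairSign b c + pairSign c a

section

variable {α β : Type*} [LinearOrder α] [LinearOrder β] {a b c : α}

theorem pairSign_of_lt (h : a < b) : pairSign a b = 1 := by simp [pairSign, h]

theorem pairSign_of_gt (h : b < a) : pairSign a b = -1 := by simp [pairSign, h, h.not_gt]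

theorem pairSign_self (a : α) : pairSign a a = 0 := by simp [pairSign]

theorem pairSign_swap (a b : α) : pairSign a b = - pairSign b a := by
  rcases lt_trichotomy a b with h | rfl | h
  · rw [pairSign_of_lt h, pairSign_of_gt h, neg_neg]
  · rw [pairSign_self, neg_zero]
  · rw [pairSign_of_lt h, pairSign_of_gt h]

theorem pairSign_congr {a' b' : β} (h : a < b ↔ a' < b') (h' : b < a ↔ b' < a') :
    pairSign a b = pairSign a' b' := by
  unfold pairSign
  simp only [h, h']

theorem Cyc.orient_eq (h : Cyc a b c) : orient a b c = 1 := by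
  rcases h with ⟨h1, h2⟩ | ⟨h1, h2⟩ | ⟨h1, h2⟩
  · rw [orient, pairSign_of_lt h1, pairSign_of_lt h2, pairSign_of_gt (h1.trans h2)]; norm_num
  · rw [orient, pairSign_of_lt h1, pairSign_of_lt h2, pairSign_of_gt (h1.trans h2)]; norm_num
  · rw [orient, pairSign_of_lt h1, pairSign_of_lt h2, pairSign_of_gt (h1.trans h2)]; norm_num

theorem orient_swap (a b c : α) : orient a b c = - orient a c b := by
  rw [orient, orient, pairSign_swap a b, pairSign_swap b c, pairSign_swap c a]
  ring

theorem orient_self_right (a b : α) : orient a b b = 0 := by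
  rw [orient, pairSign_self, pairSign_swap a b]
  ring

theorem orient_self_left (a b : α) : orient a a b = 0 := by
  rw [orient, pairSign_self, pairSign_swap a b]
  ring

theorem orient_self_outer (a b : α) : orient a b a = 0 := by
  rw [orient, pairSign_self, pairSign_swap a b]
  ring

open Classical in
theorem orient_eq_ite (a b c : α) :
    orient a b c = (if Cyc a b c then 1 else 0) - if Cyc a c b then 1 else 0 := by
  by_cases h1 : a = b
  · subst h1
    rw [if_neg fun h => h.ne_left rfl, if_neg fun h => h.rotate.rotate.ne_left rfl,
      orient_self_left, sub_zero]
  by_cases h2 : b = c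
  · subst h2
    rw [if_neg fun h => h.rotate.ne_left rfl, orient_self_right, sub_zero]
  by_cases h3 : c = a
  · subst h3
    rw [if_neg fun h => h.rotate.rotate.ne_left rfl, if_neg fun h => h.ne_left rfl,
      orient_self_outer, sub_zero]
  rcases Cyc.total h1 h2 h3 with h | h
  · rw [h.orient_eq, if_pos h, if_neg fun h' => h.asymm h'.rotate, sub_zero]
  · have h' : Cyc a c b := h.rotate.rotate
    rw [orient_swap, h'.orient_eq, if_pos h', if_neg fun h'' => h''.asymm h, zero_sub]

/-- Two disjoint chords `a b` and `p q` leave the common gate `ga` of `a` and `p` for different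
gates `gb` and `gq`. Being disjoint, they must diverge in the order in which they start, so the sign
at the common gate is opposite to the orientation of the three gates. -/
theorem pairSign_add_orient_eq_zero {ka kb kp kq : α} {ga gb gq : β} (h1 : ga ≠ gb) (h2 : gb ≠ gq)
    (h3 : gq ≠ ga) (hne : ka ≠ kp) (m1 : ga < gb → ka < kb ∧ kp < kb)
    (m1' : gb < ga → kb < ka ∧ kb < kp) (m2 : gb < gq → kb < kq) (m2' : gq < gb → kq < kb)
    (m3 : gq < ga → kq < ka ∧ kq < kp) (m3' : ga < gq → ka < kq ∧ kp < kq)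
    (n1 : Cyc ka kp kb → Cyc kb kq ka → False) (n2 : Cyc ka kq kb → Cyc kb kp ka → False) :
    pairSign ka kp + orient ga gb gq = 0 := by
  rcases lt_or_gt_of_ne hne with h | h
  · have hc : Cyc ga gq gb := ((Cyc.total h1 h2 h3).resolve_left fun hc => by
      unfold Cyc at hc n1
      grind).rotate.rotate
    rw [pairSign_of_lt h, orient_swap, hc.orient_eq, add_neg_cancel]
  · have hc : Cyc ga gb gq := (Cyc.total h1 h2 h3).resolve_right fun hc => by
      unfold Cyc at hc n2
      grind
    rw [pairSign_of_gt h, hc.orient_eq, neg_add_cancel]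

/-- Disjoint chords between the same two gates are parallel, hence met in opposite orders at the two
ends. -/
theorem pairSign_add_pairSign_eq_zero {ka kb kp kq : α} {ga gb : β} (h1 : ga ≠ gb)
    (hne : ka ≠ kp) (hne' : kb ≠ kq)
    (m1 : ga < gb → ka < kb ∧ kp < kb ∧ ka < kq ∧ kp < kq)
    (m1' : gb < ga → kb < ka ∧ kb < kp ∧ kq < ka ∧ kq < kp)
    (n1 : Cyc ka kp kb → Cyc kb kq ka → False) (n2 : Cyc ka kq kb → Cyc kb kp ka → False) :
    pairSign ka kp + pairSign kb kq = 0 := by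
  rcases lt_or_gt_of_ne hne with h | h
  · have h' : kq < kb := lt_of_le_of_ne (not_lt.1 fun h' => by
      unfold Cyc at n1
      rcases lt_or_gt_of_ne h1 with h2 | h2 <;> grind) hne'.symm
    rw [pairSign_of_lt h, pairSign_of_gt h', add_neg_cancel]
  · have h' : kb < kq := lt_of_le_of_ne (not_lt.1 fun h' => by
      unfold Cyc at n2
      rcases lt_or_gt_of_ne h1 with h2 | h2 <;> grind) hne'
    rw [pairSign_of_gt h, pairSign_of_lt h', neg_add_cancel]

/-- The contribution of the initial ends of two chords to the skew-symmetric form. Here `k` is the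
position of an end and `g` that of its gate, and `g'` is the gate of the opposite end. -/
def endPairing (k : α) (g g' : β) (l : α) (h₁ h₂ : β) : ℝ :=
  if g = h₁ then pairSign k l + orient g g' h₂ else 0

/-- Chords that do not cross contribute zero. -/
theorem endPairing_sum_eq_zero {ka kb kp kq : α} {ga gb gp gq : β} (hab : ga ≠ gb)
    (hpq : gp ≠ gq) (nap : ka ≠ kp) (naq : ka ≠ kq) (nbp : kb ≠ kp) (nbq : kb ≠ kq)
    (mab : ga < gb → ka < kb) (mba : gb < ga → kb < ka)
    (mpq : gp < gq → kp < kq) (mqp : gq < gp → kq < kp)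
    (map : ga < gp → ka < kp) (mpa : gp < ga → kp < ka)
    (maq : ga < gq → ka < kq) (mqa : gq < ga → kq < ka)
    (mbp : gb < gp → kb < kp) (mpb : gp < gb → kp < kb)
    (mbq : gb < gq → kb < kq) (mqb : gq < gb → kq < kb)
    (n1 : Cyc ka kp kb → Cyc kb kq ka → False) (n2 : Cyc ka kq kb → Cyc kb kp ka → False) :
    endPairing ka ga gb kp gp gq + endPairing kb gb ga kp gp gq +
      endPairing ka ga gb kq gq gp + endPairing kb gb ga kq gq gp = 0 := by
  have n1' : Cyc kb kp ka → Cyc ka kq kb → False := fun h h' => n2 h' h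
  have n2' : Cyc kb kq ka → Cyc ka kp kb → False := fun h h' => n1 h' h
  unfold endPairing
  -- Cases by the gates the chords share: two give parallel chords, one gives diverging chords, none
  -- gives no term at all.
  by_cases e1 : ga = gp
  · subst e1
    rw [if_pos rfl, if_neg hab.symm, if_neg hpq]
    by_cases e2 : gb = gq
    · subst e2
      rw [if_pos rfl, orient_self_right, orient_self_right, add_zero, add_zero, add_zero, add_zero]
      exact pairSign_add_pairSign_eq_zero hab nap nbq (by grind) (by grind) n1 n2
    · rw [if_neg e2, add_zero, add_zero, add_zero]
      exact pairSign_add_orient_eq_zero hab e2 hpq.symm nap (by grind) (by grind) (by grind)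
        (by grind) (by grind) (by grind) n1 n2
  · by_cases e2 : ga = gq
    · subst e2
      rw [if_neg e1, if_pos rfl, if_neg hab.symm]
      by_cases e3 : gb = gp
      · subst e3
        rw [if_pos rfl, orient_self_right, orient_self_right, zero_add, add_zero, add_zero,
          add_zero, add_comm]
        exact pairSign_add_pairSign_eq_zero hab naq nbp (by grind) (by grind) n2 n1
      · rw [if_neg e3, zero_add, zero_add, add_zero]
        exact pairSign_add_orient_eq_zero hab e3 hpq naq (by grind) (by grind) (by grind)
          (by grind) (by grind) (by grind) n2 n1
    · rw [if_neg e1, if_neg e2, zero_add, add_zero]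
      by_cases e3 : gb = gp
      · subst e3
        rw [if_pos rfl, if_neg hpq, add_zero]
        exact pairSign_add_orient_eq_zero hab.symm e2 (Ne.symm hpq) nbp (by grind) (by grind)
          (by grind) (by grind) (by grind) (by grind) n1' n2'
      · rw [if_neg e3, zero_add]
        by_cases e4 : gb = gq
        · subst e4
          rw [if_pos rfl]
          exact pairSign_add_orient_eq_zero hab.symm e1 hpq nbq (by grind) (by grind) (by grind)
            (by grind) (by grind) (by grind) n2' n1'
        · rw [if_neg e4]

end

namespace GraphMap

open RibbonGraph List

variable {G : RibbonGraph} {f : GraphMap G}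

/-! ## The skew-symmetric form in terms of an order of the darts -/

/-- An order of the darts for which the gates of `f` are intervals. -/
structure GateOrder (f : GraphMap G) extends DartOrder G where
  gate_of_between : ∀ {a b e}, f.gate a b → pos a < pos e → pos e < pos b → f.gate a e

namespace GateOrder

variable (O : f.GateOrder)

/-- The position of a gate. -/
def gatePos (g : f.trainTrack.Switch) : ℕ := O.pos (Quotient.out g)

theorem gatePos_injective : Function.Injective O.gatePos := fun g h e => by
  rw [← switch_out g, ← switch_out h, O.inj e]

/-- Gates are intervals, so a dart outside a gate lies on the same side of all its members. -/
theorem pos_lt_iff_of_gate {d d' e : G.Dart} (h : f.gate d d') (he : ¬ f.gate d e) :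
    (O.pos d < O.pos e ↔ O.pos d' < O.pos e) ∧ (O.pos e < O.pos d ↔ O.pos e < O.pos d') := by
  have h1 : O.pos d ≠ O.pos e := fun h' => he (O.inj h' ▸ f.gate.refl _)
  have h2 : O.pos d' ≠ O.pos e := fun h' => he (O.inj h' ▸ h)
  have h3 : ¬ (O.pos d < O.pos e ∧ O.pos e < O.pos d') := fun h' =>
    he (O.gate_of_between h h'.1 h'.2)
  have h4 : ¬ (O.pos d' < O.pos e ∧ O.pos e < O.pos d) := fun h' =>
    he (f.gate.trans h (O.gate_of_between (f.gate.symm h) h'.1 h'.2))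
  omega

theorem gatePos_lt_iff {d e : G.Dart} (h : ¬ f.gate d e) :
    O.gatePos (f.trainTrack.switch d) < O.gatePos (f.trainTrack.switch e) ↔ O.pos d < O.pos e := by
  have hd : f.gate d (Quotient.out (f.trainTrack.switch d)) :=
    switch_eq_iff.1 (switch_out _).symm
  have he : f.gate e (Quotient.out (f.trainTrack.switch e)) :=
    switch_eq_iff.1 (switch_out _).symm
  rw [gatePos, gatePos, (O.pos_lt_iff_of_gate hd h).1]
  exact ((O.pos_lt_iff_of_gate he fun h' =>
    h (f.gate.trans hd (f.gate.symm h'))).2).symm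

theorem cyc_gatePos_iff {a b c : G.Dart} (h1 : ¬ f.gate a b) (h2 : ¬ f.gate b c)
    (h3 : ¬ f.gate c a) :
    Cyc (O.gatePos (f.trainTrack.switch a)) (O.gatePos (f.trainTrack.switch b))
      (O.gatePos (f.trainTrack.switch c)) ↔ Cyc (O.pos a) (O.pos b) (O.pos c) := by
  rw [Cyc, O.gatePos_lt_iff h1, O.gatePos_lt_iff h2, O.gatePos_lt_iff h3, Cyc]

theorem switchCcw_iff {g h k : f.trainTrack.Switch}
    (h1 : G.SameVertex (Quotient.out g) (Quotient.out h))
    (h2 : G.SameVertex (Quotient.out g) (Quotient.out k)) :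
    f.trainTrack.SwitchCcw g h k ↔ Cyc (O.gatePos g) (O.gatePos h) (O.gatePos k) := by
  constructor
  · rintro ⟨n1, n2, n3, a, b, c, rfl, rfl, rfl, hc⟩
    refine (O.cyc_gatePos_iff (fun h => n1 (switch_eq_iff.2 h)) (fun h => n2 (switch_eq_iff.2 h))
      fun h => n3 (switch_eq_iff.2 h)).2 ?_
    exact (O.ccw_iff hc.sameVertex.1 hc.sameVertex.2).1 hc
  · intro hc
    refine ⟨fun h => hc.ne_left (h ▸ rfl), fun h => hc.rotate.ne_left (h ▸ rfl),
      fun h => hc.rotate.rotate.ne_left (h ▸ rfl), _, _, _, switch_out g, switch_out h,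
      switch_out k, ?_⟩
    exact (O.ccw_iff h1 h2).2 hc

/-- A walk inside a gate could disagree with the linear order only by going all the way round the
vertex. A vertex with two darts has a second gate, which interrupts such a walk. -/
theorem before_iff (hf : f.IsTrainTrackMap) {d d' : G.Dart} :
    f.trainTrack.Before d d' ↔
      f.trainTrack.switch d = f.trainTrack.switch d' ∧ O.pos d < O.pos d' := by
  rw [switch_eq_iff]
  constructor
  · rintro ⟨hne, hv, hall⟩
    have hg : f.gate d d' := by
      have := hall _ le_rfl
      rwa [pow_steps hv] at this
    refine ⟨hg, lt_of_le_of_ne (not_lt.1 fun hlt => ?_) (O.inj.ne hne)⟩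
    obtain ⟨e, ve, he⟩ := hf.exists_not_gate hv hne
    have hc : G.Ccw d e d' := by
      rw [O.ccw_iff ve hv]
      have h := O.pos_lt_iff_of_gate hg he
      have h1 : O.pos d ≠ O.pos e := fun h' => he (O.inj h' ▸ f.gate.refl _)
      simp only [Cyc]
      omega
    refine he ?_
    have := hall _ hc.2.le
    rwa [pow_steps ve] at this
  · rintro ⟨hg, hlt⟩
    have hne : d ≠ d' := fun h => hlt.ne (congrArg _ h)
    refine ⟨hne, hg.1, fun i hi => ?_⟩
    change f.gate d _
    set x := (G.next ^ i) d with hx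
    have vx : G.SameVertex d x := SameVertex.pow_right d i
    rcases eq_or_ne d x with h | h
    · rw [← h]
    rcases eq_or_ne x d' with h' | h'
    · rwa [h']
    have hs : G.steps d x ≤ i := steps_le hx.symm
    have hc : G.Ccw d x d' := by
      refine ⟨Nat.pos_of_ne_zero fun h0 => h ?_, lt_of_le_of_ne (hs.trans hi) fun h0 => h' ?_⟩
      · have := pow_steps vx
        rwa [h0, pow_zero] at this
      · rw [← pow_steps vx, h0, pow_steps hg.1]
    have := (O.ccw_iff vx hg.1).1 hc
    refine O.gate_of_between hg ?_ ?_ <;> simp only [Cyc] at this <;> omega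

open Classical in
-- Unfolding each determinant and exchanging the two indices in its second term turns the sums over
-- ordered pairs into sums over all pairs, weighted by signs. The result is linear in products of
-- weights and can be expanded over strands and chords.
theorem two_mul_form (hf : f.IsTrainTrackMap) (η ζ : f.trainTrack.Branch → ℝ) :
    2 * f.trainTrack.form η ζ =
      (∑ d, ∑ d', if f.trainTrack.switch d = f.trainTrack.switch d' then
        pairSign (O.pos d) (O.pos d') * (realWeight η d * realWeight ζ d') else 0) +
      ∑ g, ∑ h, ∑ k, orient (O.gatePos g) (O.gatePos h) (O.gatePos k) *
        (f.trainTrack.infWeight η g h * f.trainTrack.infWeight ζ g k) := by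
  have antisymm : ∀ {ι : Type} [Fintype ι] (P : ι → ι → Prop) (A : ι → ι → ℝ),
      (∑ i, ∑ j, if P i j then A i j - A j i else 0) =
        ∑ i, ∑ j, ((if P i j then 1 else 0) - if P j i then 1 else 0) * A i j := by
    intro ι _ P A
    have h1 : ∀ i j, (if P i j then A i j - A j i else 0) =
        (if P i j then 1 else 0) * A i j - (if P i j then 1 else 0) * A j i := fun i j => by
      split_ifs <;> ring
    simp only [h1, sub_mul, Finset.sum_sub_distrib]
    congr 1
    exact Finset.sum_comm
  rw [TrainTrack.form, ← mul_assoc, mul_one_div_cancel two_ne_zero, one_mul,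
    Finset.sum_add_distrib]
  congr 1
  · have h1 : ∀ g d, (∑ d', if f.trainTrack.switch d = g ∧ f.trainTrack.Before d d' then
        η (Sum.inl (G.edge d)) * ζ (Sum.inl (G.edge d')) -
            η (Sum.inl (G.edge d')) * ζ (Sum.inl (G.edge d)) else 0) =
        if f.trainTrack.switch d = g then ∑ d', if f.trainTrack.Before d d' then
          realWeight η d * realWeight ζ d' - realWeight η d' * realWeight ζ d else 0 else 0 := by
      intro g d
      by_cases hd : f.trainTrack.switch d = g
      · simp only [hd, true_and, if_true]
        rfl
      · simp [hd]
    simp only [h1]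
    rw [Finset.sum_comm]
    simp only [Finset.sum_ite_eq, Finset.mem_univ, if_true]
    rw [antisymm f.trainTrack.Before fun d d' => realWeight η d * realWeight ζ d']
    refine Finset.sum_congr rfl fun d _ => Finset.sum_congr rfl fun d' _ => ?_
    simp only [O.before_iff hf, eq_comm (a := f.trainTrack.switch d')]
    by_cases hd : f.trainTrack.switch d = f.trainTrack.switch d'
    · simp only [hd, true_and, if_true]
      congr 1
      rcases lt_trichotomy (O.pos d) (O.pos d') with h | h | h
      · simp [h, h.not_gt, pairSign]
      · simp [h, pairSign]
      · simp [h, h.not_gt, pairSign]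
    · simp [hd]
  · refine Finset.sum_congr rfl fun g _ => ?_
    refine (antisymm (f.trainTrack.SwitchCcw g) fun h k =>
      f.trainTrack.infWeight η g h * f.trainTrack.infWeight ζ g k).trans ?_
    refine Finset.sum_congr rfl fun h _ => Finset.sum_congr rfl fun k _ => ?_
    by_cases h1 : f.trainTrack.infWeight η g h = 0
    · rw [h1, zero_mul, mul_zero, mul_zero]
    by_cases h2 : f.trainTrack.infWeight ζ g k = 0
    · rw [h2, mul_zero, mul_zero, mul_zero]
    have v1 := f.trainTrack.joined_vertex _ _ (joined_of_infWeight_ne_zero h1)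
    have v2 := f.trainTrack.joined_vertex _ _ (joined_of_infWeight_ne_zero h2)
    rw [orient_eq_ite]
    simp only [O.switchCcw_iff v1 v2, O.switchCcw_iff v2 v1]

end GateOrder

end GraphMap

namespace GraphMap

open RibbonGraph List

variable {G : RibbonGraph} {f : GraphMap G}

/-! ## Invariance of the skew-symmetric form -/

theorem samePiece_firstStrand {d d' : G.Dart} (h : G.SameVertex d d') :
    f.SamePiece (f.firstStrand d) (f.firstStrand d') :=
  samePiece_iff.2 (Or.inr (Or.inl ⟨rfl, rfl, h⟩))

theorem Chord.samePiece_inv (k : f.Chord) {η : f.trainTrack.Branch → ℝ} (hk : k.weight η ≠ 0) :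
    f.SamePiece k.base (Chord.inv k).base := by
  rcases k with x | ⟨g, h⟩
  · exact samePiece_iff.2 (Or.inr (Or.inr ⟨x.2, rfl⟩))
  · exact samePiece_firstStrand
      (f.trainTrack.joined_vertex _ _ (joined_of_infWeight_ne_zero hk))

/-- For a band the other end works. If all ends of the image of a vertex disc were in one gate, the
vertex would have a single gate, hence a single dart and no infinitesimal edge, and the switch
condition would force the weight to vanish. -/
theorem good_strand (hf : f.IsTrainTrackMap) {η : f.trainTrack.Branch → ℝ}
    (hη : η ∈ f.trainTrack.measures) {y : f.Strand} (hy : realWeight η y.1 ≠ 0) :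
    ∃ z, f.SamePiece y z ∧ ¬ f.gate y.over z.over := by
  classical
  rcases Nat.eq_zero_or_pos y.2 with h0 | h0
  · by_contra! hall
    have hgate : ∀ e, G.SameVertex y.1 e → f.gate y.1 e := by
      intro e he
      have := hall (f.firstStrand e) (samePiece_iff.2 (Or.inr (Or.inl ⟨h0, rfl, he⟩)))
      rw [eq_firstStrand h0, over_firstStrand, over_firstStrand] at this
      exact (gate_init_iff he).1 this
    have huniq : ∀ e, G.SameVertex y.1 e → y.1 = e := by
      intro e he
      by_contra hne
      obtain ⟨e', he', hg⟩ := hf.exists_not_gate he hne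
      exact hg (hgate e' he')
    have hm : (∑ d : G.Dart, if f.trainTrack.switch d = f.trainTrack.switch y.1 then
        realWeight η d else 0) = ∑ h, f.trainTrack.infWeight η (f.trainTrack.switch y.1) h :=
      hη (f.trainTrack.switch y.1)
    have hl : (∑ d : G.Dart, if f.trainTrack.switch d = f.trainTrack.switch y.1 then
        realWeight η d else 0) = realWeight η y.1 := by
      rw [Finset.sum_eq_single y.1, if_pos rfl]
      · intro d _ hd
        exact if_neg fun h => hd (huniq d (switch_eq_iff.1 h).1.symm).symm
      · intro h
        exact absurd (Finset.mem_univ _) h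
    rw [hl] at hm
    rw [hm] at hy
    obtain ⟨h, -, hh⟩ := Finset.exists_ne_zero_of_sum_ne_zero hy
    have hj := joined_of_infWeight_ne_zero hh
    have e1 : G.SameVertex y.1 (Quotient.out (f.trainTrack.switch y.1)) :=
      (switch_eq_iff.1 (switch_out _).symm).1
    have e2 := e1.trans (f.trainTrack.joined_vertex _ _ hj)
    refine hj.1 ?_
    rw [← huniq _ e1, ← huniq _ e2]
  · exact ⟨partner y, samePiece_iff.2 (Or.inr (Or.inr ⟨h0, rfl⟩)), hf.not_gate_partner h0⟩

namespace GateOrder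

variable (O : f.GateOrder) (ht : f.Strand → ℝ)

/-- The position of the initial end of a strand. -/
abbrev strandPos (x : f.Strand) : ℕ ×ₗ ℝ := key O.toDartOrder ht x

/-- The position of the gate of the initial end of a strand. -/
abbrev strandGate (x : f.Strand) : ℕ := O.gatePos (f.trainTrack.switch x.over)

variable {O ht}

theorem strandGate_eq_iff {x y : f.Strand} :
    O.strandGate x = O.strandGate y ↔ f.gate x.over y.over :=
  O.gatePos_injective.eq_iff.trans switch_eq_iff

theorem strandPos_lt {x y : f.Strand} (h : O.strandGate x < O.strandGate y) :
    O.strandPos ht x < O.strandPos ht y := by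
  have hg : ¬ f.gate x.over y.over := fun h' => h.ne (strandGate_eq_iff.2 h')
  exact Prod.Lex.toLex_lt_toLex.2 (Or.inl ((O.gatePos_lt_iff hg).1 h))

variable (O ht)

open Classical in
/-- The sign of a pair of strands whose initial ends are in the same gate. -/
def strandSign (x y : f.Strand) : ℝ :=
  if O.strandGate x = O.strandGate y then pairSign (O.strandPos ht x) (O.strandPos ht y) else 0

open Classical in
/-- The sign of a pair of strands whose initial ends are in the same gate but not in the same
piece. -/
def pieceSign (x y : f.Strand) : ℝ := if f.SamePiece x y then 0 else O.strandSign ht x y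

variable {O ht}

theorem strandSign_swap (x y : f.Strand) : O.strandSign ht x y = - O.strandSign ht y x := by
  unfold strandSign
  rw [pairSign_swap]
  by_cases h : O.strandGate x = O.strandGate y
  · rw [if_pos h, if_pos h.symm]
  · rw [if_neg h, if_neg (Ne.symm h), neg_zero]

theorem pieceSign_swap (x y : f.Strand) : O.pieceSign ht x y = - O.pieceSign ht y x := by
  unfold pieceSign
  by_cases h : f.SamePiece x y
  · rw [if_pos h, if_pos h.symm, neg_zero]
  · rw [if_neg h, if_neg fun h' => h h'.symm, strandSign_swap]

theorem strandGate_firstStrand_eq {d d' : G.Dart} (h : f.gate d d') :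
    O.strandGate (f.firstStrand d) = O.strandGate (f.firstStrand d') := by
  rw [strandGate_eq_iff, over_firstStrand, over_firstStrand]
  exact (gate_init_iff h.1).2 h

/-- If `y` lay between the two first strands, its piece would have to cross theirs in order to reach
the end `z` in another gate. -/
theorem pieceSign_congr (he : IsEmbeddingHeight f ht) {d d' : G.Dart} (hd : f.gate d d')
    {y z : f.Strand} (hyz : f.SamePiece y z) (hg : ¬ f.gate y.over z.over) :
    O.pieceSign ht (f.firstStrand d) y = O.pieceSign ht (f.firstStrand d') y := by
  have hdd := samePiece_firstStrand (f := f) hd.1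
  unfold pieceSign
  by_cases hp : f.SamePiece (f.firstStrand d) y
  · rw [if_pos hp, if_pos (hdd.symm.trans hp)]
  have hp' : ¬ f.SamePiece (f.firstStrand d') y := fun h => hp (hdd.trans h)
  rw [if_neg hp, if_neg hp']
  unfold strandSign
  have hs := strandGate_firstStrand_eq (O := O) hd
  rw [← hs]
  by_cases hy : O.strandGate (f.firstStrand d) = O.strandGate y
  · rw [if_pos hy, if_pos hy]
    have inj := key_injective O.toDartOrder he
    have n1 : O.strandPos ht (f.firstStrand d) ≠ O.strandPos ht y :=
      inj.ne fun h => hp (h ▸ samePiece_iff.2 (Or.inl rfl))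
    have n2 : O.strandPos ht (f.firstStrand d') ≠ O.strandPos ht y :=
      inj.ne fun h => hp' (h ▸ samePiece_iff.2 (Or.inl rfl))
    have hv : G.SameVertex (f.firstStrand d).over y.over := (strandGate_eq_iff.1 hy).1
    have hv' : G.SameVertex (f.firstStrand d').over y.over :=
      (strandGate_eq_iff.1 (hs.symm.trans hy)).1
    have c1 := he.noncrossing O.toDartOrder _ _ _ _ hdd hyz hp hv
    have c2 := he.noncrossing O.toDartOrder _ _ _ _ hdd.symm hyz hp' hv'
    have hz : (O.strandPos ht z < O.strandPos ht (f.firstStrand d) ∧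
        O.strandPos ht z < O.strandPos ht (f.firstStrand d')) ∨
        (O.strandPos ht (f.firstStrand d) < O.strandPos ht z ∧
        O.strandPos ht (f.firstStrand d') < O.strandPos ht z) := by
      rcases lt_trichotomy (O.strandGate z) (O.strandGate y) with h | h | h
      · exact Or.inl ⟨strandPos_lt (hy ▸ h), strandPos_lt (hs ▸ hy ▸ h)⟩
      · exact absurd (strandGate_eq_iff.1 h.symm) hg
      · exact Or.inr ⟨strandPos_lt (hy ▸ h), strandPos_lt (hs ▸ hy ▸ h)⟩
    unfold Cyc at c1 c2
    apply pairSign_congr <;> grind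
  · rw [if_neg hy, if_neg hy]

open Classical in
theorem strandSign_eq (x y : f.Strand) : O.strandSign ht x y =
    (if f.trainTrack.switch x.over = f.trainTrack.switch y.over then
      pairSign (O.pos x.over) (O.pos y.over) else 0) +
    if x.over = y.over then pairSign (ht x) (ht y) else 0 := by
  unfold strandSign
  have hiff : O.strandGate x = O.strandGate y ↔
      f.trainTrack.switch x.over = f.trainTrack.switch y.over := O.gatePos_injective.eq_iff
  by_cases h : x.over = y.over
  · rw [if_pos (by rw [strandGate, h]), if_pos (by rw [h]), if_pos h, h, pairSign_self, zero_add]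
    apply pairSign_congr <;> simp [strandPos, key, Prod.Lex.toLex_lt_toLex, h]
  · rw [if_neg h, add_zero]
    have hp := O.inj.ne h
    simp only [hiff]
    congr 1
    apply pairSign_congr <;> simp [strandPos, key, Prod.Lex.toLex_lt_toLex, hp, hp.symm]

open Classical in
theorem sum_pairSign_pushMeasure (he : IsEmbeddingHeight f ht) (η ζ : f.trainTrack.Branch → ℝ) :
    (∑ d, ∑ d', if f.trainTrack.switch d = f.trainTrack.switch d' then
        pairSign (O.pos d) (O.pos d') *
          (realWeight (f.pushMeasure η) d * realWeight (f.pushMeasure ζ) d') else 0) =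
      ∑ x : f.Strand, ∑ y : f.Strand,
        O.strandSign ht x y * (realWeight η x.1 * realWeight ζ y.1) := by
  let ψ : G.Dart → G.Dart → ℝ := fun d d' =>
    if f.trainTrack.switch d = f.trainTrack.switch d' then pairSign (O.pos d) (O.pos d') else 0
  have h1 : ∀ d, (∑ d', if f.trainTrack.switch d = f.trainTrack.switch d' then
      pairSign (O.pos d) (O.pos d') *
        (realWeight (f.pushMeasure η) d * realWeight (f.pushMeasure ζ) d') else 0) =
      (∑ y : f.Strand, ψ d y.over * realWeight ζ y.1) * realWeight (f.pushMeasure η) d := by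
    intro d
    rw [← sum_realWeight_pushMeasure, Finset.sum_mul]
    refine Finset.sum_congr rfl fun d' _ => ?_
    simp only [ψ]
    split_ifs <;> ring
  simp only [h1]
  rw [sum_realWeight_pushMeasure]
  have h2 : ∀ x y : f.Strand, O.strandSign ht x y * (realWeight η x.1 * realWeight ζ y.1) =
      ψ x.over y.over * realWeight ζ y.1 * realWeight η x.1 +
      (if x.over = y.over then pairSign (ht x) (ht y) else 0) *
        (realWeight η x.1 * realWeight ζ y.1) := by
    intro x y
    rw [strandSign_eq]
    simp only [ψ]
    ring
  simp only [h2, Finset.sum_add_distrib, Finset.sum_mul]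
  -- Strands over one dart have a height sign that the form on real edges does not see. Running both
  -- backwards keeps the weights and negates the sign, so these terms cancel over the two
  -- directions.
  have h3 : (∑ x : f.Strand, ∑ y : f.Strand, (if x.over = y.over then pairSign (ht x) (ht y) else 0) *
        (realWeight η x.1 * realWeight ζ y.1)) =
      - ∑ x : f.Strand, ∑ y : f.Strand, (if x.over = y.over then pairSign (ht x) (ht y) else 0) *
        (realWeight η x.1 * realWeight ζ y.1) := by
    let e : f.Strand ≃ f.Strand :=
      ⟨revStrand, revStrand, revStrand_revStrand, revStrand_revStrand⟩
    simp only [← Finset.sum_neg_distrib]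
    refine Fintype.sum_equiv e _ _ fun x => Fintype.sum_equiv e _ _ fun y => ?_
    change _ = -((if (revStrand x).over = (revStrand y).over then
      pairSign (ht (revStrand x)) (ht (revStrand y)) else 0) *
        (realWeight η (G.rev x.1) * realWeight ζ (G.rev y.1)))
    rw [realWeight_rev, realWeight_rev, over_revStrand, over_revStrand, he.rev, he.rev]
    have : G.rev x.over = G.rev y.over ↔ x.over = y.over :=
      (Function.LeftInverse.injective G.rev_rev).eq_iff
    simp only [this]
    have hs : pairSign (-ht x) (-ht y) = - pairSign (ht x) (ht y) := by
      rw [pairSign_swap (ht x), neg_neg]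
      apply pairSign_congr <;> simp
    rw [hs]
    split_ifs <;> ring
  linarith

open Classical in
/-- The contribution of pairs of strands in different pieces, in terms of chords. -/
theorem sum_pieceSign (hf : f.IsTrainTrackMap) (he : IsEmbeddingHeight f ht)
    {η ζ : f.trainTrack.Branch → ℝ} (hη : η ∈ f.trainTrack.measures)
    (hζ : ζ ∈ f.trainTrack.measures) :
    ∑ x : f.Strand, ∑ y : f.Strand, O.pieceSign ht x y * (realWeight η x.1 * realWeight ζ y.1) =
      ∑ k : f.Chord, ∑ l : f.Chord,
        O.pieceSign ht k.base l.base * (k.weight η * l.weight ζ) := by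
  have hout : ∀ d : G.Dart, f.gate d (Quotient.out (f.trainTrack.switch d)) := fun d =>
    switch_eq_iff.1 (switch_out _).symm
  -- Strands are traded for chords one variable at a time; the sign is constant on gates because the
  -- piece of the fixed `y` has an end in another gate.
  have h1 : ∀ y : f.Strand,
      ∑ x : f.Strand, O.pieceSign ht x y * (realWeight η x.1 * realWeight ζ y.1) =
        ∑ k : f.Chord, O.pieceSign ht k.base y * realWeight ζ y.1 * k.weight η := by
    intro y
    rw [← sum_strand_eq_sum_chord hη fun x => O.pieceSign ht x y * realWeight ζ y.1]
    · exact Finset.sum_congr rfl fun x _ => by ring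
    · intro d
      by_cases hy : realWeight ζ y.1 = 0
      · rw [hy, mul_zero, mul_zero]
      · obtain ⟨z, hz, hg⟩ := good_strand hf hζ hy
        rw [pieceSign_congr he (hout d) hz hg]
  rw [Finset.sum_comm]
  simp only [h1]
  rw [Finset.sum_comm]
  refine Finset.sum_congr rfl fun k _ => ?_
  -- In the second variable the fixed object is the chord `k`, whose own two ends lie in different
  -- gates.
  have h2 := sum_strand_eq_sum_chord hζ (fun y => O.pieceSign ht k.base y * k.weight η) fun d => by
    by_cases hk : k.weight η = 0
    · rw [hk, mul_zero, mul_zero]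
    · have hj := Chord.joined_start hf hk
      rw [pieceSign_swap, pieceSign_congr he (hout d) (Chord.samePiece_inv k hk) hj.1, ← pieceSign_swap]
  refine Eq.trans (Finset.sum_congr rfl fun y _ => ?_)
    (h2.trans (Finset.sum_congr rfl fun l _ => ?_)) <;> ring

end GateOrder

open Classical in
theorem sum_mul_chordWeight (η : f.trainTrack.Branch → ℝ) (g : f.trainTrack.Switch)
    (φ : f.trainTrack.Switch → ℝ) :
    ∑ h, φ h * chordWeight η g h =
      ∑ k : f.Chord, if k.start = g then φ (Chord.inv k).start * k.weight η else 0 := by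
  simp only [chordWeight, Finset.mul_sum]
  rw [Finset.sum_comm]
  refine Finset.sum_congr rfl fun k _ => ?_
  by_cases hk : k.start = g <;> simp [hk]

namespace GateOrder

variable {O : f.GateOrder} {ht : f.Strand → ℝ}

open Classical in
theorem sum_orient_chordWeight (η ζ : f.trainTrack.Branch → ℝ) :
    ∑ g, ∑ h, ∑ l, orient (O.gatePos g) (O.gatePos h) (O.gatePos l) *
      (chordWeight η g h * chordWeight ζ g l) =
    ∑ k : f.Chord, ∑ l : f.Chord, (if k.start = l.start then
      orient (O.gatePos k.start) (O.gatePos (Chord.inv k).start) (O.gatePos (Chord.inv l).start)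
        else 0) * (k.weight η * l.weight ζ) := by
  have h1 : ∀ g h, ∑ l, orient (O.gatePos g) (O.gatePos h) (O.gatePos l) *
      (chordWeight η g h * chordWeight ζ g l) =
      (∑ l : f.Chord, if l.start = g then
        orient (O.gatePos g) (O.gatePos h) (O.gatePos (Chord.inv l).start) * l.weight ζ else 0) *
        chordWeight η g h := by
    intro g h
    rw [← sum_mul_chordWeight ζ g fun l => orient (O.gatePos g) (O.gatePos h) (O.gatePos l),
      Finset.sum_mul]
    exact Finset.sum_congr rfl fun l _ => by ring
  simp only [h1]
  simp only [sum_mul_chordWeight η _ fun h => ∑ l : f.Chord, if l.start = _ then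
        orient (O.gatePos _) (O.gatePos h) (O.gatePos (Chord.inv l).start) * l.weight ζ else 0]
  rw [Finset.sum_comm]
  refine Finset.sum_congr rfl fun k _ => ?_
  simp only [Finset.sum_ite_eq, Finset.mem_univ, if_true, Finset.sum_mul]
  refine Finset.sum_congr rfl fun l _ => ?_
  simp only [eq_comm (a := l.start)]
  split_ifs <;> ring

end GateOrder

end GraphMap

/-! ### Pairs inside one piece, and cancellation between different pieces -/

namespace GraphMap

open RibbonGraph List

variable {G : RibbonGraph} {f : GraphMap G}

namespace GateOrder

variable {O : f.GateOrder} {ht : f.Strand → ℝ}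

/-- The embedding preserves only cyclic orders, so `d` and `d'` are compared against a dart `e` in
another gate. The image of `e` lies outside the image gate, and the cyclic order of the three then
fixes the linear order of the first two. -/
theorem strandPos_firstStrand_lt (hf : f.IsTrainTrackMap) (he : IsEmbeddingHeight f ht)
    {d d' : G.Dart} (hg : f.gate d d') (hlt : O.pos d < O.pos d') :
    O.strandPos ht (f.firstStrand d) < O.strandPos ht (f.firstStrand d') := by
  have hne : d ≠ d' := fun h => hlt.ne (congrArg _ h)
  obtain ⟨e, ve, hn⟩ := hf.exists_not_gate hg.1 hne
  have h1 := O.pos_lt_iff_of_gate hg hn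
  have h2 : O.pos d ≠ O.pos e := fun h' => hn (O.inj h' ▸ f.gate.refl _)
  have hc : G.Ccw d d' e := by
    rw [O.ccw_iff hg.1 ve]
    simp only [Cyc]
    omega
  have hk := he.first O.toDartOrder _ _ _ hc
  have hs := strandGate_firstStrand_eq (O := O) hg
  have h3 : O.strandGate (f.firstStrand d) ≠ O.strandGate (f.firstStrand e) := by
    rw [Ne, strandGate_eq_iff, over_firstStrand, over_firstStrand, gate_init_iff ve]
    exact hn
  rcases lt_or_gt_of_ne h3 with h | h
  · have l1 := strandPos_lt (ht := ht) h
    have l2 := strandPos_lt (ht := ht) (hs ▸ h)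
    unfold Cyc at hk
    grind
  · have l1 := strandPos_lt (ht := ht) h
    have l2 := strandPos_lt (ht := ht) (hs ▸ h)
    unfold Cyc at hk
    grind

/-- The map on gates is injective at a vertex, and the embedding of the vertex disc preserves
orientation. -/
theorem orient_switchMap (he : IsEmbeddingHeight f ht) {g h k : f.trainTrack.Switch}
    (h1 : G.SameVertex (Quotient.out g) (Quotient.out h))
    (h2 : G.SameVertex (Quotient.out g) (Quotient.out k)) :
    orient (O.gatePos (f.switchMap g)) (O.gatePos (f.switchMap h)) (O.gatePos (f.switchMap k)) =
      orient (O.gatePos g) (O.gatePos h) (O.gatePos k) := by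
  have pos : ∀ {a b : f.trainTrack.Switch}, G.SameVertex (Quotient.out a) (Quotient.out b) →
      a ≠ b → f.switchMap a ≠ f.switchMap b := by
    intro a b hv hab hs
    rw [← switch_out a, ← switch_out b, switchMap_switch, switchMap_switch, switch_eq_iff,
      gate_init_iff hv, ← switch_eq_iff, switch_out, switch_out] at hs
    exact hab hs
  have sg : ∀ a : f.trainTrack.Switch,
      O.strandGate (f.firstStrand (Quotient.out a)) = O.gatePos (f.switchMap a) := fun a => by
    rw [strandGate, over_firstStrand, ← switchMap_switch, switch_out]
  have key : ∀ {a b c : f.trainTrack.Switch}, G.SameVertex (Quotient.out a) (Quotient.out b) →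
      G.SameVertex (Quotient.out a) (Quotient.out c) →
      Cyc (O.gatePos a) (O.gatePos b) (O.gatePos c) →
      Cyc (O.gatePos (f.switchMap a)) (O.gatePos (f.switchMap b)) (O.gatePos (f.switchMap c)) := by
    intro a b c v1 v2 hc
    have hk := he.first O.toDartOrder _ _ _ ((O.ccw_iff v1 v2).2 hc)
    refine (Cyc.total (O.gatePos_injective.ne ?_) (O.gatePos_injective.ne ?_)
      (O.gatePos_injective.ne ?_)).resolve_right fun h' => ?_
    · exact pos v1 fun h => hc.ne_left (h ▸ rfl)
    · exact pos (v1.symm.trans v2) fun h => hc.rotate.ne_left (h ▸ rfl)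
    · exact pos v2.symm fun h => hc.rotate.rotate.ne_left (h ▸ rfl)
    · refine hk.asymm ?_
      rw [← sg, ← sg, ← sg] at h'
      exact h'.imp (fun h => ⟨strandPos_lt h.1, strandPos_lt h.2⟩)
        (Or.imp (fun h => ⟨strandPos_lt h.1, strandPos_lt h.2⟩)
          fun h => ⟨strandPos_lt h.1, strandPos_lt h.2⟩)
  rcases eq_or_ne g h with rfl | n1
  · rw [orient_self_left, orient_self_left]
  rcases eq_or_ne h k with rfl | n2
  · rw [orient_self_right, orient_self_right]
  rcases eq_or_ne k g with rfl | n3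
  · rw [orient_self_outer, orient_self_outer]
  rcases Cyc.total (O.gatePos_injective.ne n1) (O.gatePos_injective.ne n2)
    (O.gatePos_injective.ne n3) with hc | hc
  · rw [hc.orient_eq, (key h1 h2 hc).orient_eq]
  · have hc' := hc.rotate.rotate
    rw [orient_swap, orient_swap (O.gatePos g), hc'.orient_eq, (key h2 h1 hc').orient_eq]

open Classical in
theorem samePiece_strandSign_firstStrand (hf : f.IsTrainTrackMap) (he : IsEmbeddingHeight f ht)
    (d d' : G.Dart) :
    (if f.SamePiece (f.firstStrand d) (f.firstStrand d') then
      O.strandSign ht (f.firstStrand d) (f.firstStrand d') else 0) =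
    if f.trainTrack.switch d = f.trainTrack.switch d' then pairSign (O.pos d) (O.pos d') else 0 := by
  by_cases hg : f.gate d d'
  · rw [if_pos (samePiece_firstStrand hg.1), if_pos (switch_eq_iff.2 hg), strandSign,
      if_pos (strandGate_firstStrand_eq hg)]
    rcases lt_trichotomy (O.pos d) (O.pos d') with h | h | h
    · rw [pairSign_of_lt h, pairSign_of_lt (strandPos_firstStrand_lt hf he hg h)]
    · rw [O.inj h, pairSign_self, pairSign_self]
    · rw [pairSign_of_gt h, pairSign_of_gt (strandPos_firstStrand_lt hf he (f.gate.symm hg) h)]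
  · rw [if_neg fun h => hg (switch_eq_iff.1 h)]
    split_ifs with hp
    · have hv : G.SameVertex d d' := by
        rcases samePiece_iff.1 hp with h | ⟨-, -, h⟩ | ⟨h, -⟩
        · obtain rfl : d = d' := congrArg Sigma.fst h
          exact Equiv.Perm.SameCycle.refl _ _
        · exact h
        · exact absurd h (lt_irrefl _)
      rw [strandSign, if_neg]
      rw [strandGate_eq_iff, over_firstStrand, over_firstStrand, gate_init_iff hv]
      exact hg
    · rfl

theorem not_samePiece_firstStrand {x : f.Strand} (hx : 0 < (x.2 : ℕ)) (d : G.Dart) :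
    ¬ f.SamePiece (f.firstStrand d) x := by
  intro h
  rcases samePiece_iff.1 h with h | ⟨-, h, -⟩ | ⟨h, -⟩
  · exact hx.ne' (by rw [← h]; rfl)
  · exact hx.ne' h
  · exact absurd h (lt_irrefl _)

open Classical in
-- The two ends of a band are in different gates, so bands contribute nothing. The first strands at
-- a vertex reproduce the signs of the darts themselves.
theorem sum_samePiece_strandSign (hf : f.IsTrainTrackMap) (he : IsEmbeddingHeight f ht)
    (η ζ : f.trainTrack.Branch → ℝ) :
    (∑ x : f.Strand, ∑ y : f.Strand, (if f.SamePiece x y then O.strandSign ht x y else 0) *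
      (realWeight η x.1 * realWeight ζ y.1)) =
    ∑ d, ∑ d', if f.trainTrack.switch d = f.trainTrack.switch d' then
      pairSign (O.pos d) (O.pos d') * (realWeight η d * realWeight ζ d') else 0 := by
  rw [sum_strand]
  have h0 : ∀ x : {x : f.Strand // 0 < (x.2 : ℕ)}, (∑ y : f.Strand,
      (if f.SamePiece x y then O.strandSign ht x y else 0) *
        (realWeight η x.1.1 * realWeight ζ y.1)) = 0 := by
    intro x
    refine Finset.sum_eq_zero fun y _ => ?_
    split_ifs with h
    · rcases samePiece_iff.1 h with h | ⟨h, -⟩ | ⟨-, h⟩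
      · rw [← h, strandSign, pairSign_self, ite_self, zero_mul]
      · exact absurd h x.2.ne'
      · rw [h, strandSign, if_neg, zero_mul]
        rw [strandGate_eq_iff]
        exact hf.not_gate_partner x.2
    · rw [zero_mul]
  rw [Finset.sum_eq_zero fun x _ => h0 x, add_zero]
  refine Finset.sum_congr rfl fun d _ => ?_
  rw [sum_strand, add_eq_left.2]
  · refine Finset.sum_congr rfl fun d' _ => ?_
    rw [samePiece_strandSign_firstStrand hf he, ite_mul, zero_mul]
    rfl
  · refine Finset.sum_eq_zero fun y _ => ?_
    rw [if_neg (not_samePiece_firstStrand y.2 d), zero_mul]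

open Classical in
-- A band gives only degenerate orientations. Images of infinitesimal edges at one vertex start at
-- one gate only if the originals did, and then their orientations agree.
theorem sum_samePiece_orient (hf : f.IsTrainTrackMap) (he : IsEmbeddingHeight f ht)
    (η ζ : f.trainTrack.Branch → ℝ) :
    (∑ k : f.Chord, ∑ l : f.Chord, (if f.SamePiece k.base l.base then
      (if k.start = l.start then orient (O.gatePos k.start) (O.gatePos (Chord.inv k).start)
        (O.gatePos (Chord.inv l).start) else 0) else 0) * (k.weight η * l.weight ζ)) =
    ∑ g, ∑ h, ∑ k, orient (O.gatePos g) (O.gatePos h) (O.gatePos k) *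
        (f.trainTrack.infWeight η g h * f.trainTrack.infWeight ζ g k) := by
  rw [Fintype.sum_sum_type, add_eq_right.2]
  rotate_left
  · refine Finset.sum_eq_zero fun x _ => Finset.sum_eq_zero fun l _ => ?_
    split_ifs with h1 h2
    · rcases l with y | q
      · rcases samePiece_iff.1 h1 with h | ⟨h, -⟩ | ⟨-, h⟩
        · obtain rfl : x = y := Subtype.ext h
          rw [orient_self_right, zero_mul]
        · exact absurd h x.2.ne'
        · exfalso
          change (y : f.Strand) = _ at h
          change f.trainTrack.switch x.1.over = f.trainTrack.switch y.1.over at h2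
          rw [h] at h2
          exact hf.not_gate_partner x.2 (switch_eq_iff.1 h2)
      · exact absurd h1.symm (not_samePiece_firstStrand x.2 _)
    · rw [zero_mul]
    · rw [zero_mul]
  rw [Fintype.sum_prod_type]
  refine Finset.sum_congr rfl fun g _ => Finset.sum_congr rfl fun h _ => ?_
  rw [Fintype.sum_sum_type, add_eq_right.2]
  rotate_left
  · refine Finset.sum_eq_zero fun y _ => ?_
    have hn : ¬ f.SamePiece (Chord.base (Sum.inr (g, h) : f.Chord)) (Chord.base (Sum.inl y)) :=
      not_samePiece_firstStrand y.2 _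
    rw [if_neg hn, zero_mul]
  rw [Fintype.sum_prod_type, Finset.sum_eq_single g]
  rotate_left
  · intro g' _ hne
    refine Finset.sum_eq_zero fun l _ => ?_
    split_ifs with h1 h2
    · exfalso
      rw [Chord.start_inr, Chord.start_inr] at h2
      simp only at h2
      have hv : G.SameVertex (Quotient.out g) (Quotient.out g') := by
        rcases samePiece_iff.1 h1 with h | ⟨-, -, h⟩ | ⟨h, -⟩
        · have : Quotient.out g = Quotient.out g' := congrArg Sigma.fst h
          rw [this]
          exact Equiv.Perm.SameCycle.refl _ _
        · exact h
        · exact absurd h (lt_irrefl _)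
      rw [← switch_out g, ← switch_out g', switchMap_switch, switchMap_switch, switch_eq_iff,
        gate_init_iff hv, ← switch_eq_iff, switch_out, switch_out] at h2
      exact hne h2.symm
    · rw [zero_mul]
    · rw [zero_mul]
  · intro h'
    exact absurd (Finset.mem_univ _) h'
  refine Finset.sum_congr rfl fun l _ => ?_
  have hp : f.SamePiece (Chord.base (Sum.inr (g, h) : f.Chord)) (Chord.base (Sum.inr (g, l))) :=
    samePiece_iff.2 (Or.inl rfl)
  have hq : Chord.start (Sum.inr (g, h) : f.Chord) = Chord.start (Sum.inr (g, l)) := rfl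
  rw [if_pos hp, if_pos hq]
  by_cases w1 : f.trainTrack.infWeight η g h = 0
  · change _ * (f.trainTrack.infWeight η g h * _) = _
    rw [w1, zero_mul, mul_zero, zero_mul, mul_zero]
  by_cases w2 : f.trainTrack.infWeight ζ g l = 0
  · change _ * (_ * f.trainTrack.infWeight ζ g l) = _
    rw [w2, mul_zero, mul_zero, mul_zero, mul_zero]
  have v1 := f.trainTrack.joined_vertex _ _ (joined_of_infWeight_ne_zero w1)
  have v2 := f.trainTrack.joined_vertex _ _ (joined_of_infWeight_ne_zero w2)
  rw [← orient_switchMap he v1 v2, Chord.start_inr]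
  change orient _ (O.gatePos (Chord.start (Sum.inr (h, g))))
    (O.gatePos (Chord.start (Sum.inr (l, g)))) * _ = _
  rw [Chord.start_inr, Chord.start_inr]
  rfl

open Classical in
/-- The contribution of the initial ends of two chords in different pieces. -/
def chordPairing (O : f.GateOrder) (ht : f.Strand → ℝ) (k l : f.Chord) : ℝ :=
  if f.SamePiece k.base l.base then 0 else
    endPairing (O.strandPos ht k.base) (O.gatePos k.start) (O.gatePos (Chord.inv k).start)
      (O.strandPos ht l.base) (O.gatePos l.start) (O.gatePos (Chord.inv l).start)

/-- Chords in different pieces at one vertex do not cross, which is the hypothesis of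
`endPairing_sum_eq_zero`; chords at different vertices share no gate. -/
theorem chordPairing_add_eq_zero (hf : f.IsTrainTrackMap) (he : IsEmbeddingHeight f ht)
    {η ζ : f.trainTrack.Branch → ℝ} {k l : f.Chord} (hk : k.weight η ≠ 0) (hl : l.weight ζ ≠ 0) :
    O.chordPairing ht k l + O.chordPairing ht (Chord.inv k) l +
      O.chordPairing ht k (Chord.inv l) + O.chordPairing ht (Chord.inv k) (Chord.inv l) = 0 := by
  have sk := k.samePiece_inv hk
  have sl := l.samePiece_inv hl
  have gk := (Chord.joined_start hf hk).1
  have gl := (Chord.joined_start hf hl).1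
  unfold chordPairing
  rw [Chord.inv_inv, Chord.inv_inv]
  by_cases hs : f.SamePiece k.base l.base
  · rw [if_pos hs, if_pos (sk.symm.trans hs), if_pos (hs.trans sl),
      if_pos (sk.symm.trans (hs.trans sl))]
    norm_num
  have h1 : ¬ f.SamePiece (Chord.inv k).base l.base := fun h => hs (sk.trans h)
  have h2 : ¬ f.SamePiece k.base (Chord.inv l).base := fun h => hs (h.trans sl.symm)
  have h3 : ¬ f.SamePiece (Chord.inv k).base (Chord.inv l).base := fun h => h1 (h.trans sl.symm)
  rw [if_neg hs, if_neg h1, if_neg h2, if_neg h3]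
  by_cases hv : G.SameVertex k.base.over l.base.over
  · have ne : ∀ {x y : f.Strand}, ¬ f.SamePiece x y → O.strandPos ht x ≠ O.strandPos ht y :=
      fun h h' => h (samePiece_iff.2 (Or.inl (key_injective O.toDartOrder he h')))
    exact endPairing_sum_eq_zero (fun h => gk (strandGate_eq_iff.1 h))
      (fun h => gl (strandGate_eq_iff.1 h)) (ne hs) (ne h2) (ne h1) (ne h3)
      strandPos_lt strandPos_lt strandPos_lt strandPos_lt strandPos_lt strandPos_lt strandPos_lt
      strandPos_lt strandPos_lt strandPos_lt strandPos_lt strandPos_lt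
      (he.noncrossing O.toDartOrder _ _ _ _ sk sl hs hv)
      (he.noncrossing O.toDartOrder _ _ _ _ sk sl.symm h2 (hv.trans sl.sameVertex))
  · have hn : ∀ {x y : f.Strand}, G.SameVertex k.base.over x.over →
        G.SameVertex l.base.over y.over →
        O.strandGate x ≠ O.strandGate y := fun hx hy h =>
      hv (hx.trans ((strandGate_eq_iff.1 h).1.trans hy.symm))
    have r : ∀ d : G.Dart, G.SameVertex d d := fun d => Equiv.Perm.SameCycle.refl _ _
    unfold endPairing
    have a1 : O.gatePos k.start ≠ O.gatePos l.start := hn (r _) (r _)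
    have a2 : O.gatePos (Chord.inv k).start ≠ O.gatePos l.start := hn sk.sameVertex (r _)
    have a3 : O.gatePos k.start ≠ O.gatePos (Chord.inv l).start := hn (r _) sl.sameVertex
    have a4 : O.gatePos (Chord.inv k).start ≠ O.gatePos (Chord.inv l).start :=
      hn sk.sameVertex sl.sameVertex
    rw [if_neg a1, if_neg a2, if_neg a3, if_neg a4]
    norm_num

/-- Reversing chords preserves weights, so the four sums over choices of ends are all equal, and
their total vanishes term by term. -/
theorem sum_chordPairing (hf : f.IsTrainTrackMap) (he : IsEmbeddingHeight f ht)
    (η ζ : f.trainTrack.Branch → ℝ) :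
    ∑ k : f.Chord, ∑ l : f.Chord, O.chordPairing ht k l * (k.weight η * l.weight ζ) = 0 := by
  set s := ∑ k : f.Chord, ∑ l : f.Chord, O.chordPairing ht k l * (k.weight η * l.weight ζ) with hs
  have h1 : ∑ k : f.Chord, ∑ l : f.Chord,
      O.chordPairing ht (Chord.inv k) l * (k.weight η * l.weight ζ) = s :=
    Fintype.sum_equiv Chord.inv _ _ fun k => by rw [Chord.weight_inv]
  have h2 : ∑ k : f.Chord, ∑ l : f.Chord,
      O.chordPairing ht k (Chord.inv l) * (k.weight η * l.weight ζ) = s :=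
    Finset.sum_congr rfl fun k _ => Fintype.sum_equiv Chord.inv _ _ fun l => by
      rw [Chord.weight_inv]
  have h3 : ∑ k : f.Chord, ∑ l : f.Chord,
      O.chordPairing ht (Chord.inv k) (Chord.inv l) * (k.weight η * l.weight ζ) = s :=
    Fintype.sum_equiv Chord.inv _ _ fun k => Fintype.sum_equiv Chord.inv _ _ fun l => by
      rw [Chord.weight_inv, Chord.weight_inv]
  have h4 : (∑ k : f.Chord, ∑ l : f.Chord, O.chordPairing ht k l * (k.weight η * l.weight ζ)) +
      (∑ k : f.Chord, ∑ l : f.Chord,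
        O.chordPairing ht (Chord.inv k) l * (k.weight η * l.weight ζ)) +
      (∑ k : f.Chord, ∑ l : f.Chord,
        O.chordPairing ht k (Chord.inv l) * (k.weight η * l.weight ζ)) +
      (∑ k : f.Chord, ∑ l : f.Chord,
        O.chordPairing ht (Chord.inv k) (Chord.inv l) * (k.weight η * l.weight ζ)) = 0 := by
    simp only [← Finset.sum_add_distrib, ← add_mul]
    refine Finset.sum_eq_zero fun k _ => Finset.sum_eq_zero fun l _ => ?_
    by_cases hk : k.weight η = 0
    · rw [hk, zero_mul, mul_zero]
    by_cases hl : l.weight ζ = 0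
    · rw [hl, mul_zero, mul_zero]
    rw [chordPairing_add_eq_zero hf he hk hl, zero_mul]
  linarith

end GateOrder

/-- The map `f_*` preserves the skew-symmetric form on the measures of the train track. -/
theorem form_pushMeasure (hf : f.IsTrainTrackMap) (hemb : f.IsEmbedded)
    {η ζ : f.trainTrack.Branch → ℝ} (hη : η ∈ f.trainTrack.measures)
    (hζ : ζ ∈ f.trainTrack.measures) :
    f.trainTrack.form (f.pushMeasure η) (f.pushMeasure ζ) = f.trainTrack.form η ζ := by
  classical
  obtain ⟨O', hO⟩ := exists_gateOrder hemb
  obtain ⟨ht, he⟩ := isEmbedded_iff.1 hemb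
  let O : f.GateOrder := ⟨O', fun {a b e} => hO a b e⟩
  have e1 := O.two_mul_form hf (f.pushMeasure η) (f.pushMeasure ζ)
  have e2 := O.two_mul_form hf η ζ
  simp only [infWeight_pushMeasure hf] at e1
  rw [GateOrder.sum_pairSign_pushMeasure (ht := ht) he, GateOrder.sum_orient_chordWeight] at e1
  rw [← GateOrder.sum_samePiece_strandSign (ht := ht) hf he,
    ← GateOrder.sum_samePiece_orient (ht := ht) hf he] at e2
  have e3 : (∑ x : f.Strand, ∑ y : f.Strand,
        O.strandSign ht x y * (realWeight η x.1 * realWeight ζ y.1)) =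
      (∑ k : f.Chord, ∑ l : f.Chord,
        O.pieceSign ht k.base l.base * (k.weight η * l.weight ζ)) +
      ∑ x : f.Strand, ∑ y : f.Strand, (if f.SamePiece x y then O.strandSign ht x y else 0) *
        (realWeight η x.1 * realWeight ζ y.1) := by
    rw [← GateOrder.sum_pieceSign hf he hη hζ]
    simp only [← Finset.sum_add_distrib, ← add_mul]
    refine Finset.sum_congr rfl fun x _ => Finset.sum_congr rfl fun y _ => ?_
    congr 1
    unfold GateOrder.pieceSign
    split_ifs <;> ring
  have e4 := GateOrder.sum_chordPairing (O := O) (ht := ht) hf he η ζ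
  -- Between different pieces the orientation term is the full pairing of ends minus the sign at the
  -- common gate. The latter sum cancels the one from `e3`, and the full pairing vanishes by `e4`.
  have e5 : (∑ k : f.Chord, ∑ l : f.Chord, (if k.start = l.start then
      orient (O.gatePos k.start) (O.gatePos (Chord.inv k).start) (O.gatePos (Chord.inv l).start)
        else 0) * (k.weight η * l.weight ζ)) =
      (∑ k : f.Chord, ∑ l : f.Chord, (if f.SamePiece k.base l.base then
      (if k.start = l.start then orient (O.gatePos k.start) (O.gatePos (Chord.inv k).start)
        (O.gatePos (Chord.inv l).start) else 0) else 0) * (k.weight η * l.weight ζ)) +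
      ((∑ k : f.Chord, ∑ l : f.Chord, O.chordPairing ht k l * (k.weight η * l.weight ζ)) -
      ∑ k : f.Chord, ∑ l : f.Chord,
        O.pieceSign ht k.base l.base * (k.weight η * l.weight ζ)) := by
    simp only [← Finset.sum_add_distrib, ← Finset.sum_sub_distrib, ← add_mul, ← sub_mul]
    refine Finset.sum_congr rfl fun k _ => Finset.sum_congr rfl fun l _ => ?_
    congr 1
    have hiff : O.gatePos k.start = O.gatePos l.start ↔ k.start = l.start :=
      O.gatePos_injective.eq_iff
    have hiff' : O.strandGate k.base = O.strandGate l.base ↔ k.start = l.start :=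
      O.gatePos_injective.eq_iff
    unfold GateOrder.pieceSign GateOrder.chordPairing endPairing GateOrder.strandSign
    simp only [hiff, hiff']
    split_ifs <;> ring
  linarith

end GraphMap

/-! ### The radical as the image of a kernel -/

namespace TrainTrack

variable {G : RibbonGraph} (τ : TrainTrack G)

theorem form_skew (η ζ : τ.Branch → ℝ) : τ.form η ζ = -τ.form ζ η := by
  simp only [form, ← mul_neg, ← Finset.sum_neg_distrib, neg_add]
  congr 1
  refine Finset.sum_congr rfl fun g _ => ?_
  congr 1 <;>
  · refine Finset.sum_congr rfl fun d _ => Finset.sum_congr rfl fun d' _ => ?_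
    split_ifs <;> ring

/-- The skew-symmetric form on `W(τ)`, as a bilinear map. -/
def measureForm : τ.measures →ₗ[ℝ] τ.measures →ₗ[ℝ] ℝ :=
  LinearMap.mk₂ ℝ (fun η ζ => τ.form η ζ)
    (fun a b c => by
      rw [τ.form_skew, τ.form_skew a, τ.form_skew b, Submodule.coe_add, form_add, neg_add])
    (fun r a b => by
      rw [τ.form_skew, τ.form_skew a, Submodule.coe_smul, form_smul, smul_eq_mul, mul_neg])
    (fun a b c => τ.form_add b c a) (fun r a b => τ.form_smul r b a)

/-- Ranging over all lifts of all elements of `W` is the same as ranging over all measures, so `Z`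
is the collapse of the kernel of a bilinear form on `W(τ)`. -/
theorem mem_Z_iff {η : τ.W} :
    η ∈ τ.Z ↔ ∃ η' : τ.measures, τ.collapse η' = η ∧ τ.measureForm η' = 0 := by
  constructor
  · rintro ⟨η', hm, hc, h⟩
    refine ⟨⟨η', hm⟩, hc, LinearMap.ext fun ζ => ?_⟩
    change τ.form η' ζ = 0
    rw [form_skew, h _ ⟨ζ, ζ.2, rfl⟩ ζ ζ.2 rfl, neg_zero]
  · rintro ⟨η', hc, h⟩
    refine ⟨η', η'.2, hc, fun ζ _ ζ' hm _ => ?_⟩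
    rw [form_skew, neg_eq_zero]
    exact LinearMap.congr_fun h ⟨ζ', hm⟩

end TrainTrack

/-! ### Invariance of the two subspaces, iterates and their polynomials -/

namespace GraphMap

variable {G : RibbonGraph} {f : GraphMap G}

/-- Both parts follow upstairs: `pushMeasure` lifts `f_*` to `W(τ)` and preserves the form there,
hence its kernel. -/
theorem preservesWZ (hf : f.IsTrainTrackMap) (hemb : f.IsEmbedded) : f.PreservesWZ where
  mapsW := by
    rintro _ ⟨η, hη, rfl⟩
    exact ⟨f.pushMeasure η, pushMeasure_mem hf hη, rfl⟩
  mapsZ := by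
    intro η hη
    obtain ⟨η', hc, h⟩ := f.trainTrack.mem_Z_iff.1 hη
    refine f.trainTrack.mem_Z_iff.2
      ⟨f.pushMeasure.restrict (fun _ h => pushMeasure_mem hf h) η', ?_,
        LinearMap.apply_eq_zero_of_preserves_form _ _ (fun x y => ?_) h⟩
    · exact congrArg f.push hc
    · exact form_pushMeasure hf hemb x.2 y.2

theorem IsEmbedded.iterate (h : f.IsEmbedded) {n : ℕ} (hn : 0 < n) : (f.iterate n).IsEmbedded := by
  induction n, hn using Nat.le_induction with
  | base =>
    change (f.iterate 1).IsEmbedded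
    rwa [iterate_one]
  | succ n _ ih => exact h.comp ih

theorem Represents.iterate {S : Type*} [TopologicalSpace S] {ι : G.Surface ≃ₜ S} {F : S ≃ₜ S}
    (hf : f.Represents ι F) {n : ℕ} (hn : 0 < n) : (f.iterate n).Represents ι (F ^ n) where
  pseudoAnosov := hf.pseudoAnosov.pow hn
  trainTrack := hf.trainTrack.iterate hn
  embedded := hf.embedded.iterate hn
  homotopic := by
    obtain ⟨φ, hφ, hF⟩ := hf.homotopic
    induction n, hn using Nat.le_induction with
    | base =>
      refine ⟨φ, ?_, ?_⟩
      · change (f.iterate 1).Realizes φ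
        rwa [iterate_one]
      · simpa only [zero_add, pow_one] using hF
    | succ n _ ih =>
      obtain ⟨ψ, hψ, hFn⟩ := ih
      refine ⟨φ.comp ψ, hφ.comp hψ, ?_⟩
      -- With `ψ` realizing `f^n`, the map `F^(n+1) ∘ ι` is homotopic to `F ∘ ι ∘ ψ`, and that to `ι
      -- ∘ φ ∘ ψ`.
      have h1 := (ContinuousMap.Homotopic.refl (⟨F, F.continuous⟩ : C(S, S))).comp hFn
      have h2 := hF.comp (ContinuousMap.Homotopic.refl ψ)
      convert h1.trans h2 using 1
      · ext x
        change (F ^ (n + 1)) (ι x) = F ((F ^ n) (ι x))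
        rw [pow_succ']
        rfl
      · rfl

/-- The polynomials of a map `f`, computed from a linear map that is equal to `f_*` on a train
track that is equal to that of `f`. -/
theorem exists_preserves_of_eq (h : f.PreservesWZ) {τ : TrainTrack G} (hτ : f.trainTrack = τ)
    {p : G.Weights →ₗ[ℝ] G.Weights} (hp : f.push = p) :
    ∃ (hW : ∀ η ∈ τ.W, p η ∈ τ.W) (hZ : ∀ η ∈ τ.Z, p.restrict hW η ∈ τ.Z),
      f.symplecticPoly h = (τ.Z.mapQ τ.Z (p.restrict hW) hZ).charpoly ∧
      f.puncturePoly h = ((p.restrict hW).restrict hZ).charpoly := by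
  subst hτ hp
  exact ⟨h.mapsW, h.mapsZ, rfl, rfl⟩

theorem homologyPoly_eq_mul (h : f.PreservesWZ) :
    f.homologyPoly h = f.puncturePoly h * f.symplecticPoly h :=
  LinearMap.charpoly_eq_restrict_mul_mapQ f.Z (f.push.restrict h.mapsW) h.mapsZ

/-- The spaces on which `(f^n)_*` acts depend on the track of `f^n`, so the equality of tracks is
substituted before restriction and quotient are commuted with powers. -/
theorem IsTrainTrackMap.polys_iterate (hf : f.IsTrainTrackMap) {n : ℕ} (hn : 0 < n)
    (h : f.PreservesWZ) (h' : (f.iterate n).PreservesWZ) :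
    (f.iterate n).symplecticPoly h' =
        (f.Z.mapQ f.Z (f.push.restrict h.mapsW) h.mapsZ ^ n).charpoly ∧
      (f.iterate n).puncturePoly h' =
        (((f.push.restrict h.mapsW).restrict h.mapsZ) ^ n).charpoly := by
  obtain ⟨hW, hZ, h1, h2⟩ :=
    exists_preserves_of_eq h' (hf.trainTrack_iterate hn) (f.push_iterate n)
  have e : (f.push ^ n).restrict hW = f.push.restrict h.mapsW ^ n :=
    (Module.End.pow_restrict n h.mapsW hW).symm
  rw [h1, h2]
  constructor
  · congr 1
    rw [← Submodule.mapQ_pow]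
    congr 1
  · congr 1
    rw [Module.End.pow_restrict n h.mapsZ]
    congr 1

end GraphMap

theorem mainTheorem12 (G : RibbonGraph) (f : GraphMap G) {S : Type*} [TopologicalSpace S]
    (ι : G.Surface ≃ₜ S) (F : S ≃ₜ S) (hf : f.Represents ι F) (n : ℕ) (hn : 0 < n) :
    (f.iterate n).Represents ι (F ^ n) ∧
    (f.iterate n).trainTrack = f.trainTrack ∧
    ∃ (h : f.PreservesWZ) (h' : (f.iterate n).PreservesWZ),
      ∀ (k m : ℕ) (z : Fin k → ℂ) (w : Fin m → ℂ),
        (f.symplecticPoly h).map (algebraMap ℝ ℂ) = ∏ i, (X - C (z i)) →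
        (f.puncturePoly h).map (algebraMap ℝ ℂ) = ∏ j, (X - C (w j)) →
        ((f.iterate n).symplecticPoly h').map (algebraMap ℝ ℂ) = ∏ i, (X - C (z i ^ n)) ∧
        ((f.iterate n).puncturePoly h').map (algebraMap ℝ ℂ) = ∏ j, (X - C (w j ^ n)) ∧
        ((f.iterate n).homologyPoly h').map (algebraMap ℝ ℂ) =
          (∏ i, (X - C (z i ^ n))) * ∏ j, (X - C (w j ^ n)) := by
  have h := GraphMap.preservesWZ hf.trainTrack hf.embedded
  have hr := hf.iterate hn
  have h' := GraphMap.preservesWZ hr.trainTrack hr.embedded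
  refine ⟨hr, hf.trainTrack.trainTrack_iterate hn, h, h', fun k m z w hz hw => ?_⟩
  obtain ⟨hs, hp⟩ := hf.trainTrack.polys_iterate hn h h'
  have hs' := LinearMap.charpoly_pow_eq_prod _ z hz hn
  have hp' := LinearMap.charpoly_pow_eq_prod _ w hw hn
  rw [← hs] at hs'
  rw [← hp] at hp'
  refine ⟨hs', hp', ?_⟩
  rw [GraphMap.homologyPoly_eq_mul, Polynomial.map_mul, hs', hp', mul_comm]

end
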